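/- Let $X$ be a compact complex manifold, $\dim_{\mathbb C}X=n$. A $C^\infty$ positive-definite $(1,1)$-form $\gamma$ on $X$ is called a strongly Gauduchon metric if the $(n,n-1)$-form $\partial\gamma^{n-1}$ is $\bar\partial$-exact on $X$, that is, $\partial\gamma^{n-1}=\bar\partial\beta$ for some $C^\infty$ form $\beta$ on $X$. A current of degree $k$ on $X$ is a continuous linear functional on the space of $C^\infty$ complex $(2n-k)$-forms with the $C^\infty$ topology; a current $T$ of degree $2$ is of type $(1,1)$ if it vanishes on all $C^\infty$ forms of type $(p,q)\neq(n-1,n-1)$, it is $d$-exact if $T=dS$ for some current $S$ of degree $1$, and, when it is of type $(1,1)$, $T\ge 0$ means that $T$ takes real non-negative values on all $C^\infty$ positive $(n-1,n-1)$-forms. Then $X$ carries a strongly Gauduchon metric if and only if there is no non-zero current $T$ of type $(1,1)$ on $X$ such that $T\ge 0$ and $T$ is $d$-exact on $X$. -/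

import Mathlib

open scoped Manifold ContDiff Topology

noncomputable section

namespace StronglyGauduchon

section LinearAlgebra

variable {M : Type*} [AddCommGroup M] [Module ℂ M] [TopologicalSpace M]

/-- The exterior product of two complex-valued alternating forms on a (real) vector space: the
exterior product of alternating maps of Mathlib, followed by multiplication in `ℂ`. -/
def wedge {k l : ℕ} (α : M [⋀^Fin k]→L[ℝ] ℂ) (β : M [⋀^Fin l]→L[ℝ] ℂ) :
    M [⋀^Fin (k + l)]→L[ℝ] ℂ :=
  { ((LinearMap.mul' ℝ ℂ).compAlternatingMap
      (α.toAlternatingMap.domCoprod β.toAlternatingMap)).domDomCongr finSumFinEquiv with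
    cont := by
      have key : ∀ σ : Equiv.Perm.ModSumCongr (Fin k) (Fin l), Continuous fun v : Fin (k + l) → M =>
          LinearMap.mul' ℝ ℂ (AlternatingMap.domCoprod.summand α.toAlternatingMap
            β.toAlternatingMap σ (fun i => v (finSumFinEquiv i))) := by
        intro σ
        induction σ using Quotient.inductionOn' with
        | h σ =>
          simp only [AlternatingMap.domCoprod.summand_mk'', _root_.smul_apply,
            MultilinearMap.domDomCongr_apply, MultilinearMap.domCoprod_apply]
          have h : Continuous fun v : Fin (k + l) → M =>
              α (fun i => v (finSumFinEquiv (σ (Sum.inl i)))) *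
                β (fun i => v (finSumFinEquiv (σ (Sum.inr i)))) :=
            (α.cont.comp (by fun_prop)).mul (β.cont.comp (by fun_prop))
          rcases Int.units_eq_one_or (Equiv.Perm.sign σ) with hs | hs
          · simpa [hs] using h
          · simp only [hs]
            refine h.neg.congr fun v => ?_
            simp
      have := continuous_finsetSum Finset.univ fun σ _ => key σ
      refine this.congr fun v => ?_
      simp [AlternatingMap.domCoprod, Function.comp_def] }

/-- The exterior power `γ ^ m` of a `2`-form `γ`. -/
def wedgePow (γ : M [⋀^Fin 2]→L[ℝ] ℂ) : (m : ℕ) → M [⋀^Fin (2 * m)]→L[ℝ] ℂ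
  | 0 => ContinuousAlternatingMap.constOfIsEmpty ℝ M (Fin 0) 1
  | m + 1 => wedge (wedgePow γ m) γ

/-- A complex-valued alternating form on a complex vector space is of type `(p, q)` if it is
homogeneous of bidegree `(p, q)` under multiplication of all its arguments by a complex scalar. -/
def IsType (p q : ℕ) {k : ℕ} (α : M [⋀^Fin k]→L[ℝ] ℂ) : Prop :=
  ∀ (c : ℂ) (v : Fin k → M), α (fun i => c • v i) = c ^ p * (starRingEnd ℂ c) ^ q * α v

/-- The real frame `(v₁, i v₁, v₂, i v₂, …, vₘ, i vₘ)`. -/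
def complexFrame {m : ℕ} (v : Fin m → M) : Fin (2 * m) → M := fun j =>
  if (j : ℕ) % 2 = 0 then v ⟨j / 2, by omega⟩ else Complex.I • v ⟨j / 2, by omega⟩

open scoped ComplexOrder in
/-- A form of type `(m, m)` is positive if it is real and nonnegative on every complex `m`-plane,
for the complex orientation. (For `m = n - 1` in complex dimension `n` weak and strong positivity
agree, so that no distinction is necessary.) -/
def IsPositive {m : ℕ} (α : M [⋀^Fin (2 * m)]→L[ℝ] ℂ) : Prop :=
  IsType m m α ∧ ∀ v : Fin m → M, 0 ≤ α (complexFrame v)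

open scoped ComplexOrder in
/-- A form of type `(1, 1)` is positive definite if `γ (v, i v) > 0` for all `v ≠ 0`
(in particular it is then a real form). -/
def IsPosDef (γ : M [⋀^Fin 2]→L[ℝ] ℂ) : Prop :=
  IsType 1 1 γ ∧ ∀ v : M, v ≠ 0 → 0 < γ ![v, Complex.I • v]

end LinearAlgebra

section Local

variable {E : Type*} [NormedAddCommGroup E] [NormedSpace ℂ E]

/-- Multiplication by `i`. -/
def mulI (E : Type*) [NormedAddCommGroup E] [NormedSpace ℂ E] : E →L[ℝ] E :=
  (Complex.I • ContinuousLinearMap.id ℂ E).restrictScalars ℝ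

/-- The operator `∂` in coordinates: in the formula for the exterior derivative, every directional
derivative `D_v` is replaced by its complex linear part `(D_v - i D_{iv}) / 2`; that is,
`∂ (∑ f_{JK} dz_J ∧ dz̄_K) = ∑ (∂f_{JK}/∂z_l) dz_l ∧ dz_J ∧ dz̄_K`. -/
def localDel {k : ℕ} (φ : E → E [⋀^Fin k]→L[ℝ] ℂ) (y : E) : E [⋀^Fin (k + 1)]→L[ℝ] ℂ :=
  ContinuousAlternatingMap.alternatizeUncurryFin
    ((1 / 2 : ℂ) • (fderiv ℝ φ y - Complex.I • (fderiv ℝ φ y).comp (mulI E)))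

/-- The operator `∂̄` in coordinates: in the formula for the exterior derivative, every directional
derivative `D_v` is replaced by its antilinear part `(D_v + i D_{iv}) / 2`; that is,
`∂̄ (∑ f_{JK} dz_J ∧ dz̄_K) = ∑ (∂f_{JK}/∂z̄_l) dz̄_l ∧ dz_J ∧ dz̄_K`. -/
def localDelBar {k : ℕ} (φ : E → E [⋀^Fin k]→L[ℝ] ℂ) (y : E) : E [⋀^Fin (k + 1)]→L[ℝ] ℂ :=
  ContinuousAlternatingMap.alternatizeUncurryFin
    ((1 / 2 : ℂ) • (fderiv ℝ φ y + Complex.I • (fderiv ℝ φ y).comp (mulI E)))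

end Local

section Forms

variable (E : Type*) [NormedAddCommGroup E] [NormedSpace ℂ E]
  (X : Type*) [TopologicalSpace X] [ChartedSpace E X]

/-- A complex-valued differential form of degree `k`, without any regularity. -/
abbrev RoughForm (k : ℕ) : Type _ :=
  ∀ x : X, (TangentSpace 𝓘(ℂ, E) x) [⋀^Fin k]→L[ℝ] ℂ

variable {E X}

/-- The expression of a form in a chart `e`: its pullback under `e.symm`. -/
def inChart {k : ℕ} (φ : RoughForm E X k) (e : OpenPartialHomeomorph X E) (y : E) :
    E [⋀^Fin k]→L[ℝ] ℂ :=
  (φ (e.symm y)).compContinuousLinearMap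
    ((mfderiv 𝓘(ℂ, E) 𝓘(ℂ, E) e.symm y).restrictScalars ℝ)

/-- A form is smooth if its expression in every chart of the atlas is `C^∞` (in the real sense). -/
def IsSmooth {k : ℕ} (φ : RoughForm E X k) : Prop :=
  ∀ e ∈ atlas E X, ContDiffOn ℝ ∞ (inChart φ e) e.target

/-- A first-order operator given in coordinates, applied to a form on `X`: at the point `x` one
computes in the preferred chart at `x` and pulls back the result to the tangent space at `x`. -/
def viaChart {k l : ℕ} (D : (E → E [⋀^Fin k]→L[ℝ] ℂ) → E → E [⋀^Fin l]→L[ℝ] ℂ)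
    (φ : RoughForm E X k) : RoughForm E X l := fun x =>
  (D (inChart φ (chartAt E x)) (chartAt E x x)).compContinuousLinearMap
    ((mfderiv 𝓘(ℂ, E) 𝓘(ℂ, E) (chartAt E x) x).restrictScalars ℝ)

/-- The exterior derivative `d`. -/
def extD {k : ℕ} (φ : RoughForm E X k) : RoughForm E X (k + 1) := viaChart extDeriv φ

/-- The operator `∂`. -/
def del {k : ℕ} (φ : RoughForm E X k) : RoughForm E X (k + 1) := viaChart localDel φ

/-- The operator `∂̄`. -/
def delBar {k : ℕ} (φ : RoughForm E X k) : RoughForm E X (k + 1) := viaChart localDelBar φ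

theorem inChart_apply {k : ℕ} (φ : RoughForm E X k) (e : OpenPartialHomeomorph X E) (y : E)
    (v : Fin k → E) :
    inChart φ e y v = φ (e.symm y) (fun j => mfderiv 𝓘(ℂ, E) 𝓘(ℂ, E) e.symm y (v j)) := rfl

theorem inChart_add {k : ℕ} (φ ψ : RoughForm E X k) (e : OpenPartialHomeomorph X E) :
    inChart (φ + ψ) e = inChart φ e + inChart ψ e := by
  ext y v; rfl

theorem inChart_smul {k : ℕ} (c : ℂ) (φ : RoughForm E X k) (e : OpenPartialHomeomorph X E) :
    inChart (c • φ) e = c • inChart φ e := by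
  ext y v; rfl

theorem inChart_zero {k : ℕ} (e : OpenPartialHomeomorph X E) :
    inChart (0 : RoughForm E X k) e = 0 := by
  ext y v; rfl

variable (E X) in
/-- The complex vector space of smooth forms of degree `k`, inside that of all forms. -/
def smoothForms (k : ℕ) : Submodule ℂ (RoughForm E X k) where
  carrier := {φ | IsSmooth φ}
  add_mem' {φ ψ} hφ hψ e he := by
    rw [inChart_add]; exact (hφ e he).add (hψ e he)
  zero_mem' e he := by
    rw [inChart_zero]; exact contDiffOn_const
  smul_mem' c φ hφ e he := by
    rw [inChart_smul]; exact (hφ e he).const_smul c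

variable (E X) in
/-- The complex vector space of smooth complex-valued forms of degree `k` on `X`. -/
def Form (k : ℕ) : Type _ := smoothForms E X k

instance (k : ℕ) : AddCommGroup (Form E X k) := inferInstanceAs (AddCommGroup (smoothForms E X k))

instance (k : ℕ) : Module ℂ (Form E X k) := inferInstanceAs (Module ℂ (smoothForms E X k))

/-- The underlying field of alternating forms of a smooth form. -/
def Form.val {k : ℕ} (φ : Form E X k) : RoughForm E X k := Subtype.val φ

/-- A smooth form is of type `(p, q)` if it is so at every point. -/
def Form.IsType (p q : ℕ) {k : ℕ} (φ : Form E X k) : Prop :=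
  ∀ x, StronglyGauduchon.IsType p q (φ.val x)

end Forms

section Manifold

variable {E : Type*} [NormedAddCommGroup E] [NormedSpace ℂ E]
  {X : Type*} [TopologicalSpace X] [ChartedSpace E X]

/-- The coordinate change between two charts is smooth in the real sense. -/
theorem contDiffAt_transition [IsManifold 𝓘(ℂ, E) ω X]
    {e e' : OpenPartialHomeomorph X E} (he : e ∈ atlas E X) (he' : e' ∈ atlas E X)
    {y : E} (hy : y ∈ (e.symm.trans e').source) : ContDiffAt ℂ ω (e' ∘ e.symm) y := by
  have h := (contDiffGroupoid ω 𝓘(ℂ, E)).compatible he he'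
  rw [contDiffGroupoid, mem_groupoid_of_pregroupoid] at h
  have h1 := h.1
  have h2 : ContDiffOn ℂ ω (e' ∘ e.symm) (e.symm.trans e').source := by
    simpa [contDiffPregroupoid] using h1
  exact h2.contDiffAt ((e.symm.trans e').open_source.mem_nhds hy)

/-- The expressions of a form in two charts are related by pullback. -/
theorem inChart_eq_pullback [IsManifold 𝓘(ℂ, E) ω X] {k : ℕ} (φ : RoughForm E X k)
    {e e' : OpenPartialHomeomorph X E} (he : e ∈ atlas E X) (he' : e' ∈ atlas E X)
    {y : E} (hy : y ∈ (e.symm.trans e').source) :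
    inChart φ e y = (inChart φ e' ((e' ∘ e.symm) y)).compContinuousLinearMap
      (fderiv ℝ (e' ∘ e.symm) y) := by
  have hM : IsManifold 𝓘(ℂ, E) 1 X := IsManifold.of_le (n := ω) le_top
  have hy' : y ∈ e.target ∧ e.symm y ∈ e'.source := by simpa using hy
  have hd : DifferentiableAt ℂ (e' ∘ e.symm) y :=
    (contDiffAt_transition he he' hy).differentiableAt (by simp)
  have h1 : mfderiv 𝓘(ℂ, E) 𝓘(ℂ, E) e.symm y =
      mfderiv 𝓘(ℂ, E) 𝓘(ℂ, E) (e'.symm ∘ (e' ∘ e.symm)) y := by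
    refine Filter.EventuallyEq.mfderiv_eq ?_
    filter_upwards [(e.symm.trans e').open_source.mem_nhds hy] with z hz
    have hz' : z ∈ e.target ∧ e.symm z ∈ e'.source := by simpa using hz
    simp [e'.left_inv hz'.2]
  have h2 := mfderiv_comp (I := 𝓘(ℂ, E)) (I' := 𝓘(ℂ, E)) (I'' := 𝓘(ℂ, E)) y
    (g := e'.symm) (f := e' ∘ e.symm)
    (mdifferentiableAt_atlas_symm (I := 𝓘(ℂ, E)) he' (e'.map_source hy'.2))
    hd.mdifferentiableAt
  rw [mfderiv_eq_fderiv] at h2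
  have h3 : fderiv ℝ (e' ∘ e.symm) y = (fderiv ℂ (e' ∘ e.symm) y).restrictScalars ℝ :=
    hd.fderiv_restrictScalars ℝ
  ext v
  rw [ContinuousAlternatingMap.compContinuousLinearMap_apply, inChart_apply, inChart_apply, h1, h2,
    h3]
  have h4 : e'.symm ((e' ∘ e.symm) y) = e.symm y := e'.left_inv hy'.2
  exact congr_arg (fun z : X => φ z fun j => (mfderiv 𝓘(ℂ, E) 𝓘(ℂ, E) e'.symm ((e' ∘ e.symm) y)
    (fderiv ℂ (e' ∘ e.symm) y (v j)) : E)) h4.symm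

/-- In every chart, the exterior derivative of a smooth form is computed by the formula for it. -/
theorem inChart_extD [IsManifold 𝓘(ℂ, E) ω X] {k : ℕ} {φ : RoughForm E X k} (hφ : IsSmooth φ)
    {e : OpenPartialHomeomorph X E} (he : e ∈ atlas E X) {y : E} (hy : y ∈ e.target) :
    inChart (extD φ) e y = extDeriv (inChart φ e) y := by
  have hM : IsManifold 𝓘(ℂ, E) 1 X := IsManifold.of_le (n := ω) le_top
  set x : X := e.symm y with hx
  set e' := chartAt E x with he'_def
  have he' : e' ∈ atlas E X := chart_mem_atlas E x
  have hxs : x ∈ e'.source := mem_chart_source E x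
  have hys : y ∈ (e.symm.trans e').source := by simpa using ⟨hy, hxs⟩
  have hc : ContDiffAt ℂ ω (e' ∘ e.symm) y := contDiffAt_transition he he' hys
  have hd : DifferentiableAt ℂ (e' ∘ e.symm) y := hc.differentiableAt (by simp)
  have h1 : inChart φ e =ᶠ[𝓝 y] fun z => (inChart φ e' ((e' ∘ e.symm) z)).compContinuousLinearMap
      (fderiv ℝ (e' ∘ e.symm) z) := by
    filter_upwards [(e.symm.trans e').open_source.mem_nhds hys] with z hz
    exact inChart_eq_pullback φ he he' hz
  have h2 : DifferentiableAt ℝ (inChart φ e') ((e' ∘ e.symm) y) :=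
    ((hφ e' he').contDiffAt (e'.open_target.mem_nhds (e'.map_source hxs))).differentiableAt
      (by simp)
  rw [h1.extDeriv_eq, extDeriv_pullback (r := ω) h2 (hc.restrict_scalars ℝ) (by simp)]
  have h3 := mfderiv_comp (I := 𝓘(ℂ, E)) (I' := 𝓘(ℂ, E)) (I'' := 𝓘(ℂ, E)) y
    (g := e') (f := e.symm) (mdifferentiableAt_atlas (I := 𝓘(ℂ, E)) he' hxs)
    (mdifferentiableAt_atlas_symm (I := 𝓘(ℂ, E)) he hy)
  rw [mfderiv_eq_fderiv] at h3
  have h4 : fderiv ℝ (e' ∘ e.symm) y = (fderiv ℂ (e' ∘ e.symm) y).restrictScalars ℝ :=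
    hd.fderiv_restrictScalars ℝ
  rw [h4, h3]
  rfl

theorem isSmooth_extD [IsManifold 𝓘(ℂ, E) ω X] {k : ℕ} {φ : RoughForm E X k} (hφ : IsSmooth φ) :
    IsSmooth (extD φ) := by
  intro e he
  refine ContDiffOn.congr (f := extDeriv (inChart φ e)) ?_ fun y hy => inChart_extD hφ he hy
  have h : ContDiffOn ℝ ∞ (fderiv ℝ (inChart φ e)) e.target :=
    (hφ e he).fderiv_of_isOpen e.open_target (by simp)
  exact (ContinuousAlternatingMap.alternatizeUncurryFinCLM ℝ E ℂ).contDiff.comp_contDiffOn h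

/-- The exterior derivative of a smooth form, as a smooth form. -/
def Form.d [IsManifold 𝓘(ℂ, E) ω X] {k : ℕ} (φ : Form E X k) : Form E X (k + 1) :=
  ⟨extD φ.val, isSmooth_extD φ.2⟩

end Manifold

section Currents

variable (E : Type*) [NormedAddCommGroup E] [NormedSpace ℂ E]
  (X : Type*) [TopologicalSpace X] [ChartedSpace E X]

/-- Index set of the seminorms that define the `C^∞` topology: a chart, a compact subset of its
target, and an order of differentiation. -/
structure SeminormIndex where
  /-- The chart. -/
  chart : OpenPartialHomeomorph X E
  chart_mem : chart ∈ atlas E X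
  /-- The compact set. -/
  compact : Set E
  isCompact : IsCompact compact
  subset_target : compact ⊆ chart.target
  /-- The order of differentiation. -/
  order : ℕ

variable {E X}

theorem contDiffAt_inChart {k : ℕ} (φ : Form E X k) (i : SeminormIndex E X) (y : i.compact) :
    ContDiffAt ℝ ∞ (inChart φ.val i.chart) y :=
  (φ.2 i.chart i.chart_mem).contDiffAt
    (i.chart.open_target.mem_nhds (i.subset_target y.2))

theorem bddAbove_seminorm {k : ℕ} (φ : Form E X k) (i : SeminormIndex E X) :
    BddAbove (Set.range fun y : i.compact =>
      ‖iteratedFDeriv ℝ i.order (inChart φ.val i.chart) y‖) := by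
  have : CompactSpace i.compact := isCompact_iff_compactSpace.mp i.isCompact
  refine (isCompact_range ?_).bddAbove
  refine continuous_iff_continuousAt.mpr fun y => ?_
  have h := (contDiffAt_inChart φ i y).continuousAt_iteratedFDeriv (k := i.order) (mod_cast le_top)
  exact (h.comp continuous_subtype_val.continuousAt).norm

/-- The seminorm `φ ↦ sup_{y ∈ K} ‖D^m φ_e (y)‖`, where `φ_e` is the expression of `φ` in the
chart `e`. -/
def formSeminorm (k : ℕ) (i : SeminormIndex E X) : Seminorm ℂ (Form E X k) :=
  Seminorm.of
    (fun φ => ⨆ y : i.compact, ‖iteratedFDeriv ℝ i.order (inChart φ.val i.chart) y‖)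
    (by
      intro φ ψ
      refine Real.iSup_le (fun y => ?_) (add_nonneg (Real.iSup_nonneg fun _ => norm_nonneg _)
        (Real.iSup_nonneg fun _ => norm_nonneg _))
      have h : inChart (φ + ψ).val i.chart = inChart φ.val i.chart + inChart ψ.val i.chart :=
        inChart_add φ.val ψ.val i.chart
      rw [h, iteratedFDeriv_add_apply ((contDiffAt_inChart φ i y).of_le (mod_cast le_top))
        ((contDiffAt_inChart ψ i y).of_le (mod_cast le_top))]
      exact (norm_add_le _ _).trans
        (add_le_add (le_ciSup (bddAbove_seminorm φ i) y) (le_ciSup (bddAbove_seminorm ψ i) y)))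
    (by
      intro c φ
      have h : inChart (c • φ).val i.chart = c • inChart φ.val i.chart :=
        inChart_smul c φ.val i.chart
      rw [Real.mul_iSup_of_nonneg (norm_nonneg c)]
      refine iSup_congr fun y => ?_
      rw [h, iteratedFDeriv_const_smul_apply
        ((contDiffAt_inChart φ i y).of_le (mod_cast le_top)), norm_smul])

/-- The `C^∞` topology on smooth forms: uniform convergence of all derivatives on the compact
subsets of the charts. -/
instance (k : ℕ) : TopologicalSpace (Form E X k) :=
  SeminormFamily.moduleFilterBasis (𝕜 := ℂ) (fun i => formSeminorm (E := E) (X := X) k i) |>.topology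

variable (E X) in
/-- The currents of dimension `j` on a compact manifold `X`: the continuous complex linear
functionals on the smooth forms of degree `j`. On a manifold of complex dimension `n`, these are the
currents of degree `2 * n - j`. -/
abbrev Current (j : ℕ) : Type _ := Form E X j →L[ℂ] ℂ

/-- A current is of bidimension `(p, q)` if it vanishes on the forms of any other type. On a manifold
of complex dimension `n`, this means that it is of type, or bidegree, `(n - p, n - q)`. -/
def HasBidimension {j : ℕ} (T : Current E X j) (p q : ℕ) : Prop :=
  ∀ r s : ℕ, (r, s) ≠ (p, q) → ∀ φ : Form E X j, φ.IsType r s → T φ = 0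

/-- A current `T` is `d`-exact if `T = d S` for a current `S`, where `(d S) φ = S (d φ)` up to a sign
that depends on the degree only and can be absorbed in `S`. -/
def IsExact [IsManifold 𝓘(ℂ, E) ω X] {j : ℕ} (T : Current E X j) : Prop :=
  ∃ S : Current E X (j + 1), ∀ φ : Form E X j, T φ = S φ.d

open scoped ComplexOrder in
/-- `T ≥ 0`, for a current `T` of bidimension `(m, m)` on a manifold of complex dimension `m + 1`
(that is, of type `(1, 1)`): it takes real nonnegative values on all positive smooth forms. -/
def IsNonneg {m : ℕ} (T : Current E X (2 * m)) : Prop :=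
  ∀ φ : Form E X (2 * m), (∀ x, IsPositive (φ.val x)) → 0 ≤ T φ

/-- A smooth positive definite `(1, 1)`-form `γ` on a manifold of complex dimension `n` is a strongly
Gauduchon metric if `∂ (γ ^ (n - 1))` is `∂̄`-exact. -/
def IsStronglyGauduchon (n : ℕ) (γ : Form E X 2) : Prop :=
  (∀ x, IsPosDef (γ.val x)) ∧
    ∃ β : Form E X (2 * (n - 1)),
      del (fun x => wedgePow (γ.val x) (n - 1)) = delBar β.val

end Currents

end StronglyGauduchon

end

set_option linter.unusedSectionVars false

noncomputable section

/-! Put `m = n - 1`. A strongly Gauduchon metric amounts to a `d`-closed form of degree `2m` whose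
real part is positive on every complex `m`-plane (`FramePos`). If `∂γ^m = ∂̄β` and `η` is the
component of `β` of type `(m+1, m-1)`, then `∂η = 0` because its type exceeds the dimension, and
`∂̄η = ∂γ^m`; hence `γ^m - η - η̄` is closed (`extD_wedgePow_eq`). Conversely, if `ζ` is closed and
positive on complex planes, the `(m, m)` component of `ζ + ζ̄` is a positive real form, so it is the
`m`-th power of a unique metric (`exists_metric_of_power`), and the component of `d(ζ + ζ̄) = 0` of
type `(m+1, m)` is the strongly Gauduchon condition.

A metric excludes currents: if `T` is exact and of bidimension `(m, m)`, then `T(γ^m) = T(η + η̄) =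
0`. Since `γ^m` is interior to the positive cone, `T ≥ 0` then forces `T = 0`
(`IsNonneg.eq_zero_of_real`, `eq_zero_of_isStronglyGauduchon`).

Without a metric, the closed forms miss the open convex cone of forms that are positive on complex
planes, and Hahn-Banach gives a functional `G`, continuous in the sup norm, positive on the cone and
zero on closed forms (`DiscCover.exists_functional`). The cone depends only on real parts of values
on complex `m`-planes, so the bidimension and the reality of `G` come for free. Exactness needs an
estimate `|G φ| ≤ C ‖dφ‖`, after which a second use of Hahn-Banach writes `G` as `S ∘ d`
(`exists_factor`).

The estimate is a closed range property of `d`: a smooth form of positive degree lies within `C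
‖dφ‖` of a closed form, in the sup norm (`DiscCover.exists_closed_approx`). Its proof uses
regularizing operators in the manner of de Rham: convolution in a coordinate ball is homotopic to
the identity (`mollify_sub_self`), the homotopy can be cut off (`regOp`), and finitely many such
operators compose to an `R` with smooth values (`exists_isRegularizer`). By the uniform boundedness
principle and Arzelà-Ascoli `R` is compact, and a contradicting sequence would have a closed limit
too close to it. -/

namespace StronglyGauduchon

/-! ### Types of alternating forms: extraction of components, and polarization. -/

section Types

variable {M : Type*} [AddCommGroup M] [Module ℂ M] [TopologicalSpace M] {k : ℕ}

/-- `v` or `i v`, according to a Boolean. -/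
def rotSel (b : Bool) : M →ₗ[ℝ] M :=
  if b then (Complex.I • (LinearMap.id : M →ₗ[ℂ] M)).restrictScalars ℝ else LinearMap.id

@[simp] theorem rotSel_true (v : M) : rotSel true v = Complex.I • v := rfl

@[simp] theorem rotSel_false (v : M) : rotSel false v = v := rfl

/-- The weights of `v` and `i v` in the complex linear (`true`) or antilinear (`false`) part of a
real linear map. -/
def slotWeight : Bool → Bool → ℂ
  | _, false => 1 / 2
  | true, true => -(Complex.I / 2)
  | false, true => Complex.I / 2

/-- The character `c` or `c̄`. -/
def slotChar : Bool → ℂ → ℂ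
  | true, c => c
  | false, c => starRingEnd ℂ c

/-- The real or imaginary part. -/
def rePart : Bool → ℂ → ℝ
  | false, c => c.re
  | true, c => c.im

theorem sum_rePart_smul (c : ℂ) (v : M) : ∑ b : Bool, rePart b c • rotSel b v = c • v := by
  have h : c • v = ((c.re : ℂ) + c.im * Complex.I) • v := by rw [Complex.re_add_im]
  rw [h, add_smul, mul_smul]
  simp [rePart, add_comm]

/-- The part of an alternating form that is complex linear in the arguments `i` with `s i = true`
and antilinear in the others. -/
def slotProj (f : M [⋀^Fin k]→L[ℝ] ℂ) (s : Fin k → Bool) :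
    MultilinearMap ℝ (fun _ : Fin k => M) ℂ :=
  ∑ u : Fin k → Bool, (∏ i, slotWeight (s i) (u i)) •
    f.toMultilinearMap.compLinearMap (fun i => rotSel (u i))

theorem slotProj_apply (f : M [⋀^Fin k]→L[ℝ] ℂ) (s : Fin k → Bool) (v : Fin k → M) :
    slotProj f s v =
      ∑ u : Fin k → Bool, (∏ i, slotWeight (s i) (u i)) * f (fun i => rotSel (u i) (v i)) := by
  simp [slotProj]

/-- In each slot the linear and antilinear weights add up to `1` at `v` and cancel at `i v`, so only
the term without any `i` survives. -/
theorem sum_slotProj (f : M [⋀^Fin k]→L[ℝ] ℂ) (v : Fin k → M) :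
    ∑ s : Fin k → Bool, slotProj f s v = f v := by
  simp_rw [slotProj_apply]
  rw [Finset.sum_comm]
  have h : ∀ u : Fin k → Bool, ∑ s : Fin k → Bool, ∏ i, slotWeight (s i) (u i) =
      if u = fun _ => false then 1 else 0 := by
    intro u
    rw [← Fintype.prod_sum (fun i b => slotWeight b (u i))]
    split_ifs with hu
    · subst hu
      simp [slotWeight]
    · obtain ⟨i, hi⟩ : ∃ i, u i ≠ false := by
        by_contra hc
        push Not at hc
        exact hu (funext hc)
      refine Finset.prod_eq_zero (Finset.mem_univ i) ?_
      have : u i = true := by simpa using hi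
      simp [this, slotWeight]
  simp_rw [← Finset.sum_mul, h]
  simp

theorem map_smul_expand (f : M [⋀^Fin k]→L[ℝ] ℂ) (c : Fin k → ℂ) (v : Fin k → M) :
    f (fun i => c i • v i) =
      ∑ u : Fin k → Bool, (∏ i, (rePart (u i) (c i) : ℂ)) * f (fun i => rotSel (u i) (v i)) := by
  have h1 : (fun i => c i • v i) = fun i => ∑ b : Bool, rePart b (c i) • rotSel b (v i) := by
    ext i; rw [sum_rePart_smul]
  have h2 := f.toMultilinearMap.map_sum (fun i (b : Bool) => rePart b (c i) • rotSel b (v i))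
  rw [h1]
  refine h2.trans (Finset.sum_congr rfl fun u _ => ?_)
  have h3 := f.toMultilinearMap.map_smul_univ (fun i => rePart (u i) (c i))
    (fun i => rotSel (u i) (v i))
  refine h3.trans ?_
  rw [Complex.real_smul]
  push_cast
  rfl

/-- This is the homogeneity of `(f(v) ∓ i f(iv)) / 2` under a complex scalar, for one slot, read off
from the coefficients of `v` and `i v`. -/
theorem slotWeight_rePart (s b : Bool) (c : ℂ) :
    ∑ a : Bool, slotWeight s a * (rePart b (bif a then Complex.I * c else c) : ℂ) =
      slotChar s c * slotWeight s b := by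
  cases s <;> cases b <;> apply Complex.ext <;> simp [slotWeight, slotChar, rePart] <;> ring

/-- Once every `c i • v i` is expanded in `v i` and `I • v i`, the double sum factorizes over the
slots, and each factor is `slotWeight_rePart`. -/
theorem slotProj_smul (f : M [⋀^Fin k]→L[ℝ] ℂ) (s : Fin k → Bool) (c : Fin k → ℂ)
    (v : Fin k → M) :
    slotProj f s (fun i => c i • v i) = (∏ i, slotChar (s i) (c i)) * slotProj f s v := by
  simp_rw [slotProj_apply]
  have h1 : ∀ u : Fin k → Bool, (fun i => rotSel (u i) (c i • v i)) =
      fun i => (bif u i then Complex.I * c i else c i) • v i := by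
    intro u; ext i
    cases u i <;> simp [mul_smul]
  simp_rw [h1, map_smul_expand f]
  simp_rw [Finset.mul_sum]
  rw [Finset.sum_comm]
  refine Finset.sum_congr rfl fun u _ => ?_
  simp_rw [← mul_assoc]
  rw [← Finset.sum_mul]
  congr 1
  simp_rw [← Finset.prod_mul_distrib]
  rw [← Fintype.prod_sum (fun i a => slotWeight (s i) a *
    (rePart (u i) (bif a then Complex.I * c i else c i) : ℂ))]
  exact Finset.prod_congr rfl fun i _ => slotWeight_rePart _ _ _

/-- For a fixed pattern the projection is not alternating: the pattern has to be permuted along with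
the arguments. Antisymmetry remains among the linear slots, and among the antilinear ones. -/
theorem slotProj_comp_perm (f : M [⋀^Fin k]→L[ℝ] ℂ) (s : Fin k → Bool) (v : Fin k → M)
    (σ : Equiv.Perm (Fin k)) :
    slotProj f (s ∘ σ) (v ∘ σ) = (Equiv.Perm.sign σ : ℂ) * slotProj f s v := by
  simp_rw [slotProj_apply, Finset.mul_sum]
  rw [← (Equiv.arrowCongr σ (Equiv.refl Bool)).symm.sum_comp]
  refine Finset.sum_congr rfl fun u _ => ?_
  have h1 : (fun i => rotSel (((Equiv.arrowCongr σ (Equiv.refl Bool)).symm u) i) ((v ∘ σ) i)) =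
      (fun i => rotSel (u i) (v i)) ∘ σ := by
    ext i; simp [Equiv.arrowCongr]
  have h2 : f ((fun i => rotSel (u i) (v i)) ∘ σ) =
      (Equiv.Perm.sign σ : ℂ) * f (fun i => rotSel (u i) (v i)) := by
    have := f.toAlternatingMap.map_perm (fun i => rotSel (u i) (v i)) σ
    refine this.trans ?_
    rw [Units.smul_def, zsmul_eq_mul]
    rfl
  rw [h1, h2, mul_left_comm]
  congr 1
  rw [← Equiv.prod_comp σ fun i => slotWeight (s i) (u i)]
  simp [Equiv.arrowCongr]

theorem slotProj_eq_zero_of_eq (f : M [⋀^Fin k]→L[ℝ] ℂ) (s : Fin k → Bool) {v : Fin k → M}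
    {i j : Fin k} (hij : i ≠ j) (hs : s i = s j) (hv : v i = v j) : slotProj f s v = 0 := by
  have h := slotProj_comp_perm f s v (Equiv.swap i j)
  have h1 : s ∘ Equiv.swap i j = s := by
    ext l
    exact Equiv.apply_swap_eq_self hs l
  have h2 : v ∘ Equiv.swap i j = v := by
    ext l
    exact Equiv.apply_swap_eq_self hv l
  rw [h1, h2, Equiv.Perm.sign_swap hij] at h
  have h3 : slotProj f s v = -slotProj f s v := by simpa using h
  exact self_eq_neg.mp h3

theorem slotProj_update_smul (f : M [⋀^Fin k]→L[ℝ] ℂ) (s : Fin k → Bool) (v : Fin k → M)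
    (i : Fin k) (c : ℂ) (x : M) :
    slotProj f s (Function.update v i (c • x)) =
      slotChar (s i) c * slotProj f s (Function.update v i x) := by
  have h := slotProj_smul f s (Function.update 1 i c) (Function.update v i x)
  have h1 : (fun j => (Function.update 1 i c : Fin k → ℂ) j • Function.update v i x j) =
      Function.update v i (c • x) := by
    ext j
    by_cases hj : j = i
    · subst hj; simp
    · simp [hj]
  rw [h1] at h
  rw [h]
  congr 1
  rw [Finset.prod_eq_single i]
  · simp
  · intro j _ hj
    simp only [Function.update_of_ne hj, Pi.one_apply]
    cases s j <;> simp [slotChar]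
  · simp

/-- The number of complex linear arguments. -/
def linCount (s : Fin k → Bool) : ℕ := (Finset.univ.filter fun i => s i = true).card

theorem linCount_le (s : Fin k → Bool) : linCount s ≤ k := by
  simpa [linCount] using Finset.card_filter_le Finset.univ fun i => s i = true

theorem prod_slotChar (s : Fin k → Bool) (c : ℂ) :
    ∏ i, slotChar (s i) c = c ^ linCount s * (starRingEnd ℂ c) ^ (k - linCount s) := by
  have h : ∀ i, slotChar (s i) c = if s i = true then c else starRingEnd ℂ c := by
    intro i; cases s i <;> simp [slotChar]
  simp_rw [h]
  rw [Finset.prod_ite, Finset.prod_const, Finset.prod_const]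
  congr 2
  have := Finset.card_filter_add_card_filter_not (s := (Finset.univ : Finset (Fin k)))
    (fun i => s i = true)
  simp only [Finset.card_univ, Fintype.card_fin] at this
  rw [linCount]
  omega

/-- A complex vector space of dimension less than `p` has no form of type `(p, q)`, componentwise. -/
theorem slotProj_eq_zero_of_finrank_lt [FiniteDimensional ℂ M] (f : M [⋀^Fin k]→L[ℝ] ℂ)
    (s : Fin k → Bool) (hs : Module.finrank ℂ M < linCount s) (v : Fin k → M) :
    slotProj f s v = 0 := by
  classical
  have hdep : ¬ LinearIndependent ℂ (fun i : {i : Fin k // s i = true} => v i) := by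
    intro h
    have := h.fintype_card_le_finrank
    rw [Fintype.card_subtype] at this
    exact absurd this (not_le.mpr hs)
  rw [Fintype.not_linearIndependent_iff] at hdep
  obtain ⟨g, hg, i₀, hi₀⟩ := hdep
  -- Substitute the vanishing combination in slot `i₀`. By linearity there, every term except that
  -- of `i₀` repeats a vector in two linear slots and vanishes.
  have h1 : slotProj f s (Function.update v i₀ (∑ i, g i • v i)) = 0 := by
    rw [hg]
    exact (slotProj f s).map_coord_zero (i₀ : Fin k) (by simp)
  rw [MultilinearMap.map_update_sum] at h1
  rw [Finset.sum_eq_single i₀] at h1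
  · rw [slotProj_update_smul, i₀.2, Function.update_eq_self] at h1
    exact (mul_eq_zero.mp h1).resolve_left hi₀
  · intro j _ hj
    rw [slotProj_update_smul]
    have hne : (i₀ : Fin k) ≠ j := fun h => hj (Subtype.ext h.symm)
    rw [slotProj_eq_zero_of_eq f s hne (by rw [i₀.2, j.2]), mul_zero]
    simp [hne.symm]
  · simp

variable [ContinuousConstSMul ℂ M]

/-- Multiplication by a complex number as a real linear map. -/
def scalarMap (M : Type*) [AddCommGroup M] [Module ℂ M] [TopologicalSpace M]
    [ContinuousConstSMul ℂ M] (c : ℂ) : M →L[ℝ] M :=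
  (⟨c • LinearMap.id, continuous_const_smul c⟩ : M →L[ℂ] M).restrictScalars ℝ

@[simp] theorem scalarMap_apply (c : ℂ) (v : M) : scalarMap M c v = c • v := rfl

/-- A complex number whose square is a primitive root of unity of order `k + 2`. -/
def halfRoot (k : ℕ) : ℂ := Complex.exp (2 * Real.pi * Complex.I / ((2 * (k + 2) : ℕ) : ℂ))

theorem isPrimitiveRoot_halfRoot (k : ℕ) : IsPrimitiveRoot (halfRoot k) (2 * (k + 2)) :=
  Complex.isPrimitiveRoot_exp _ (by omega)

theorem isPrimitiveRoot_halfRoot_sq (k : ℕ) : IsPrimitiveRoot (halfRoot k ^ 2) (k + 2) :=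
  (isPrimitiveRoot_halfRoot k).pow (by omega) rfl

theorem halfRoot_mul_conj (k : ℕ) : halfRoot k * starRingEnd ℂ (halfRoot k) = 1 := by
  rw [Complex.mul_conj, Complex.normSq_eq_norm_sq,
    (isPrimitiveRoot_halfRoot k).norm'_eq_one (by omega)]
  simp

/-- With `z = halfRoot k`, scaling by `z^j` multiplies a form of type `(p', k-p')` by
`z^(j(2p'-k))`. The weight is `z^(j(k-2p))`, so the terms are `(z²)^(j(p'-p))` and the sum is
geometric. Only even powers of `z` occur, hence the square must have the full order. The order `k +
2` separates all indices from `0` to `k + 1`, the last of which belongs to no component but is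
convenient for `p + 1`. -/
theorem sum_halfRoot (k : ℕ) {p p' : ℕ} (hp : p ≤ k + 1) (hp' : p' ≤ k) :
    ∑ j ∈ Finset.range (k + 2), ((halfRoot k ^ j) ^ k * (starRingEnd ℂ (halfRoot k ^ j)) ^ (2 * p)) *
      ((halfRoot k ^ j) ^ p' * (starRingEnd ℂ (halfRoot k ^ j)) ^ (k - p')) =
      if p = p' then (k + 2 : ℂ) else 0 := by
  set z := halfRoot k with hz
  have hz1 : z * starRingEnd ℂ z = 1 := halfRoot_mul_conj k
  have hz0 : z ≠ 0 := left_ne_zero_of_mul_eq_one hz1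
  have hzc : starRingEnd ℂ z = z⁻¹ := (eq_inv_of_mul_eq_one_right hz1)
  have hprim := isPrimitiveRoot_halfRoot_sq k
  rw [← hz] at hprim
  have h1 : ∀ j ∈ Finset.range (k + 2),
      ((z ^ j) ^ k * (starRingEnd ℂ (z ^ j)) ^ (2 * p)) *
      ((z ^ j) ^ p' * (starRingEnd ℂ (z ^ j)) ^ (k - p')) =
      ((z ^ 2) ^ p' * ((z ^ 2) ^ p)⁻¹) ^ j := by
    intro j _
    obtain ⟨d, hd⟩ := Nat.exists_eq_add_of_le hp'
    have hk : (z ^ j) ^ k * (starRingEnd ℂ (z ^ j)) ^ (k - p') = (z ^ j) ^ p' := by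
      rw [hd, Nat.add_sub_cancel_left, pow_add, mul_assoc, ← mul_pow, map_pow, ← mul_pow z, hz1]
      simp
    have hc : ∀ a b c d : ℂ, a * b * (c * d) = a * d * (c * b) := fun a b c d => by ring
    rw [hc, hk, map_pow, hzc]
    simp only [inv_pow, mul_pow, ← pow_mul, ← pow_add, ← mul_assoc]
    congr 2 <;> ring
  rw [Finset.sum_congr rfl h1]
  split_ifs with h
  · subst h
    have : (z ^ 2) ^ p * ((z ^ 2) ^ p)⁻¹ = 1 := mul_inv_cancel₀ (by positivity)
    simp [this]
  · set w := (z ^ 2) ^ p' * ((z ^ 2) ^ p)⁻¹ with hw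
    have hw1 : w ≠ 1 := by
      intro h2
      rw [hw, mul_inv_eq_one₀ (by positivity)] at h2
      exact h (hprim.pow_inj (by omega) (by omega) h2).symm
    have hwN : w ^ (k + 2) = 1 := by
      rw [hw, mul_pow, inv_pow, ← pow_mul, ← pow_mul _ p, mul_comm p', mul_comm p,
        pow_mul, pow_mul (z ^ 2) (k + 2) p, hprim.pow_eq_one]
      simp
    have := mul_neg_geom_sum w (k + 2)
    rw [hwN, sub_self] at this
    exact (mul_eq_zero.mp this).resolve_left (sub_ne_zero.mpr hw1.symm)

/-- The component of type `(p, k - p)` of a form of degree `k`. -/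
def typeProj (p : ℕ) (f : M [⋀^Fin k]→L[ℝ] ℂ) : M [⋀^Fin k]→L[ℝ] ℂ :=
  ((k + 2 : ℂ)⁻¹) • ∑ j ∈ Finset.range (k + 2),
    ((halfRoot k ^ j) ^ k * (starRingEnd ℂ (halfRoot k ^ j)) ^ (2 * p)) •
      f.compContinuousLinearMap (scalarMap M (halfRoot k ^ j))

theorem typeProj_apply (p : ℕ) (f : M [⋀^Fin k]→L[ℝ] ℂ) (v : Fin k → M) :
    typeProj p f v = ((k + 2 : ℂ)⁻¹) * ∑ j ∈ Finset.range (k + 2),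
      ((halfRoot k ^ j) ^ k * (starRingEnd ℂ (halfRoot k ^ j)) ^ (2 * p)) *
        f (fun i => halfRoot k ^ j • v i) := by
  simp only [typeProj, ContinuousAlternatingMap.smul_apply, ContinuousAlternatingMap.sum_apply,
    smul_eq_mul]
  rfl

theorem map_smul_eq_sum_slotProj (f : M [⋀^Fin k]→L[ℝ] ℂ) (c : ℂ) (v : Fin k → M) :
    f (fun i => c • v i) = ∑ s : Fin k → Bool,
      (c ^ linCount s * (starRingEnd ℂ c) ^ (k - linCount s)) * slotProj f s v := by
  rw [← sum_slotProj]
  refine Finset.sum_congr rfl fun s _ => ?_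
  rw [slotProj_smul f s (fun _ => c), prod_slotChar]

theorem typeProj_eq_sum_slotProj {p : ℕ} (hp : p ≤ k + 1) (f : M [⋀^Fin k]→L[ℝ] ℂ)
    (v : Fin k → M) :
    typeProj p f v = ∑ s : Fin k → Bool, if p = linCount s then slotProj f s v else 0 := by
  rw [typeProj_apply]
  simp_rw [map_smul_eq_sum_slotProj f, Finset.mul_sum]
  rw [Finset.sum_comm]
  refine Finset.sum_congr rfl fun s _ => ?_
  rw [← Finset.mul_sum]
  rw [Finset.sum_congr rfl fun j _ => (mul_assoc _ _ (slotProj f s v)).symm, ← Finset.sum_mul,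
    sum_halfRoot k hp (linCount_le s)]
  have : (k + 2 : ℂ) ≠ 0 := by exact_mod_cast (by omega : k + 2 ≠ 0)
  split_ifs <;> simp [this]

theorem isType_typeProj {p : ℕ} (hp : p ≤ k + 1) (f : M [⋀^Fin k]→L[ℝ] ℂ) :
    IsType p (k - p) (typeProj p f) := by
  intro c v
  rw [typeProj_eq_sum_slotProj hp, typeProj_eq_sum_slotProj hp, Finset.mul_sum]
  refine Finset.sum_congr rfl fun s _ => ?_
  split_ifs with h
  · rw [slotProj_smul f s (fun _ => c), prod_slotChar, h]
  · simp

theorem sum_typeProj (f : M [⋀^Fin k]→L[ℝ] ℂ) :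
    ∑ p ∈ Finset.range (k + 1), typeProj p f = f := by
  ext v
  rw [ContinuousAlternatingMap.sum_apply]
  rw [Finset.sum_congr rfl fun p hp =>
    typeProj_eq_sum_slotProj (by have := Finset.mem_range.mp hp; omega) f v]
  rw [Finset.sum_comm, ← sum_slotProj f v]
  refine Finset.sum_congr rfl fun s _ => ?_
  rw [Finset.sum_ite_eq' (Finset.range (k + 1)) (linCount s) fun _ => slotProj f s v]
  simp [Nat.lt_succ_of_le (linCount_le s)]

/-- No pattern has `k + 1` linear slots. This extra index lets statements about `p` and `p + 1` hold
without a case distinction at `p = k`. -/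
theorem typeProj_succ_eq_zero (f : M [⋀^Fin k]→L[ℝ] ℂ) : typeProj (k + 1) f = 0 := by
  ext v
  rw [typeProj_eq_sum_slotProj le_rfl]
  refine Finset.sum_eq_zero fun s _ => if_neg ?_
  have := linCount_le s
  omega

/-- The real scalar `2` acts by `2^k` by multilinearity and by `2^(p+q)` by the type. -/
theorem IsType.eq_zero_of_add_ne {p q : ℕ} {f : M [⋀^Fin k]→L[ℝ] ℂ} (hf : IsType p q f)
    (h : p + q ≠ k) : f = 0 := by
  ext v
  have h1 := hf 2 v
  have h2 : f (fun i => (2 : ℂ) • v i) = 2 ^ k * f v := by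
    have h3 := f.toMultilinearMap.map_smul_univ (fun _ => (2 : ℝ)) v
    have h4 : (fun i => (2 : ℂ) • v i) = fun i => (2 : ℝ) • v i := by
      ext i
      rw [← Complex.coe_smul]; norm_num
    rw [h4]
    refine h3.trans ?_
    simp
  rw [h2] at h1
  have h5 : ((2 : ℂ) ^ k - 2 ^ (p + q)) * f v = 0 := by
    rw [pow_add, sub_mul, h1]
    simp [Complex.conj_ofNat]
  refine (mul_eq_zero.mp h5).resolve_left (sub_ne_zero.mpr fun h6 => h ?_)
  have h7 : (2 : ℕ) ^ k = 2 ^ (p + q) := by exact_mod_cast h6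
  exact (Nat.pow_right_injective le_rfl h7).symm

theorem IsType.typeProj_eq {p p' q : ℕ} {f : M [⋀^Fin k]→L[ℝ] ℂ} (hf : IsType p' q f)
    (hp : p ≤ k + 1) : typeProj p f = if p = p' then f else 0 := by
  by_cases hk : p' + q = k
  · ext v
    rw [typeProj_apply]
    simp_rw [fun c : ℂ => hf c v]
    have hq : q = k - p' := by omega
    rw [hq, Finset.sum_congr rfl fun j _ => (mul_assoc _ _ (f v)).symm, ← Finset.sum_mul,
      sum_halfRoot k hp (by omega)]
    have : (k + 2 : ℂ) ≠ 0 := by exact_mod_cast (by omega : k + 2 ≠ 0)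
    split_ifs <;> simp [this]
  · rw [hf.eq_zero_of_add_ne hk]
    ext v
    simp [typeProj_apply]

theorem IsType.eq_zero_of_ne {p q p' q' : ℕ} {f : M [⋀^Fin k]→L[ℝ] ℂ} (hf : IsType p q f)
    (hf' : IsType p' q' f) (h : (p, q) ≠ (p', q')) : f = 0 := by
  by_cases hk : p + q = k
  · by_cases hk' : p' + q' = k
    · have h1 := hf.typeProj_eq (p := p) (by omega)
      rw [hf'.typeProj_eq (p := p) (by omega), if_pos rfl, if_neg] at h1
      · exact h1.symm
      · rintro rfl
        exact h (by rw [Prod.mk.injEq]; omega)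
    · exact hf'.eq_zero_of_add_ne hk'
  · exact hf.eq_zero_of_add_ne hk

theorem IsType.eq_zero_of_finrank_lt [FiniteDimensional ℂ M] {p q : ℕ} {f : M [⋀^Fin k]→L[ℝ] ℂ}
    (hf : IsType p q f) (h : Module.finrank ℂ M < p) : f = 0 := by
  by_cases hk : p + q = k
  · have h1 := hf.typeProj_eq (p := p) (by omega)
    rw [if_pos rfl] at h1
    rw [← h1]
    ext v
    rw [typeProj_eq_sum_slotProj (by omega)]
    refine Finset.sum_eq_zero fun s _ => ?_
    split_ifs with h2
    · exact slotProj_eq_zero_of_finrank_lt f s (h2 ▸ h) v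
    · rfl
  · exact hf.eq_zero_of_add_ne hk

theorem IsType.eq_zero_of_slotProj {p q : ℕ} {f : M [⋀^Fin k]→L[ℝ] ℂ} (hf : IsType p q f)
    (h : ∀ s : Fin k → Bool, linCount s = p → ∀ v, slotProj f s v = 0) : f = 0 := by
  by_cases hk : p + q = k
  · have h1 := hf.typeProj_eq (p := p) (by omega)
    rw [if_pos rfl] at h1
    rw [← h1]
    ext v
    rw [typeProj_eq_sum_slotProj (by omega)]
    refine Finset.sum_eq_zero fun s _ => ?_
    split_ifs with h2
    · exact h s h2.symm v
    · rfl
  · exact hf.eq_zero_of_add_ne hk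

/-- The alternating pattern linear, antilinear, linear, … -/
def altPattern (m : ℕ) : Fin (2 * m) → Bool := fun i => decide ((i : ℕ) % 2 = 0)

/-- The sequence `(x₁, y₁, x₂, y₂, …)`. -/
def interleave {m : ℕ} {A : Type*} (x y : Fin m → A) : Fin (2 * m) → A := fun j =>
  if (j : ℕ) % 2 = 0 then x ⟨j / 2, by omega⟩ else y ⟨j / 2, by omega⟩

theorem linCount_altPattern (m : ℕ) : linCount (altPattern m) = m := by
  rw [linCount]
  refine Eq.trans (Finset.card_bij (s := (Finset.univ : Finset (Fin m)))
    (fun i _ => (⟨2 * i, by omega⟩ : Fin (2 * m))) ?_ ?_ ?_).symm (by simp)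
  · intro i _
    simp [altPattern]
  · intro i _ j _ h
    have := congrArg Fin.val h
    simp only at this
    exact Fin.ext (by omega)
  · intro i hi
    have hi : (i : ℕ) % 2 = 0 := by simpa [altPattern] using hi
    exact ⟨⟨i / 2, by omega⟩, Finset.mem_univ _, Fin.ext (by simp only; omega)⟩

theorem exists_perm_of_linCount_eq (s t : Fin k → Bool) (h : linCount s = linCount t) :
    ∃ σ : Equiv.Perm (Fin k), s = t ∘ σ := by
  have e1 : Nonempty ({i // s i = true} ≃ {i // t i = true}) := by
    refine Fintype.card_eq.mp ?_
    rw [Fintype.card_subtype, Fintype.card_subtype]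
    exact h
  obtain ⟨e1⟩ := e1
  refine ⟨e1.extendSubtype, funext fun i => ?_⟩
  by_cases hi : s i = true
  · have := e1.extendSubtype_mem i hi
    rw [Function.comp_apply, this, hi]
  · have := e1.extendSubtype_not_mem i hi
    rw [Function.comp_apply]
    simp only [Bool.not_eq_true] at hi this
    rw [this, hi]

theorem interleave_update_left {m : ℕ} (x y : Fin m → M) (i : Fin m) (a : M) :
    interleave (Function.update x i a) y =
      Function.update (interleave x y) ⟨2 * i, by omega⟩ a := by
  ext j
  by_cases hj : (j : ℕ) = 2 * i
  · obtain ⟨j, hj'⟩ := j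
    simp only at hj
    subst hj
    simp [interleave]
  · rw [Function.update_of_ne (fun h => hj (by rw [h]))]
    unfold interleave
    split_ifs with h2
    · rw [Function.update_of_ne]
      intro h
      have := congrArg Fin.val h
      simp only at this
      omega
    · rfl

theorem interleave_update_right {m : ℕ} (x y : Fin m → M) (i : Fin m) (a : M) :
    interleave x (Function.update y i a) =
      Function.update (interleave x y) ⟨2 * i + 1, by omega⟩ a := by
  ext j
  by_cases hj : (j : ℕ) = 2 * i + 1
  · obtain ⟨j, hj'⟩ := j
    simp only at hj
    subst hj
    have h2 : (⟨(2 * (i : ℕ) + 1) / 2, by omega⟩ : Fin m) = i := Fin.ext (by simp; omega)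
    simp [interleave, h2]
  · rw [Function.update_of_ne (fun h => hj (by rw [h]))]
    unfold interleave
    split_ifs with h2
    · rfl
    · rw [Function.update_of_ne]
      intro h
      have := congrArg Fin.val h
      simp only at this
      omega

/-- In each term of the expansion, the two slots of a pair carry `x i` or `I • x i`. If they agree,
alternation gives zero; if not, the pair is `(z, ± I • z)` and the term is, up to sign, a value on a
complex frame. -/
theorem slotProj_interleave_self {m : ℕ} {f : M [⋀^Fin (2 * m)]→L[ℝ] ℂ}
    (hf : ∀ v : Fin m → M, f (complexFrame v) = 0) (x : Fin m → M) :
    slotProj f (altPattern m) (interleave x x) = 0 := by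
  rw [slotProj_apply]
  refine Finset.sum_eq_zero fun u _ => ?_
  suffices h : f (fun i => rotSel (u i) (interleave x x i)) = 0 by rw [h, mul_zero]
  by_cases hu : ∃ i : Fin m, u ⟨2 * i, by omega⟩ = u ⟨2 * i + 1, by omega⟩
  · obtain ⟨i, hi⟩ := hu
    refine f.map_eq_zero_of_eq _ (i := ⟨2 * i, by omega⟩) (j := ⟨2 * i + 1, by omega⟩) ?_
      (by simp)
    have h2 : (2 * (i : ℕ) + 1) / 2 = i := by omega
    simp [interleave, hi, h2]
  · push Not at hu
    let z : Fin m → M := fun i => rotSel (u ⟨2 * i, by omega⟩) (x i)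
    -- The sign comes from `(I • x, x) = (z, -(I • z))` for `z = I • x`.
    let c : Fin (2 * m) → ℝ := fun j =>
      if (j : ℕ) % 2 = 0 then 1 else if u ⟨2 * (j / 2), by omega⟩ then -1 else 1
    have h1 : (fun i => rotSel (u i) (interleave x x i)) = fun i => c i • complexFrame z i := by
      ext j
      by_cases hj : (j : ℕ) % 2 = 0
      · have h3 : (⟨2 * ((j : ℕ) / 2), by omega⟩ : Fin (2 * m)) = j := Fin.ext (by simp; omega)
        simp [interleave, c, complexFrame, hj, z, h3]
      · have h3 : (⟨2 * ((j : ℕ) / 2) + 1, by omega⟩ : Fin (2 * m)) = j :=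
          Fin.ext (by simp; omega)
        have h4 := hu ⟨j / 2, by omega⟩
        simp only [h3] at h4
        simp only [interleave, c, complexFrame, hj, z, if_false]
        cases h5 : u ⟨2 * ((j : ℕ) / 2), by omega⟩ <;> cases h6 : u j <;>
          simp_all [smul_smul]
    rw [h1]
    refine (f.toMultilinearMap.map_smul_univ c (complexFrame z)).trans ?_
    have h2 : f.toMultilinearMap (complexFrame z) = 0 := hf z
    rw [h2, smul_zero]

/-- Complex polarization. -/
theorem slotProj_interleave {m : ℕ} {f : M [⋀^Fin (2 * m)]→L[ℝ] ℂ}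
    (hf : ∀ v : Fin m → M, f (complexFrame v) = 0) (j : ℕ) :
    ∀ x y : Fin m → M, (∀ i : Fin m, j ≤ i → x i = y i) →
      slotProj f (altPattern m) (interleave x y) = 0 := by
  induction j with
  | zero =>
    intro x y h
    have : x = y := funext fun i => h i (Nat.zero_le _)
    subst this
    exact slotProj_interleave_self hf x
  | succ j ih =>
    intro x y h
    by_cases hj : j < m
    · set i : Fin m := ⟨j, hj⟩ with hi
      -- As functions of the pair in position `j`, the values form a sesquilinear form that vanishes
      -- on the diagonal by the induction hypothesis; replacing `a` by `I • a` in the polarized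
      -- identity shows that it vanishes.
      let ψ : M → M → ℂ := fun a b => slotProj f (altPattern m)
        (interleave (Function.update x i a) (Function.update y i b))
      have hdiag : ∀ a, ψ a a = 0 := by
        intro a
        refine ih _ _ fun l hl => ?_
        by_cases hli : l = i
        · subst hli; simp
        · rw [Function.update_of_ne hli, Function.update_of_ne hli]
          refine h l ?_
          have : (l : ℕ) ≠ j := fun h' => hli (Fin.ext h')
          omega
      have hal : ∀ a a' b, ψ (a + a') b = ψ a b + ψ a' b := by
        intro a a' b
        simp only [ψ, interleave_update_left]
        rw [MultilinearMap.map_update_add]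
      have har : ∀ a b b', ψ a (b + b') = ψ a b + ψ a b' := by
        intro a b b'
        simp only [ψ, interleave_update_right]
        rw [MultilinearMap.map_update_add]
      have hsl : ∀ (c : ℂ) a b, ψ (c • a) b = c * ψ a b := by
        intro c a b
        simp only [ψ, interleave_update_left]
        rw [slotProj_update_smul]
        simp [altPattern, slotChar]
      have hsr : ∀ (c : ℂ) a b, ψ a (c • b) = starRingEnd ℂ c * ψ a b := by
        intro c a b
        simp only [ψ, interleave_update_right]
        rw [slotProj_update_smul]
        have : (2 * j + 1) % 2 ≠ 0 := by omega
        simp [altPattern, slotChar, hi]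
      have h1 : ∀ a b, ψ a b + ψ b a = 0 := by
        intro a b
        have := hdiag (a + b)
        rw [hal, har, har, hdiag, hdiag] at this
        simpa using this
      have h2 : ψ (x i) (y i) = 0 := by
        have h3 := h1 (x i) (y i)
        have h4 := h1 (Complex.I • x i) (y i)
        rw [hsl, hsr, Complex.conj_I] at h4
        have h5 : Complex.I * (ψ (x i) (y i) - ψ (y i) (x i)) = 0 := by linear_combination h4
        have h6 := (mul_eq_zero.mp h5).resolve_left Complex.I_ne_zero
        linear_combination (h3 + h6) / 2
      simpa [ψ] using h2
    · exact ih x y fun l hl => by have := l.2; omega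

/-- A form of type `(m, m)` is determined by its values on complex frames. -/
theorem IsType.eq_zero_of_complexFrame {m : ℕ} {f : M [⋀^Fin (2 * m)]→L[ℝ] ℂ} (hf : IsType m m f)
    (h : ∀ v : Fin m → M, f (complexFrame v) = 0) : f = 0 := by
  refine hf.eq_zero_of_slotProj fun s hs v => ?_
  -- Any pattern with `m` linear slots is a permutation of the alternating one, so polarization for
  -- that one pattern suffices.
  obtain ⟨σ, rfl⟩ := exists_perm_of_linCount_eq s (altPattern m)
    (hs.trans (linCount_altPattern m).symm)
  have h1 := slotProj_comp_perm f (altPattern m) (v ∘ σ.symm) σ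
  have h2 : (v ∘ σ.symm) ∘ σ = v := by ext; simp
  rw [h2] at h1
  rw [h1]
  have h3 : v ∘ σ.symm = interleave (fun i => (v ∘ σ.symm) ⟨2 * i, by omega⟩)
      (fun i => (v ∘ σ.symm) ⟨2 * i + 1, by omega⟩) := by
    ext j
    unfold interleave
    split_ifs with hj
    · congr 1; exact Fin.ext (by simp; omega)
    · congr 1; exact Fin.ext (by simp; omega)
  rw [h3, slotProj_interleave h m _ _ fun i hi => absurd i.2 (not_lt.mpr hi), mul_zero]

end Types

/-! ### Exterior products, and positivity of powers on unitary frames. -/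

section Wedge

variable {M : Type*} [AddCommGroup M] [Module ℂ M] [TopologicalSpace M] {k l : ℕ}

/-- The term of a permutation in the exterior product. -/
def wedgeTerm (α : M [⋀^Fin k]→L[ℝ] ℂ) (β : M [⋀^Fin l]→L[ℝ] ℂ) (x : Fin k ⊕ Fin l → M)
    (σ : Equiv.Perm (Fin k ⊕ Fin l)) : ℂ :=
  (Equiv.Perm.sign σ : ℂ) * (α (fun i => x (σ (Sum.inl i))) * β (fun i => x (σ (Sum.inr i))))

/-- The sum over shuffle classes becomes a normalized sum over all permutations, for which no choice
of representatives is needed. -/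
theorem wedge_apply (α : M [⋀^Fin k]→L[ℝ] ℂ) (β : M [⋀^Fin l]→L[ℝ] ℂ) (v : Fin (k + l) → M) :
    wedge α β v = ((k.factorial * l.factorial : ℕ) : ℂ)⁻¹ *
      ∑ σ, wedgeTerm α β (fun i => v (finSumFinEquiv i)) σ := by
  have h := MultilinearMap.domCoprod_alternization_eq α.toAlternatingMap β.toAlternatingMap
  have h1 := congrArg (fun f => LinearMap.mul' ℝ ℂ (f (fun i => v (finSumFinEquiv i)))) h
  simp only [Fintype.card_fin, MultilinearMap.alternatization_apply, AlternatingMap.smul_apply,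
    map_nsmul, map_sum] at h1
  have h2 : wedge α β v = LinearMap.mul' ℝ ℂ ((α.toAlternatingMap.domCoprod β.toAlternatingMap)
    (fun i => v (finSumFinEquiv i))) := rfl
  have h3 : ((k.factorial * l.factorial : ℕ) : ℂ) ≠ 0 := by
    exact_mod_cast Nat.mul_ne_zero k.factorial_ne_zero l.factorial_ne_zero
  rw [eq_inv_mul_iff_mul_eq₀ h3, h2, ← nsmul_eq_mul, ← h1]
  refine Finset.sum_congr rfl fun σ _ => ?_
  rw [Units.smul_def, map_zsmul, zsmul_eq_mul]
  simp only [MultilinearMap.domDomCongr_apply, MultilinearMap.domCoprod_apply, LinearMap.mul'_apply,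
    wedgeTerm]
  rfl

theorem wedge_add_left (α α' : M [⋀^Fin k]→L[ℝ] ℂ) (β : M [⋀^Fin l]→L[ℝ] ℂ) :
    wedge (α + α') β = wedge α β + wedge α' β := by
  ext v
  simp only [ContinuousAlternatingMap.add_apply, wedge_apply, wedgeTerm]
  rw [← mul_add, ← Finset.sum_add_distrib]
  congr 1
  exact Finset.sum_congr rfl fun σ _ => by ring

theorem wedge_add_right (α : M [⋀^Fin k]→L[ℝ] ℂ) (β β' : M [⋀^Fin l]→L[ℝ] ℂ) :
    wedge α (β + β') = wedge α β + wedge α β' := by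
  ext v
  simp only [ContinuousAlternatingMap.add_apply, wedge_apply, wedgeTerm]
  rw [← mul_add, ← Finset.sum_add_distrib]
  congr 1
  exact Finset.sum_congr rfl fun σ _ => by ring

theorem wedge_smul_left (c : ℂ) (α : M [⋀^Fin k]→L[ℝ] ℂ) (β : M [⋀^Fin l]→L[ℝ] ℂ) :
    wedge (c • α) β = c • wedge α β := by
  ext v
  simp only [ContinuousAlternatingMap.smul_apply, wedge_apply, wedgeTerm, smul_eq_mul,
    Finset.mul_sum]
  exact Finset.sum_congr rfl fun σ _ => by ring

theorem wedge_smul_right (c : ℂ) (α : M [⋀^Fin k]→L[ℝ] ℂ) (β : M [⋀^Fin l]→L[ℝ] ℂ) :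
    wedge α (c • β) = c • wedge α β := by
  ext v
  simp only [ContinuousAlternatingMap.smul_apply, wedge_apply, wedgeTerm, smul_eq_mul,
    Finset.mul_sum]
  exact Finset.sum_congr rfl fun σ _ => by ring

theorem wedge_compContinuousLinearMap {M' : Type*} [AddCommGroup M'] [Module ℂ M']
    [TopologicalSpace M'] (α : M [⋀^Fin k]→L[ℝ] ℂ) (β : M [⋀^Fin l]→L[ℝ] ℂ) (L : M' →L[ℝ] M) :
    (wedge α β).compContinuousLinearMap L =
      wedge (α.compContinuousLinearMap L) (β.compContinuousLinearMap L) := by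
  ext v
  rw [ContinuousAlternatingMap.compContinuousLinearMap_apply, wedge_apply, wedge_apply]
  rfl

theorem wedgePow_compContinuousLinearMap {M' : Type*} [AddCommGroup M'] [Module ℂ M']
    [TopologicalSpace M'] (γ : M [⋀^Fin 2]→L[ℝ] ℂ) (L : M' →L[ℝ] M) (m : ℕ) :
    (wedgePow γ m).compContinuousLinearMap L = wedgePow (γ.compContinuousLinearMap L) m := by
  induction m with
  | zero => ext v; rfl
  | succ m ih =>
    rw [wedgePow, wedgePow, ← ih]
    exact wedge_compContinuousLinearMap _ _ _

theorem IsType.wedge {p q p' q' : ℕ} {α : M [⋀^Fin k]→L[ℝ] ℂ} {β : M [⋀^Fin l]→L[ℝ] ℂ}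
    (hα : IsType p q α) (hβ : IsType p' q' β) :
    IsType (p + p') (q + q') (StronglyGauduchon.wedge α β) := by
  intro c v
  simp only [wedge_apply, wedgeTerm, Finset.mul_sum]
  refine Finset.sum_congr rfl fun σ _ => ?_
  rw [hα c fun i => v (finSumFinEquiv (σ (Sum.inl i))),
    hβ c fun i => v (finSumFinEquiv (σ (Sum.inr i)))]
  ring

theorem IsType.wedgePow {γ : M [⋀^Fin 2]→L[ℝ] ℂ} (hγ : IsType 1 1 γ) (m : ℕ) :
    IsType m m (wedgePow γ m) := by
  induction m with
  | zero =>
    intro c v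
    simp [StronglyGauduchon.wedgePow]
  | succ m ih => exact ih.wedge hγ

/-- Both factors are alternating, so the signs of `τ` and `τ'` appear twice and cancel: a term
depends only on the coset of `σ`. -/
theorem wedgeTerm_sumCongr (α : M [⋀^Fin k]→L[ℝ] ℂ) (β : M [⋀^Fin l]→L[ℝ] ℂ)
    (x : Fin k ⊕ Fin l → M) (σ : Equiv.Perm (Fin k ⊕ Fin l)) (τ : Equiv.Perm (Fin k))
    (τ' : Equiv.Perm (Fin l)) :
    wedgeTerm α β x (σ * Equiv.Perm.sumCongr τ τ') = wedgeTerm α β x σ := by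
  have h1 : α (fun i => x (σ (Sum.inl (τ i)))) =
      (Equiv.Perm.sign τ : ℂ) * α (fun i => x (σ (Sum.inl i))) := by
    have := α.toAlternatingMap.map_perm (fun i => x (σ (Sum.inl i))) τ
    refine this.trans ?_
    rw [Units.smul_def, zsmul_eq_mul]
    rfl
  have h2 : β (fun i => x (σ (Sum.inr (τ' i)))) =
      (Equiv.Perm.sign τ' : ℂ) * β (fun i => x (σ (Sum.inr i))) := by
    have := β.toAlternatingMap.map_perm (fun i => x (σ (Sum.inr i))) τ'
    refine this.trans ?_
    rw [Units.smul_def, zsmul_eq_mul]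
    rfl
  have hs : ∀ {n : ℕ} (ρ : Equiv.Perm (Fin n)),
      ((Equiv.Perm.sign ρ : ℤ) : ℂ) * ((Equiv.Perm.sign ρ : ℤ) : ℂ) = 1 := by
    intro n ρ
    rcases Int.units_eq_one_or (Equiv.Perm.sign ρ) with h | h <;> simp [h]
  simp only [wedgeTerm, Equiv.Perm.sign_mul, Equiv.Perm.sign_sumCongr, Equiv.Perm.mul_apply,
    Equiv.Perm.sumCongr_apply, Sum.map_inl, Sum.map_inr, h1, h2, Units.val_mul, Int.cast_mul]
  linear_combination ((Equiv.Perm.sign σ : ℤ) : ℂ) * (α fun i => x (σ (Sum.inl i))) *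
    (β fun i => x (σ (Sum.inr i))) *
    (((Equiv.Perm.sign τ' : ℤ) : ℂ) * ((Equiv.Perm.sign τ' : ℤ) : ℂ) * hs τ + hs τ')

/-- If `β` vanishes as soon as one of its arguments is one of the first `k` vectors, then only one
term of the exterior product survives. -/
theorem wedge_apply_of_forall_eq_zero (α : M [⋀^Fin k]→L[ℝ] ℂ) (β : M [⋀^Fin l]→L[ℝ] ℂ)
    (v : Fin (k + l) → M)
    (h : ∀ (w : Fin l → M) (i : Fin l) (j : Fin k), w i = v (Fin.castAdd l j) → β w = 0) :
    wedge α β v = α (fun i => v (Fin.castAdd l i)) * β (fun i => v (Fin.natAdd k i)) := by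
  classical
  set x : Fin k ⊕ Fin l → M := fun i => v (finSumFinEquiv i) with hx
  have h0 : ∀ σ : Equiv.Perm (Fin k ⊕ Fin l), σ ∉ (Finset.univ : Finset
      (Equiv.Perm (Fin k) × Equiv.Perm (Fin l))).image (fun p => Equiv.Perm.sumCongr p.1 p.2) →
      wedgeTerm α β x σ = 0 := by
    intro σ hσ
    by_cases hm : ∃ (i : Fin l) (j : Fin k), σ (Sum.inr i) = Sum.inl j
    · obtain ⟨i, j, hij⟩ := hm
      rw [wedgeTerm, h (fun i => x (σ (Sum.inr i))) i j (by simp only [hij, hx]; rfl)]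
      simp
    · exfalso
      apply hσ
      have hm2 : Set.MapsTo σ (Set.range Sum.inr) (Set.range Sum.inr) := by
        rintro _ ⟨i, rfl⟩
        rcases hi : σ (Sum.inr i) with j | j
        · exact absurd ⟨i, j, hi⟩ hm
        · exact ⟨j, rfl⟩
      obtain ⟨p, hp⟩ := Equiv.Perm.mem_sumCongrHom_range_of_perm_mapsTo_inl
        ((Equiv.Perm.perm_mapsTo_inl_iff_mapsTo_inr σ).mpr hm2)
      exact Finset.mem_image.mpr ⟨p, Finset.mem_univ _, hp⟩
  rw [wedge_apply, ← Finset.sum_subset (Finset.subset_univ _) fun σ _ hσ => h0 σ hσ,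
    Finset.sum_image]
  · have h1 : ∀ p : Equiv.Perm (Fin k) × Equiv.Perm (Fin l),
        wedgeTerm α β x (Equiv.Perm.sumCongr p.1 p.2) =
          α (fun i => v (Fin.castAdd l i)) * β (fun i => v (Fin.natAdd k i)) := by
      intro p
      rw [← one_mul (Equiv.Perm.sumCongr p.1 p.2), wedgeTerm_sumCongr]
      simp [wedgeTerm, hx]
    rw [Finset.sum_congr rfl fun p _ => h1 p, Finset.sum_const, nsmul_eq_mul, Finset.card_univ,
      Fintype.card_prod, Fintype.card_perm, Fintype.card_perm, Fintype.card_fin, Fintype.card_fin,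
      ← mul_assoc, inv_mul_cancel₀, one_mul]
    exact_mod_cast Nat.mul_ne_zero k.factorial_ne_zero l.factorial_ne_zero
  · intro p _ p' _ hpp
    exact Equiv.Perm.sumCongrHom_injective hpp

theorem complexFrame_castAdd {m : ℕ} (v : Fin (m + 1) → M) :
    (fun i => complexFrame v (Fin.castAdd 2 i : Fin (2 * m + 2))) =
      complexFrame (fun i => v i.castSucc) := by
  ext i
  simp [complexFrame]

theorem complexFrame_natAdd {m : ℕ} (v : Fin (m + 1) → M) :
    (fun i => complexFrame v (Fin.natAdd (2 * m) i : Fin (2 * m + 2))) =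
      ![v (Fin.last m), Complex.I • v (Fin.last m)] := by
  ext i
  fin_cases i
  · simp [complexFrame, Fin.last]
  · have h1 : (2 * m + 1) % 2 ≠ 0 := by omega
    have h2 : (2 * m + 1) / 2 = m := by omega
    simp [complexFrame, Fin.last, h2]

/-- The permutation of the indices of a real frame that exchanges the complex lines `j` and `m`. -/
def swapLines {m : ℕ} (j : Fin (m + 1)) : Equiv.Perm (Fin (2 * m + 2)) :=
  Equiv.swap ⟨2 * j, by omega⟩ ⟨2 * m, by omega⟩ *
    Equiv.swap ⟨2 * j + 1, by omega⟩ ⟨2 * m + 1, by omega⟩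

theorem swapLines_val {m : ℕ} (j : Fin (m + 1)) (q : Fin (2 * m + 2)) :
    (swapLines j q : ℕ) = if (q : ℕ) = 2 * j then 2 * m else if (q : ℕ) = 2 * m then 2 * j else
      if (q : ℕ) = 2 * j + 1 then 2 * m + 1 else if (q : ℕ) = 2 * m + 1 then 2 * j + 1 else q := by
  simp only [swapLines, Equiv.Perm.mul_apply, Equiv.swap_apply_def, Fin.ext_iff]
  split_ifs <;> simp_all <;> omega

theorem sign_swapLines {m : ℕ} (j : Fin (m + 1)) : Equiv.Perm.sign (swapLines j) = 1 := by
  rw [swapLines, Equiv.Perm.sign_mul, Equiv.Perm.sign_swap', Equiv.Perm.sign_swap']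
  simp only [Fin.mk.injEq]
  split_ifs <;> first | omega | simp

theorem complexFrame_swapLines {m : ℕ} (v : Fin (m + 1) → M) (j : Fin (m + 1))
    (q : Fin (2 * m + 2)) :
    complexFrame v (swapLines j q : Fin (2 * (m + 1))) =
      complexFrame (fun i => v (Equiv.swap j (Fin.last m) i)) (q : Fin (2 * (m + 1))) := by
  have hj := j.2
  have h1 : (swapLines j q : ℕ) % 2 = (q : ℕ) % 2 := by
    rw [swapLines_val]; split_ifs <;> omega
  have h2 : (⟨(swapLines j q : ℕ) / 2, by omega⟩ : Fin (m + 1)) =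
      Equiv.swap j (Fin.last m) ⟨(q : ℕ) / 2, by omega⟩ := by
    apply Fin.ext
    have h3 := swapLines_val j q
    rw [Equiv.swap_apply_def]
    simp only [Fin.ext_iff, Fin.val_last]
    split_ifs at h3 ⊢ <;> first | omega | (simp only [Fin.val_last]; omega)
  simp only [complexFrame, h1, h2]

open scoped ComplexOrder in
/-- The powers of a `2`-form are positive on a unitary frame. -/
theorem wedgePow_complexFrame_pos {γ : M [⋀^Fin 2]→L[ℝ] ℂ} (m : ℕ) :
    ∀ v : Fin m → M, (∀ i j, γ ![v i, v j] = 0) →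
      (∀ i j, γ ![Complex.I • v i, Complex.I • v j] = 0) →
      (∀ i j, γ ![v i, Complex.I • v j] = if i = j then 1 else 0) →
      0 < wedgePow γ m (complexFrame v) := by
  induction m with
  | zero =>
    intro v _ _ _
    simp [wedgePow]
  | succ m ih =>
    intro v h1 h2 h3
    set x : Fin (2 * m) ⊕ Fin 2 → M :=
      fun i => complexFrame v (finSumFinEquiv i : Fin (2 * m + 2)) with hx
    have hxl : ∀ i : Fin (2 * m), x (Sum.inl i) = complexFrame (fun i => v i.castSucc) i :=
      fun i => congrFun (complexFrame_castAdd v) i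
    have hxr : ∀ i : Fin 2, x (Sum.inr i) = ![v (Fin.last m), Complex.I • v (Fin.last m)] i :=
      fun i => congrFun (complexFrame_natAdd v) i
    have hterm : ∀ τ : Equiv.Perm (Fin (m + 1)),
        0 < wedgePow γ m (complexFrame fun i => v (τ i.castSucc)) := by
      intro τ
      refine ih _ (fun i j => h1 _ _) (fun i j => h2 _ _) fun i j => ?_
      rw [h3]
      congr 1
      simp
    have hγ : ∀ i, γ ![v i, Complex.I • v i] = 1 := fun i => by rw [h3, if_pos rfl]
    -- For the term that hands line `j` to the last factor, exchange the lines `j` and `m`. The sign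
    -- is even, and the first factor is evaluated on a permuted unitary frame, where the induction
    -- hypothesis applies.
    have hlines : ∀ j : Fin (m + 1), 0 ≤ wedgeTerm (wedgePow γ m) γ x
        (finSumFinEquiv.symm.permCongr (swapLines j)) := by
      intro j
      have hl : (fun i => x (finSumFinEquiv.symm.permCongr (swapLines j) (Sum.inl i))) =
          complexFrame (fun i => v (Equiv.swap j (Fin.last m) i.castSucc)) := by
        ext i
        have := complexFrame_swapLines v j (Fin.castAdd 2 i)
        refine Eq.trans ?_ (this.trans
          (congrFun (complexFrame_castAdd fun i => v (Equiv.swap j (Fin.last m) i)) i))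
        simp [hx, Equiv.permCongr_apply]
      have hr : (fun i => x (finSumFinEquiv.symm.permCongr (swapLines j) (Sum.inr i))) =
          ![v j, Complex.I • v j] := by
        ext i
        have := complexFrame_swapLines v j (Fin.natAdd (2 * m) i)
        have h5 := this.trans
          (congrFun (complexFrame_natAdd fun i => v (Equiv.swap j (Fin.last m) i)) i)
        rw [Equiv.swap_apply_right] at h5
        refine Eq.trans ?_ h5
        simp [hx, Equiv.permCongr_apply]
      rw [wedgeTerm, hl, hr, Equiv.Perm.sign_permCongr, sign_swapLines, hγ]
      simpa using (hterm (Equiv.swap j (Fin.last m))).le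
    have hx' : ∀ p, x p = rotSel (decide ((finSumFinEquiv p : ℕ) % 2 ≠ 0))
        (v ⟨(finSumFinEquiv p : ℕ) / 2, by have := (finSumFinEquiv p).2; omega⟩) := by
      intro p
      simp only [hx, complexFrame]
      by_cases hp : (finSumFinEquiv p : ℕ) % 2 = 0 <;> simp [hp]
    -- Either `σ` sends the last two slots to different complex lines, and `γ` gives zero, or to a
    -- single line `j`, and then `σ` is in the coset of the exchange of the lines `j` and `m`. The
    -- identity supplies a strictly positive term.
    have hnn : ∀ σ, 0 ≤ wedgeTerm (wedgePow γ m) γ x σ := by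
      intro σ
      have hne : (finSumFinEquiv (σ (Sum.inr 0)) : ℕ) ≠ finSumFinEquiv (σ (Sum.inr 1)) := by
        intro h
        have := σ.injective (finSumFinEquiv.injective (Fin.ext h))
        simp at this
      have hlt0 := (finSumFinEquiv (σ (Sum.inr 0))).2
      have hlt1 := (finSumFinEquiv (σ (Sum.inr 1))).2
      by_cases hp : (finSumFinEquiv (σ (Sum.inr 0)) : ℕ) / 2 = (finSumFinEquiv (σ (Sum.inr 1)) : ℕ) / 2
      · set j : Fin (m + 1) := ⟨(finSumFinEquiv (σ (Sum.inr 0)) : ℕ) / 2, by omega⟩ with hj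
        have hjv : (j : ℕ) = (finSumFinEquiv (σ (Sum.inr 0)) : ℕ) / 2 := rfl
        set τ := finSumFinEquiv.symm.permCongr (swapLines j) with hτ
        have hmem : ∀ i : Fin 2, τ (Sum.inr 0) = σ (Sum.inr i) ∨ τ (Sum.inr 1) = σ (Sum.inr i) := by
          intro i
          have h0 : (finSumFinEquiv (τ (Sum.inr 0)) : ℕ) = 2 * j := by
            have hj2 := j.2
            simp only [hτ, Equiv.permCongr_apply, Equiv.symm_symm, Equiv.apply_symm_apply,
              finSumFinEquiv_apply_right, swapLines_val, Fin.val_natAdd]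
            split_ifs <;> simp at * <;> omega
          have h1 : (finSumFinEquiv (τ (Sum.inr 1)) : ℕ) = 2 * j + 1 := by
            have hj2 := j.2
            simp only [hτ, Equiv.permCongr_apply, Equiv.symm_symm, Equiv.apply_symm_apply,
              finSumFinEquiv_apply_right, swapLines_val, Fin.val_natAdd]
            split_ifs <;> simp at * <;> omega
          have h2 : (finSumFinEquiv (σ (Sum.inr i)) : ℕ) = 2 * j ∨
              (finSumFinEquiv (σ (Sum.inr i)) : ℕ) = 2 * j + 1 := by
            fin_cases i <;> simp only [Fin.zero_eta, Fin.mk_one] <;> omega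
          rcases h2 with h2 | h2
          · left; exact finSumFinEquiv.injective (Fin.ext (h0.trans h2.symm))
          · right; exact finSumFinEquiv.injective (Fin.ext (h1.trans h2.symm))
        have hm2 : Set.MapsTo (τ⁻¹ * σ) (Set.range Sum.inr) (Set.range Sum.inr) := by
          rintro _ ⟨i, rfl⟩
          rcases hmem i with h | h
          · exact ⟨0, by rw [Equiv.Perm.mul_apply, ← h]; simp⟩
          · exact ⟨1, by rw [Equiv.Perm.mul_apply, ← h]; simp⟩
        obtain ⟨p, hp⟩ := Equiv.Perm.mem_sumCongrHom_range_of_perm_mapsTo_inl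
          ((Equiv.Perm.perm_mapsTo_inl_iff_mapsTo_inr (τ⁻¹ * σ)).mpr hm2)
        have hσ : σ = τ * Equiv.Perm.sumCongr p.1 p.2 := by
          rw [← Equiv.Perm.sumCongrHom_apply, hp, mul_inv_cancel_left]
        rw [hσ, wedgeTerm_sumCongr]
        exact hlines j
      · have h0 : γ (fun i => x (σ (Sum.inr i))) = 0 := by
          have h4 : (fun i => x (σ (Sum.inr i))) = ![x (σ (Sum.inr 0)), x (σ (Sum.inr 1))] := by
            ext i; fin_cases i <;> rfl
          rw [h4, hx', hx' (σ (Sum.inr 1))]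
          cases decide ((finSumFinEquiv (σ (Sum.inr 0)) : ℕ) % 2 ≠ 0) <;>
            cases decide ((finSumFinEquiv (σ (Sum.inr 1)) : ℕ) % 2 ≠ 0) <;>
            simp only [rotSel_true, rotSel_false]
          · exact h1 _ _
          · rw [h3, if_neg (by simpa [Fin.ext_iff] using hp)]
          · have h5 := γ.toAlternatingMap.map_swap
              ![v ⟨(finSumFinEquiv (σ (Sum.inr 1)) : ℕ) / 2, by omega⟩,
                Complex.I • v ⟨(finSumFinEquiv (σ (Sum.inr 0)) : ℕ) / 2, by omega⟩]
              (i := 0) (j := 1) (by simp)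
            have h6 : ![v ⟨(finSumFinEquiv (σ (Sum.inr 1)) : ℕ) / 2, by omega⟩,
                Complex.I • v ⟨(finSumFinEquiv (σ (Sum.inr 0)) : ℕ) / 2, by omega⟩] ∘
                Equiv.swap (0 : Fin 2) 1 =
              ![Complex.I • v ⟨(finSumFinEquiv (σ (Sum.inr 0)) : ℕ) / 2, by omega⟩,
                v ⟨(finSumFinEquiv (σ (Sum.inr 1)) : ℕ) / 2, by omega⟩] := by
              ext i; fin_cases i <;> simp
            rw [h6] at h5
            refine h5.trans ?_
            rw [neg_eq_zero]
            refine (h3 _ _).trans (if_neg ?_)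
            simpa [Fin.ext_iff] using fun h => hp h.symm
          · exact h2 _ _
        rw [wedgeTerm, h0]
        simp
    have hone : 0 < wedgeTerm (wedgePow γ m) γ x 1 := by
      have := hterm 1
      simp only [wedgeTerm, Equiv.Perm.sign_one, Equiv.Perm.coe_one, id_eq, hxl, hxr]
      have h4 : (fun i => ![v (Fin.last m), Complex.I • v (Fin.last m)] i) =
        ![v (Fin.last m), Complex.I • v (Fin.last m)] := rfl
      simpa [h4, hγ] using this
    have hw : wedgePow γ (m + 1) (complexFrame v) = (((2 * m).factorial * Nat.factorial 2 : ℕ) : ℂ)⁻¹ *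
      ∑ σ, wedgeTerm (wedgePow γ m) γ x σ := wedge_apply _ _ _
    rw [hw]
    have hsum : 0 < ∑ σ, wedgeTerm (wedgePow γ m) γ x σ :=
      Finset.sum_pos' (fun σ _ => hnn σ) ⟨1, Finset.mem_univ _, hone⟩
    refine mul_pos ?_ hsum
    rw [inv_pos]
    exact_mod_cast Nat.mul_pos (Nat.factorial_pos _) (Nat.factorial_pos _)

end Wedge

/-! ### Hermitian matrices and `(1, 1)`-forms. -/

section HermitianForms

open Matrix
open scoped ComplexOrder

variable {E : Type*} [NormedAddCommGroup E] [NormedSpace ℂ E]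

/-- The `(1, 1)`-form `(i / 2) ζ ∧ ξ̄` of two complex linear functionals. -/
def pairForm (ξ ζ : E →L[ℂ] ℂ) : E [⋀^Fin 2]→L[ℝ] ℂ where
  toFun v := (starRingEnd ℂ (ξ (v 0)) * ζ (v 1) - starRingEnd ℂ (ξ (v 1)) * ζ (v 0)) /
    (2 * Complex.I)
  map_update_add' v i x y := by
    fin_cases i <;> simp [Function.update] <;> ring
  map_update_smul' v i c x := by
    fin_cases i <;> simp [Function.update] <;> ring
  cont := by fun_prop
  map_eq_zero_of_eq' v i j hv hij := by
    fin_cases i <;> fin_cases j <;> simp_all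

theorem pairForm_apply (ξ ζ : E →L[ℂ] ℂ) (v : Fin 2 → E) :
    pairForm ξ ζ v = (starRingEnd ℂ (ξ (v 0)) * ζ (v 1) - starRingEnd ℂ (ξ (v 1)) * ζ (v 0)) /
      (2 * Complex.I) := rfl

theorem isType_pairForm (ξ ζ : E →L[ℂ] ℂ) : IsType 1 1 (pairForm ξ ζ) := by
  intro c v
  simp only [pairForm_apply, map_smul, smul_eq_mul, map_mul, pow_one]
  ring

theorem pairForm_self_apply (ξ ζ : E →L[ℂ] ℂ) (v : E) :
    pairForm ξ ζ ![v, Complex.I • v] = starRingEnd ℂ (ξ v) * ζ v := by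
  simp only [pairForm_apply, cons_val_zero, cons_val_one, map_smul, smul_eq_mul, map_mul,
    Complex.conj_I]
  have : Complex.I ≠ 0 := Complex.I_ne_zero
  field_simp
  ring

theorem IsType.sum {M : Type*} [AddCommGroup M] [Module ℂ M] [TopologicalSpace M] {k p q : ℕ}
    {ι : Type*} (s : Finset ι) {f : ι → M [⋀^Fin k]→L[ℝ] ℂ} (hf : ∀ i ∈ s, IsType p q (f i)) :
    IsType p q (∑ i ∈ s, f i) := by
  intro c v
  rw [ContinuousAlternatingMap.sum_apply, ContinuousAlternatingMap.sum_apply, Finset.mul_sum]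
  exact Finset.sum_congr rfl fun i hi => hf i hi c v

theorem IsType.smul {M : Type*} [AddCommGroup M] [Module ℂ M] [TopologicalSpace M] {k p q : ℕ}
    {f : M [⋀^Fin k]→L[ℝ] ℂ} (hf : IsType p q f) (a : ℂ) : IsType p q (a • f) := by
  intro c v
  rw [ContinuousAlternatingMap.smul_apply, ContinuousAlternatingMap.smul_apply, hf c v]
  simp only [smul_eq_mul]
  ring

theorem IsType.add {M : Type*} [AddCommGroup M] [Module ℂ M] [TopologicalSpace M] {k p q : ℕ}
    {f g : M [⋀^Fin k]→L[ℝ] ℂ} (hf : IsType p q f) (hg : IsType p q g) : IsType p q (f + g) := by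
  intro c v
  rw [ContinuousAlternatingMap.add_apply, ContinuousAlternatingMap.add_apply, hf c v, hg c v,
    mul_add]

variable [FiniteDimensional ℂ E] {n : ℕ} (b : Module.Basis (Fin n) ℂ E)

/-- The coordinate functionals of a basis. -/
def coordFun (j : Fin n) : E →L[ℂ] ℂ := LinearMap.toContinuousLinearMap (b.coord j)

theorem coordFun_apply (j : Fin n) (v : E) : coordFun b j v = b.repr v j := rfl

/-- The `(1, 1)`-form with given matrix in a basis. -/
def hermForm (H : Matrix (Fin n) (Fin n) ℂ) : E [⋀^Fin 2]→L[ℝ] ℂ :=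
  ∑ j, ∑ k, H j k • pairForm (coordFun b j) (coordFun b k)

theorem isType_hermForm (H : Matrix (Fin n) (Fin n) ℂ) : IsType 1 1 (hermForm b H) :=
  IsType.sum _ fun _ _ => IsType.sum _ fun _ _ => (isType_pairForm _ _).smul _

theorem hermForm_self_apply (H : Matrix (Fin n) (Fin n) ℂ) (v : E) :
    hermForm b H ![v, Complex.I • v] = star (b.repr v : Fin n → ℂ) ⬝ᵥ (H *ᵥ (b.repr v)) := by
  simp only [hermForm, ContinuousAlternatingMap.sum_apply, ContinuousAlternatingMap.smul_apply,
    pairForm_self_apply, coordFun_apply, smul_eq_mul, dotProduct, mulVec, Finset.mul_sum,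
    Pi.star_apply, RCLike.star_def]
  exact Finset.sum_congr rfl fun j _ => Finset.sum_congr rfl fun k _ => by ring

/-- The `ℝ`-linear endomorphism with a given complex matrix. -/
def matMap (L : Matrix (Fin n) (Fin n) ℂ) : E →L[ℝ] E :=
  (LinearMap.toContinuousLinearMap (Matrix.toLin b b L)).restrictScalars ℝ

theorem repr_matMap (L : Matrix (Fin n) (Fin n) ℂ) (v : E) :
    (b.repr (matMap b L v) : Fin n → ℂ) = L *ᵥ b.repr v := by
  have : matMap b L v = Matrix.toLin b b L v := rfl
  rw [this, Matrix.repr_toLin]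

theorem pairForm_comp_matMap (L : Matrix (Fin n) (Fin n) ℂ) (j k : Fin n) :
    (pairForm (coordFun b j) (coordFun b k)).compContinuousLinearMap (matMap b L) =
      ∑ j', ∑ k', (starRingEnd ℂ (L j j') * L k k') •
        pairForm (coordFun b j') (coordFun b k') := by
  ext v
  have h1 : ∀ (l : Fin n) (i : Fin 2), coordFun b l (matMap b L (v i)) =
      ∑ l', L l l' * b.repr (v i) l' := by
    intro l i
    rw [coordFun_apply, repr_matMap]
    rfl
  simp only [ContinuousAlternatingMap.compContinuousLinearMap_apply, pairForm_apply,
    ContinuousAlternatingMap.sum_apply, ContinuousAlternatingMap.smul_apply, Function.comp_apply,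
    h1, map_sum, map_mul, coordFun_apply, smul_eq_mul, Finset.sum_mul_sum,
    ← Finset.sum_sub_distrib, Finset.sum_div]
  exact Finset.sum_congr rfl fun j _ => Finset.sum_congr rfl fun k _ => by ring

/-- Both sides are of type `(1, 1)`, so it is enough to compare them on pairs `(v, I • v)`, where
they are values of the Hermitian forms. -/
theorem hermForm_comp_matMap (H L : Matrix (Fin n) (Fin n) ℂ) :
    (hermForm b H).compContinuousLinearMap (matMap b L) = hermForm b (Lᴴ * H * L) := by
  have h2 : IsType 1 1 ((hermForm b H).compContinuousLinearMap (matMap b L)) := by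
    intro c v
    have := isType_hermForm b H c (fun i => matMap b L (v i))
    refine Eq.trans ?_ this
    simp only [ContinuousAlternatingMap.compContinuousLinearMap_apply]
    congr 1
    ext i
    simp [matMap]
  rw [← sub_eq_zero]
  have h3 : IsType 1 1 ((hermForm b H).compContinuousLinearMap (matMap b L) -
      hermForm b (Lᴴ * H * L)) := by
    rw [sub_eq_add_neg, ← neg_one_smul ℂ (hermForm b (Lᴴ * H * L))]
    exact h2.add ((isType_hermForm b _).smul _)
  refine IsType.eq_zero_of_complexFrame (m := 1) h3 fun v => ?_
  have h4 : complexFrame v = ![v 0, Complex.I • v 0] := by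
    ext i; fin_cases i <;> rfl
  rw [h4, ContinuousAlternatingMap.sub_apply, sub_eq_zero, hermForm_self_apply]
  have h5 : ((hermForm b H).compContinuousLinearMap (matMap b L)) ![v 0, Complex.I • v 0] =
      hermForm b H ![matMap b L (v 0), Complex.I • matMap b L (v 0)] := by
    rw [ContinuousAlternatingMap.compContinuousLinearMap_apply]
    congr 1
    ext i
    fin_cases i
    · rfl
    · simp [matMap]
  rw [h5, hermForm_self_apply, repr_matMap, star_mulVec, ← dotProduct_mulVec]
  simp only [mulVec_mulVec, Matrix.mul_assoc]

/-- A form of top degree is multiplied by the real determinant, which for a complex linear map is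
`|det|²`. Real and imaginary parts are treated separately, since the statement about bases concerns
real-valued forms. -/
theorem compContinuousLinearMap_top [NeZero n] (τ : E [⋀^Fin (2 * n)]→L[ℝ] ℂ)
    (L : Matrix (Fin n) (Fin n) ℂ) (v : Fin (2 * n) → E) :
    τ (matMap b L ∘ v) = (Complex.normSq L.det : ℂ) * τ v := by
  have hdim : Module.finrank ℝ E = 2 * n := by
    rw [finrank_real_of_complex, Module.finrank_eq_card_basis b, Fintype.card_fin]
  let e : Module.Basis (Fin (2 * n)) ℝ E := Module.finBasisOfFinrankEq ℝ E hdim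
  have hdet : LinearMap.det ((Matrix.toLin b b L).restrictScalars ℝ) = Complex.normSq L.det := by
    rw [LinearMap.det_restrictScalars, LinearMap.det_toLin, Algebra.norm_complex_apply]
  have key : ∀ f : E [⋀^Fin (2 * n)]→ₗ[ℝ] ℝ, f (matMap b L ∘ v) = Complex.normSq L.det * f v := by
    intro f
    rw [f.eq_smul_basis_det e]
    have := e.det_comp ((Matrix.toLin b b L).restrictScalars ℝ) v
    rw [hdet] at this
    simp only [AlternatingMap.smul_apply, smul_eq_mul]
    have h2 : e.det (matMap b L ∘ v) = e.det (⇑((Matrix.toLin b b L).restrictScalars ℝ) ∘ v) := rfl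
    rw [h2, this]
    ring
  apply Complex.ext
  · have := key (Complex.reLm.compAlternatingMap τ.toAlternatingMap)
    rw [Complex.re_ofReal_mul]
    exact this
  · have := key (Complex.imLm.compAlternatingMap τ.toAlternatingMap)
    rw [Complex.im_ofReal_mul]
    exact this

theorem comp_complexFrame (L : Matrix (Fin n) (Fin n) ℂ) {m : ℕ} (v : Fin m → E) :
    matMap b L ∘ complexFrame v = complexFrame (fun i => matMap b L (v i)) := by
  ext i
  simp only [complexFrame, Function.comp_apply]
  split_ifs <;> simp [matMap]

end HermitianForms

/-! ### Forms of degree `2m` in dimension `m + 1` as Hermitian forms on covectors. -/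

section PositivityMatrix

open Matrix
open scoped ComplexOrder

variable {E : Type*} [NormedAddCommGroup E] [NormedSpace ℂ E]

/-- The exterior product as a linear map in the second factor. -/
def wedgeRight {k l : ℕ} (α : E [⋀^Fin k]→L[ℝ] ℂ) :
    (E [⋀^Fin l]→L[ℝ] ℂ) →ₗ[ℂ] E [⋀^Fin (k + l)]→L[ℝ] ℂ where
  toFun β := wedge α β
  map_add' := wedge_add_right α
  map_smul' c β := wedge_smul_right c α β

theorem wedge_sum_smul {k l : ℕ} {ι : Type*} (s : Finset ι) (α : E [⋀^Fin k]→L[ℝ] ℂ)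
    (c : ι → ℂ) (β : ι → E [⋀^Fin l]→L[ℝ] ℂ) (v : Fin (k + l) → E) :
    wedge α (∑ i ∈ s, c i • β i) v = ∑ i ∈ s, c i * wedge α (β i) v := by
  have h : wedge α (∑ i ∈ s, c i • β i) = ∑ i ∈ s, c i • wedge α (β i) := by
    have := map_sum (wedgeRight (l := l) α) (fun i => c i • β i) s
    simp only [map_smul] at this
    exact this
  rw [h, ContinuousAlternatingMap.sum_apply]
  rfl

variable [FiniteDimensional ℂ E] {m : ℕ} (b : Module.Basis (Fin (m + 1)) ℂ E)

/-- The matrix of the Hermitian form on covectors that corresponds to a form of degree `2 m` on a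
complex vector space of dimension `m + 1`. -/
def posMat (α : E [⋀^Fin (2 * m)]→L[ℝ] ℂ) : Matrix (Fin (m + 1)) (Fin (m + 1)) ℂ :=
  Matrix.of fun j k => wedge α (pairForm (coordFun b j) (coordFun b k)) (complexFrame b)

theorem posMat_apply (α : E [⋀^Fin (2 * m)]→L[ℝ] ℂ) (j k : Fin (m + 1)) :
    posMat b α j k = wedge α (pairForm (coordFun b j) (coordFun b k)) (complexFrame b) := rfl

theorem posMat_add (α α' : E [⋀^Fin (2 * m)]→L[ℝ] ℂ) :
    posMat b (α + α') = posMat b α + posMat b α' := by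
  ext j k
  simp only [posMat_apply, wedge_add_left, Matrix.add_apply]
  rfl

theorem posMat_smul (c : ℂ) (α : E [⋀^Fin (2 * m)]→L[ℝ] ℂ) :
    posMat b (c • α) = c • posMat b α := by
  ext j k
  simp only [posMat_apply, wedge_smul_left, Matrix.smul_apply]
  rfl

/-- The pullback of `α ∧ β`, a form of top degree, is `|det L|²` times that form; on the other hand
the pullback of `β` mixes the coordinate functionals by `L`. Comparison gives the transformation law
of `posMat`. -/
theorem posMat_comp_matMap (α : E [⋀^Fin (2 * m)]→L[ℝ] ℂ)
    (L : Matrix (Fin (m + 1)) (Fin (m + 1)) ℂ) :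
    L.map (starRingEnd ℂ) * posMat b (α.compContinuousLinearMap (matMap b L)) * Lᵀ =
      (Complex.normSq L.det : ℂ) • posMat b α := by
  ext j k
  have h1 : wedge (α.compContinuousLinearMap (matMap b L))
      ((pairForm (coordFun b j) (coordFun b k)).compContinuousLinearMap (matMap b L))
      (complexFrame b) = (Complex.normSq L.det : ℂ) * posMat b α j k := by
    rw [← wedge_compContinuousLinearMap, ContinuousAlternatingMap.compContinuousLinearMap_apply]
    exact compContinuousLinearMap_top b
      (wedge α (pairForm (coordFun b j) (coordFun b k)) : E [⋀^Fin (2 * (m + 1))]→L[ℝ] ℂ) L _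
  rw [Matrix.smul_apply, smul_eq_mul, ← h1, pairForm_comp_matMap]
  rw [← Finset.sum_product', wedge_sum_smul (Finset.univ ×ˢ Finset.univ) _
    (fun x => starRingEnd ℂ (L j x.1) * L k x.2)
    (fun x => pairForm (coordFun b x.1) (coordFun b x.2)), Finset.sum_product_right]
  simp only [Matrix.mul_apply, Finset.sum_mul, Matrix.map_apply, Matrix.transpose_apply,
    posMat_apply]
  exact Finset.sum_congr rfl fun j _ => Finset.sum_congr rfl fun k _ => by ring

theorem hermForm_one_apply (x y : E) :
    hermForm b 1 ![x, y] = (∑ l, (starRingEnd ℂ (b.repr x l) * b.repr y l -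
      starRingEnd ℂ (b.repr y l) * b.repr x l)) / (2 * Complex.I) := by
  simp only [hermForm, ContinuousAlternatingMap.sum_apply, ContinuousAlternatingMap.smul_apply,
    smul_eq_mul, Matrix.one_apply, ite_mul, one_mul, zero_mul, Finset.sum_ite_eq, Finset.mem_univ,
    if_true, pairForm_apply, coordFun_apply, Finset.sum_div]
  rfl

/-- The constant in the formula for the powers of Hermitian forms. -/
def hermConst : ℂ := wedgePow (hermForm b 1) m (complexFrame fun i : Fin m => b i.castSucc)

theorem hermConst_pos : 0 < hermConst b := by
  have hI : (2 * Complex.I) ≠ 0 := mul_ne_zero two_ne_zero Complex.I_ne_zero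
  refine wedgePow_complexFrame_pos m _ ?_ ?_ ?_
  · intro i j
    rw [hermForm_one_apply, Finset.sum_eq_zero, zero_div]
    intro l _
    simp [Finsupp.single_apply]
    split_ifs <;> simp
  · intro i j
    rw [hermForm_one_apply, Finset.sum_eq_zero, zero_div]
    intro l _
    simp [Finsupp.single_apply]
    split_ifs <;> simp
  · intro i j
    rw [hermForm_one_apply]
    by_cases h : i = j
    · subst h
      simp [Finsupp.single_apply]
      field_simp
      norm_num
    · have h' : ¬ j = i := fun h' => h h'.symm
      simp [Finsupp.single_apply, h, h']

/-- The form attached to the last coordinate vanishes as soon as one argument lies on one of the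
first `m` lines, so a single term of the exterior product survives. -/
theorem posMat_last (α : E [⋀^Fin (2 * m)]→L[ℝ] ℂ) (w : Module.Basis (Fin (m + 1)) ℂ E) :
    wedge α (pairForm (coordFun w (Fin.last m)) (coordFun w (Fin.last m))) (complexFrame w) =
      α (complexFrame fun i : Fin m => w i.castSucc) := by
  rw [wedge_apply_of_forall_eq_zero]
  · have h1 := complexFrame_castAdd (fun i => w i)
    have h2 := complexFrame_natAdd (fun i => w i)
    refine (congrArg₂ (· * ·) (congrArg α h1) (congrArg _ h2)).trans ?_
    rw [pairForm_self_apply]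
    simp [coordFun_apply]
  · intro v i j hv
    have h0 : coordFun w (Fin.last m) (v i) = 0 := by
      have h3 := congrFun (complexFrame_castAdd (fun i => w i)) j
      rw [hv]
      refine (congrArg _ h3).trans ?_
      simp only [complexFrame]
      have h4 : ∀ i : Fin m, w.repr (w i.castSucc) (Fin.last m) = 0 := by
        intro i
        rw [w.repr_self, Finsupp.single_apply, if_neg (Fin.castSucc_lt_last i).ne]
      split_ifs
      · exact h4 _
      · rw [map_smul, coordFun_apply, h4, smul_zero]
    rw [pairForm_apply]
    fin_cases i <;> simp_all

/-- The standard form is invariant under unitary maps, hence so is its matrix. Permutations make the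
diagonal entries equal, and the diagonal unitary with one entry `i` makes the other entries vanish.
-/
theorem posMat_wedgePow_hermForm_one :
    posMat b (wedgePow (hermForm b 1) m) = hermConst b • (1 : Matrix _ _ ℂ) := by
  have hinv : ∀ L : Matrix (Fin (m + 1)) (Fin (m + 1)) ℂ, Lᴴ * L = 1 →
      L.map (starRingEnd ℂ) * posMat b (wedgePow (hermForm b 1) m) * Lᵀ =
        posMat b (wedgePow (hermForm b 1) m) := by
    intro L hL
    have h1 := posMat_comp_matMap b (wedgePow (hermForm b 1) m) L
    rw [wedgePow_compContinuousLinearMap, hermForm_comp_matMap, Matrix.mul_one, hL] at h1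
    have h2 : (Complex.normSq L.det : ℂ) = 1 := by
      have := congrArg Matrix.det hL
      rw [Matrix.det_mul, Matrix.det_conjTranspose, Matrix.det_one] at this
      rw [Complex.normSq_eq_conj_mul_self]
      exact this
    rw [h1, h2, one_smul]
  have hlast : posMat b (wedgePow (hermForm b 1) m) (Fin.last m) (Fin.last m) = hermConst b :=
    posMat_last _ b
  ext j k
  by_cases hjk : j = k
  · subst hjk
    let L : Matrix (Fin (m + 1)) (Fin (m + 1)) ℂ := (Equiv.swap j (Fin.last m)).permMatrix ℂ
    have h1 : Lᴴ * L = 1 := by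
      simp only [L, Matrix.conjTranspose_permMatrix, ← Matrix.permMatrix_mul]
      simp
    have h2 := congrFun (congrFun (hinv L h1) j) j
    rw [← h2]
    simp [L, Matrix.mul_apply, Equiv.Perm.permMatrix, PEquiv.toMatrix_apply,
      Equiv.toPEquiv_apply]
    rw [Finset.sum_eq_single (Fin.last m)]
    · simp [hlast]
    · intro x _ hx
      refine if_neg fun h => hx ?_
      rw [Equiv.swap_apply_eq_iff.mp h, Equiv.swap_apply_left]
    · simp
  · let L : Matrix (Fin (m + 1)) (Fin (m + 1)) ℂ :=
      Matrix.diagonal fun i => if i = j then Complex.I else 1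
    have h1 : Lᴴ * L = 1 := by
      simp only [L, Matrix.diagonal_conjTranspose, Matrix.diagonal_mul_diagonal]
      rw [← Matrix.diagonal_one]
      congr 1
      ext i
      by_cases hi : i = j <;> simp [hi]
    have h2 := congrFun (congrFun (hinv L h1) j) k
    have hkj : ¬ k = j := fun h => hjk h.symm
    have h3 : L.map (starRingEnd ℂ) = Matrix.diagonal fun i => if i = j then -Complex.I else 1 := by
      simp only [L]
      rw [Matrix.diagonal_map (by simp)]
      congr 1
      ext i
      by_cases hi : i = j <;> simp [hi]
    rw [h3] at h2
    simp only [L, Matrix.diagonal_transpose, Matrix.mul_diagonal, Matrix.diagonal_mul, hkj,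
      if_true, if_false, mul_one] at h2
    have h4 : (1 + Complex.I) * posMat b (wedgePow (hermForm b 1) m) j k = 0 := by
      linear_combination -h2
    have h5 : (1 + Complex.I) ≠ 0 := by
      intro h
      have := congrArg Complex.re h
      simp at this
    rw [(mul_eq_zero.mp h4).resolve_left h5]
    simp [hjk]

open scoped MatrixOrder Matrix.Norms.L2Operator in
theorem exists_eq_conjTranspose_mul_self {n : ℕ} {H : Matrix (Fin n) (Fin n) ℂ} (hH : H.PosDef) :
    ∃ L : Matrix (Fin n) (Fin n) ℂ, H = Lᴴ * L :=
  CStarAlgebra.nonneg_iff_eq_star_mul_self.mp (Matrix.nonneg_iff_posSemidef.mpr hH.posSemidef)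

/-- The matrix of the top-but-one power of a Hermitian form. -/
theorem posMat_wedgePow_hermForm {H : Matrix (Fin (m + 1)) (Fin (m + 1)) ℂ} (hH : H.PosDef) :
    posMat b (wedgePow (hermForm b H) m) = (hermConst b * H.det) • Hᵀ⁻¹ := by
  -- The form with matrix `Lᴴ * L` is the pullback of the standard one under `L`, so the
  -- transformation law reduces the claim to the identity matrix.
  obtain ⟨L, rfl⟩ := exists_eq_conjTranspose_mul_self hH
  have h1 := posMat_comp_matMap b (wedgePow (hermForm b 1) m) L
  rw [wedgePow_compContinuousLinearMap, hermForm_comp_matMap, Matrix.mul_one,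
    posMat_wedgePow_hermForm_one, smul_smul] at h1
  have hdet : (Lᴴ * L).det = (Complex.normSq L.det : ℂ) := by
    rw [Matrix.det_mul, Matrix.det_conjTranspose, Complex.normSq_eq_conj_mul_self]
    rfl
  have hL : IsUnit L.det := by
    rw [isUnit_iff_ne_zero]
    intro h
    have := hH.det_pos
    rw [hdet, h] at this
    simp at this
  have hLc : IsUnit (L.map (starRingEnd ℂ)).det := by
    have : (L.map (starRingEnd ℂ)).det = starRingEnd ℂ L.det := ((starRingEnd ℂ).map_det L).symm
    rw [this]
    exact hL.map _
  have hLt : IsUnit Lᵀ.det := by rwa [Matrix.det_transpose]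
  have hT : (Lᴴ * L)ᵀ = Lᵀ * L.map (starRingEnd ℂ) := by
    rw [Matrix.transpose_mul]
    rfl
  rw [hT, Matrix.mul_inv_rev, hdet]
  have h2 : posMat b (wedgePow (hermForm b (Lᴴ * L)) m) = (L.map (starRingEnd ℂ))⁻¹ *
      (L.map (starRingEnd ℂ) * posMat b (wedgePow (hermForm b (Lᴴ * L)) m) * Lᵀ) * Lᵀ⁻¹ := by
    rw [Matrix.mul_assoc, Matrix.mul_assoc _ Lᵀ, Matrix.mul_nonsing_inv _ hLt, Matrix.mul_one,
      ← Matrix.mul_assoc, Matrix.nonsing_inv_mul _ hLc, Matrix.one_mul]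
  rw [h2, h1, Matrix.mul_smul, Matrix.mul_one, Matrix.smul_mul, mul_comm (hermConst b)]

theorem pairForm_eq_sum (ξ : E →L[ℂ] ℂ) :
    pairForm ξ ξ = ∑ x : Fin (m + 1) × Fin (m + 1),
      (starRingEnd ℂ (ξ (b x.1)) * ξ (b x.2)) • pairForm (coordFun b x.1) (coordFun b x.2) := by
  ext v
  have h1 : ∀ x : E, ξ x = ∑ l, b.repr x l * ξ (b l) := by
    intro x
    conv_lhs => rw [← b.sum_repr x]
    rw [map_sum]
    simp only [map_smul, smul_eq_mul]
  simp only [pairForm_apply, ContinuousAlternatingMap.sum_apply,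
    ContinuousAlternatingMap.smul_apply, smul_eq_mul, coordFun_apply]
  rw [Fintype.sum_prod_type]
  conv_lhs => rw [h1 (v 0), h1 (v 1)]
  simp only [map_sum, map_mul, Finset.sum_mul_sum, ← Finset.sum_sub_distrib, Finset.sum_div]
  exact Finset.sum_congr rfl fun j _ => Finset.sum_congr rfl fun k _ => by ring

/-- The values of a form on complex frames are values of the associated Hermitian form. -/
theorem apply_complexFrame_basis (w : Module.Basis (Fin (m + 1)) ℂ E) :
    ∃ d : ℝ, 0 < d ∧ ∀ α : E [⋀^Fin (2 * m)]→L[ℝ] ℂ,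
      α (complexFrame fun i : Fin m => w i.castSucc) =
        d * (star (fun k => w.repr (b k) (Fin.last m)) ⬝ᵥ
          (posMat b α *ᵥ fun k => w.repr (b k) (Fin.last m))) := by
  set L : Matrix (Fin (m + 1)) (Fin (m + 1)) ℂ := b.toMatrix w with hL
  have hLb : ∀ i, matMap b L (b i) = w i := by
    intro i
    have : matMap b L (b i) = Matrix.toLin b b L (b i) := rfl
    rw [this, Matrix.toLin_self, hL, b.sum_toMatrix_smul_self]
  have hdet : L.det ≠ 0 := by
    have h := congrArg Matrix.det (b.toMatrix_mul_toMatrix_flip w)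
    rw [Matrix.det_mul, Matrix.det_one] at h
    exact left_ne_zero_of_mul_eq_one h
  -- `L` carries `b` to `w`, so `|det L|²` is the ratio of the values of a top form on their complex
  -- frames. It does not depend on `α`.
  refine ⟨Complex.normSq L.det, Complex.normSq_pos.mpr hdet, fun α => ?_⟩
  set ξ := coordFun w (Fin.last m) with hξ
  have h1 := compContinuousLinearMap_top b
    (wedge α (pairForm ξ ξ) : E [⋀^Fin (2 * (m + 1))]→L[ℝ] ℂ) L (complexFrame b)
  rw [comp_complexFrame] at h1
  simp only [hLb] at h1
  rw [← posMat_last α w, ← hξ]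
  refine h1.trans ?_
  congr 1
  have h2 := wedge_sum_smul Finset.univ α
    (fun x : Fin (m + 1) × Fin (m + 1) => starRingEnd ℂ (ξ (b x.1)) * ξ (b x.2))
    (fun x => pairForm (coordFun b x.1) (coordFun b x.2)) (complexFrame b)
  rw [← pairForm_eq_sum b ξ] at h2
  refine h2.trans ?_
  rw [Fintype.sum_prod_type]
  simp only [dotProduct, mulVec, Finset.mul_sum, posMat_apply, Pi.star_apply, RCLike.star_def]
  refine Finset.sum_congr rfl fun j _ => Finset.sum_congr rfl fun k _ => ?_
  have h3 : ∀ k, ξ (b k) = w.repr (b k) (Fin.last m) := fun k => rfl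
  rw [h3, h3]
  ring

/-- Complete `v` to a basis; the covector is the last coordinate functional, whose kernel is the
plane spanned by `v`. Covector and factor serve all `α` at once. -/
theorem exists_covector_of_linearIndependent {v : Fin m → E} (hv : LinearIndependent ℂ v) :
    ∃ c : Fin (m + 1) → ℂ, c ≠ 0 ∧ ∃ d : ℝ, 0 < d ∧ ∀ α : E [⋀^Fin (2 * m)]→L[ℝ] ℂ,
      α (complexFrame v) = d * (star c ⬝ᵥ (posMat b α *ᵥ c)) := by
  have hdim : Module.finrank ℂ E = m + 1 := by
    rw [Module.finrank_eq_card_basis b, Fintype.card_fin]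
  obtain ⟨u, hu⟩ : ∃ u, u ∉ Submodule.span ℂ (Set.range v) := by
    by_contra h
    push Not at h
    have h1 : Submodule.span ℂ (Set.range v) = ⊤ := eq_top_iff.mpr fun x _ => h x
    have h2 := finrank_range_le_card (R := ℂ) v
    rw [Set.finrank, h1, finrank_top, hdim, Fintype.card_fin] at h2
    omega
  have hli : LinearIndependent ℂ (Fin.snoc v u : Fin (m + 1) → E) :=
    linearIndependent_finSnoc.mpr ⟨hv, hu⟩
  let w : Module.Basis (Fin (m + 1)) ℂ E :=
    basisOfLinearIndependentOfCardEqFinrank hli (by rw [Fintype.card_fin, hdim])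
  have hw : ∀ i, w i = (Fin.snoc v u : Fin (m + 1) → E) i := fun i => by
    rw [coe_basisOfLinearIndependentOfCardEqFinrank]
  obtain ⟨d, hd, h⟩ := apply_complexFrame_basis b w
  refine ⟨fun k => w.repr (b k) (Fin.last m), ?_, d, hd, fun α => ?_⟩
  · intro h0
    have h1 : w.coord (Fin.last m) = 0 := b.ext fun k => congrFun h0 k
    have h2 : w.coord (Fin.last m) (w (Fin.last m)) = 1 := by simp
    rw [h1] at h2
    simp at h2
  · rw [← h α]
    congr 2
    ext i
    simp [hw]

/-- In the other direction, the frame is a basis of the kernel of the covector. Together the two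
lemmas identify complex `m`-planes with nonzero covectors up to scaling. -/
theorem exists_frame_of_ne_zero {c : Fin (m + 1) → ℂ} (hc : c ≠ 0) :
    ∃ v : Fin m → E, ∃ d : ℝ, 0 < d ∧ ∀ α : E [⋀^Fin (2 * m)]→L[ℝ] ℂ,
      star c ⬝ᵥ (posMat b α *ᵥ c) = d * α (complexFrame v) := by
  have hdim : Module.finrank ℂ E = m + 1 := by
    rw [Module.finrank_eq_card_basis b, Fintype.card_fin]
  let ξ : E →ₗ[ℂ] ℂ := b.constr ℂ c
  have hξ : ∀ k, ξ (b k) = c k := fun k => b.constr_basis ℂ c k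
  have hξ0 : ξ ≠ 0 := by
    intro h
    apply hc
    ext k
    rw [← hξ, h]
    rfl
  have hker : Module.finrank ℂ (LinearMap.ker ξ) = m := by
    have := Module.Dual.finrank_ker_add_one_of_ne_zero (f := ξ) hξ0
    omega
  let κ := Module.finBasisOfFinrankEq ℂ (LinearMap.ker ξ) hker
  obtain ⟨u, hu⟩ : ∃ u, ξ u = 1 := by
    obtain ⟨u, hu⟩ := LinearMap.surjective hξ0 1
    exact ⟨u, hu⟩
  let v : Fin m → E := fun i => κ i
  have hv : LinearIndependent ℂ v := κ.linearIndependent.map' (LinearMap.ker ξ).subtype (by simp)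
  have hspan : u ∉ Submodule.span ℂ (Set.range v) := by
    intro h
    have h1 : Submodule.span ℂ (Set.range v) ≤ LinearMap.ker ξ := by
      rw [Submodule.span_le]
      rintro _ ⟨i, rfl⟩
      exact (κ i).2
    have := h1 h
    rw [LinearMap.mem_ker, hu] at this
    exact one_ne_zero this
  have hli : LinearIndependent ℂ (Fin.snoc v u : Fin (m + 1) → E) :=
    linearIndependent_finSnoc.mpr ⟨hv, hspan⟩
  let w : Module.Basis (Fin (m + 1)) ℂ E :=
    basisOfLinearIndependentOfCardEqFinrank hli (by rw [Fintype.card_fin, hdim])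
  have hw : ∀ i, w i = (Fin.snoc v u : Fin (m + 1) → E) i := fun i => by
    rw [coe_basisOfLinearIndependentOfCardEqFinrank]
  have hcoord : w.coord (Fin.last m) = ξ := by
    refine w.ext fun i => ?_
    refine Fin.lastCases ?_ (fun i => ?_) i
    · rw [hw (Fin.last m), Fin.snoc_last, hu, ← Fin.snoc_last (α := fun _ => E) u v, ← hw]
      simp
    · have h1 : ξ (w i.castSucc) = 0 := by
        rw [hw, Fin.snoc_castSucc]
        exact (κ i).2
      rw [h1, Module.Basis.coord_apply, w.repr_self, Finsupp.single_apply,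
        if_neg (Fin.castSucc_lt_last i).ne]
  obtain ⟨d, hd, h⟩ := apply_complexFrame_basis b w
  have hcw : (fun k => w.repr (b k) (Fin.last m)) = c := by
    ext k
    rw [← hξ k, ← hcoord]
    rfl
  refine ⟨v, d⁻¹, inv_pos.mpr hd, fun α => ?_⟩
  have h1 := h α
  rw [hcw] at h1
  have h2 : (fun i : Fin m => w i.castSucc) = v := by
    ext i
    simp [hw]
  rw [h2] at h1
  rw [h1, ← mul_assoc]
  have : (d : ℂ) ≠ 0 := by exact_mod_cast hd.ne'
  push_cast
  rw [inv_mul_cancel₀ this, one_mul]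

/-- The real and imaginary parts of the coefficients of a complex relation give a real relation
among the vectors of the frame. -/
theorem apply_complexFrame_of_not_linearIndependent {v : Fin m → E}
    (hv : ¬ LinearIndependent ℂ v) (α : E [⋀^Fin (2 * m)]→L[ℝ] ℂ) : α (complexFrame v) = 0 := by
  refine α.toAlternatingMap.map_linearDependent _ fun h => hv ?_
  rw [Fintype.linearIndependent_iff] at h ⊢
  intro g hg i
  have h1 := h (fun j => if (j : ℕ) % 2 = 0 then (g ⟨j / 2, by omega⟩).re else
    (g ⟨j / 2, by omega⟩).im) ?_
  · apply Complex.ext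
    · have := h1 ⟨2 * i, by omega⟩
      simpa using this
    · have h2 := h1 ⟨2 * i + 1, by omega⟩
      have h3 : (2 * (i : ℕ) + 1) / 2 = i := by omega
      simpa [h3] using h2
  · rw [← hg, ← (finProdFinEquiv.trans (finCongr (mul_comm m 2))).sum_comp, Fintype.sum_prod_type]
    refine Finset.sum_congr rfl fun i _ => ?_
    have h3 : ((i : ℕ) * 2 + 1) % 2 ≠ 0 := by omega
    have h4 : g i • v i = ((g i).re : ℂ) • v i + ((g i).im * Complex.I : ℂ) • v i := by
      rw [← add_smul, Complex.re_add_im]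
    rw [h4, Fin.sum_univ_two]
    have e0 : ((finProdFinEquiv.trans (finCongr (mul_comm m 2))) (i, 0) : ℕ) = 2 * i := by
      simp
    have e1 : ((finProdFinEquiv.trans (finCongr (mul_comm m 2))) (i, 1) : ℕ) = 2 * i + 1 := by
      simp; omega
    have h5 : (2 * (i : ℕ) + 1) / 2 = i := by omega
    simp only [complexFrame, e0, e1, mul_smul]
    simp [h5]

theorem posMat_eq_of_dotProduct {n : ℕ} {A B : Matrix (Fin n) (Fin n) ℂ}
    (h : ∀ c, star c ⬝ᵥ (A *ᵥ c) = star c ⬝ᵥ (B *ᵥ c)) : A = B := by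
  have key : ∀ D : Matrix (Fin n) (Fin n) ℂ, (∀ c, star c ⬝ᵥ (D *ᵥ c) = 0) → D = 0 := by
    intro D hD
    have h1 : ∀ c c', star c ⬝ᵥ (D *ᵥ c') = 0 := by
      intro c c'
      have e1 := hD (c + c')
      have e2 := hD (c + Complex.I • c')
      simp only [star_add, star_smul, Matrix.mulVec_add, Matrix.mulVec_smul, add_dotProduct,
        dotProduct_add, smul_dotProduct, dotProduct_smul, hD, smul_eq_mul, RCLike.star_def,
        Complex.conj_I] at e1 e2
      have e3 : Complex.I * (star c ⬝ᵥ (D *ᵥ c') - star c' ⬝ᵥ (D *ᵥ c)) = 0 := by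
        linear_combination e2
      have e4 := (mul_eq_zero.mp e3).resolve_left Complex.I_ne_zero
      linear_combination (e1 + e4) / 2
    ext i j
    have := h1 (Pi.single i 1) (Pi.single j 1)
    simpa using this
  rw [← sub_eq_zero]
  refine key _ fun c => ?_
  rw [Matrix.sub_mulVec, dotProduct_sub, h c, sub_self]

theorem posDef_of_dotProduct_pos {n : ℕ} {A : Matrix (Fin n) (Fin n) ℂ}
    (h : ∀ c, c ≠ 0 → 0 < star c ⬝ᵥ (A *ᵥ c)) : A.PosDef := by
  rw [Matrix.posDef_iff_dotProduct_mulVec]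
  refine ⟨posMat_eq_of_dotProduct fun c => ?_, fun c hc => h c hc⟩
  by_cases hc : c = 0
  · simp [hc]
  · have h1 : star c ⬝ᵥ (Aᴴ *ᵥ c) = star (star c ⬝ᵥ (A *ᵥ c)) := by
      rw [Matrix.star_dotProduct, Matrix.star_mulVec, Matrix.conjTranspose_conjTranspose,
        ← Matrix.dotProduct_mulVec]
    rw [h1]
    exact (h c hc).le.isSelfAdjoint

theorem eq_of_posMat_eq {α α' : E [⋀^Fin (2 * m)]→L[ℝ] ℂ} (hα : IsType m m α)
    (hα' : IsType m m α') (h : posMat b α = posMat b α') : α = α' := by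
  rw [← sub_eq_zero]
  have h3 : IsType m m (α - α') := by
    rw [sub_eq_add_neg, ← neg_one_smul ℂ α']
    exact hα.add (hα'.smul _)
  refine h3.eq_zero_of_complexFrame fun v => ?_
  rw [ContinuousAlternatingMap.sub_apply, sub_eq_zero]
  by_cases hv : LinearIndependent ℂ v
  · obtain ⟨c, -, d, -, hd⟩ := exists_covector_of_linearIndependent b hv
    rw [hd, hd, h]
  · rw [apply_complexFrame_of_not_linearIndependent hv,
      apply_complexFrame_of_not_linearIndependent hv]

end PositivityMatrix

/-! ### The `m`-th root of a positive form of type `(m, m)`. -/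

section Root

open Matrix
open scoped ComplexOrder

variable {E : Type*} [NormedAddCommGroup E] [NormedSpace ℂ E]

theorem update_pair_zero (x y z : E) : Function.update ![x, y] 0 z = ![z, y] := by
  ext i; fin_cases i <;> rfl

theorem update_pair_one (x y z : E) : Function.update ![x, y] 1 z = ![x, z] := by
  ext i; fin_cases i <;> rfl

theorem apply_pair_add_left (γ : E [⋀^Fin 2]→L[ℝ] ℂ) (x x' y : E) :
    γ ![x + x', y] = γ ![x, y] + γ ![x', y] := by
  have := γ.map_update_add ![x, y] 0 x x'
  rwa [update_pair_zero, update_pair_zero, update_pair_zero] at this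

theorem apply_pair_add_right (γ : E [⋀^Fin 2]→L[ℝ] ℂ) (x y y' : E) :
    γ ![x, y + y'] = γ ![x, y] + γ ![x, y'] := by
  have := γ.map_update_add ![x, y] 1 y y'
  rwa [update_pair_one, update_pair_one, update_pair_one] at this

theorem apply_pair_smul_left (γ : E [⋀^Fin 2]→L[ℝ] ℂ) (c : ℝ) (x y : E) :
    γ ![c • x, y] = c * γ ![x, y] := by
  have := γ.map_update_smul ![x, y] 0 c x
  rwa [update_pair_zero, update_pair_zero, Complex.real_smul] at this

theorem apply_pair_smul_right (γ : E [⋀^Fin 2]→L[ℝ] ℂ) (c : ℝ) (x y : E) :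
    γ ![x, c • y] = c * γ ![x, y] := by
  have := γ.map_update_smul ![x, y] 1 c y
  rwa [update_pair_one, update_pair_one, Complex.real_smul] at this

/-- The sesquilinear form of a `(1, 1)`-form. -/
def sesq (γ : E [⋀^Fin 2]→L[ℝ] ℂ) (x y : E) : ℂ :=
  γ ![x, Complex.I • y] + Complex.I * γ ![x, y]

theorem IsType.apply_I {γ : E [⋀^Fin 2]→L[ℝ] ℂ} (hγ : IsType 1 1 γ) (x y : E) :
    γ ![Complex.I • x, Complex.I • y] = γ ![x, y] := by
  have := hγ Complex.I ![x, y]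
  have h : (fun i => Complex.I • ![x, y] i) = ![Complex.I • x, Complex.I • y] := by
    ext i; fin_cases i <;> rfl
  rw [h] at this
  simpa using this

theorem neg_pair_right (γ : E [⋀^Fin 2]→L[ℝ] ℂ) (x y : E) : γ ![x, -y] = -γ ![x, y] := by
  have := apply_pair_smul_right γ (-1) x y
  simpa using this

theorem smul_decomp (c : ℂ) (x : E) : c • x = c.re • x + c.im • (Complex.I • x) := by
  conv_lhs => rw [← Complex.re_add_im c, add_smul, mul_smul]
  simp

theorem sesq_smul_right (γ : E [⋀^Fin 2]→L[ℝ] ℂ) (c : ℂ) (x y : E) :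
    sesq γ x (c • y) = c * sesq γ x y := by
  have hI : Complex.I • Complex.I • y = -y := by rw [smul_smul]; simp
  have hc : ∀ z : E, Complex.I • c.re • z = c.re • Complex.I • z := fun z => smul_comm _ _ _
  have hc' : ∀ z : E, Complex.I • c.im • z = c.im • Complex.I • z := fun z => smul_comm _ _ _
  rw [smul_decomp c y]
  simp only [sesq, smul_add, hc, hc', hI, apply_pair_add_right, apply_pair_smul_right,
    neg_pair_right]
  conv_rhs => rw [← Complex.re_add_im c]
  linear_combination (-(c.im : ℂ) * γ ![x, y]) * Complex.I_sq

theorem sesq_smul_left {γ : E [⋀^Fin 2]→L[ℝ] ℂ} (hγ : IsType 1 1 γ) (c : ℂ) (x y : E) :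
    sesq γ (c • x) y = starRingEnd ℂ c * sesq γ x y := by
  have h1 : γ ![Complex.I • x, y] = -γ ![x, Complex.I • y] := by
    have := hγ.apply_I x (Complex.I • y)
    rw [smul_smul, Complex.I_mul_I, neg_one_smul, neg_pair_right] at this
    rw [← this, neg_neg]
  rw [smul_decomp c x]
  simp only [sesq, apply_pair_add_left, apply_pair_smul_left, hγ.apply_I, h1]
  have h2 : starRingEnd ℂ c = c.re - c.im * Complex.I := by
    apply Complex.ext <;> simp
  rw [h2]
  linear_combination ((c.im : ℂ) * γ ![x, y]) * Complex.I_sq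

theorem sesq_sum_left {γ : E [⋀^Fin 2]→L[ℝ] ℂ} {ι : Type*} (s : Finset ι) (f : ι → E) (y : E) :
    sesq γ (∑ i ∈ s, f i) y = ∑ i ∈ s, sesq γ (f i) y := by
  let g : E →+ ℂ := AddMonoidHom.mk' (fun x => sesq γ x y) fun x x' => by
    simp only [sesq, apply_pair_add_left]; ring
  exact map_sum g f s

theorem sesq_sum_right {γ : E [⋀^Fin 2]→L[ℝ] ℂ} {ι : Type*} (s : Finset ι) (x : E) (f : ι → E) :
    sesq γ x (∑ i ∈ s, f i) = ∑ i ∈ s, sesq γ x (f i) := by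
  let g : E →+ ℂ := AddMonoidHom.mk' (fun y => sesq γ x y) fun y y' => by
    simp only [sesq, apply_pair_add_right, smul_add]; ring
  exact map_sum g f s

variable [FiniteDimensional ℂ E]

theorem IsPosDef.exists_hermForm {n : ℕ} (b : Module.Basis (Fin n) ℂ E)
    {γ : E [⋀^Fin 2]→L[ℝ] ℂ} (hγ : IsPosDef γ) :
    ∃ H : Matrix (Fin n) (Fin n) ℂ, H.PosDef ∧ γ = hermForm b H := by
  let H : Matrix (Fin n) (Fin n) ℂ := Matrix.of fun j k => sesq γ (b j) (b k)
  have hH : ∀ v : E, γ ![v, Complex.I • v] =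
      star (b.repr v : Fin n → ℂ) ⬝ᵥ (H *ᵥ (b.repr v)) := by
    intro v
    have h1 : γ ![v, Complex.I • v] = sesq γ v v := by
      have : γ ![v, v] = 0 := γ.map_eq_zero_of_eq _ (i := 0) (j := 1) (by simp) (by simp)
      simp [sesq, this]
    have h2 : sesq γ v v = sesq γ (∑ j, b.repr v j • b j) (∑ k, b.repr v k • b k) := by
      rw [b.sum_repr]
    rw [h1, h2, sesq_sum_left]
    simp only [sesq_sum_right, sesq_smul_left hγ.1, sesq_smul_right γ, dotProduct, mulVec,
      Finset.mul_sum, Pi.star_apply, RCLike.star_def, H, Matrix.of_apply]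
    exact Finset.sum_congr rfl fun j _ => Finset.sum_congr rfl fun k _ => by ring
  refine ⟨H, posDef_of_dotProduct_pos fun c hc => ?_, ?_⟩
  · let v : E := ∑ j, c j • b j
    have hv : (b.repr v : Fin n → ℂ) = c := by
      ext k
      simp [v, Finsupp.single_apply]
    have hv0 : v ≠ 0 := by
      intro h
      apply hc
      rw [← hv, h]
      simp
    have := hγ.2 v hv0
    rwa [hH, hv] at this
  · rw [← sub_eq_zero]
    have h3 : IsType 1 1 (γ - hermForm b H) := by
      rw [sub_eq_add_neg, ← neg_one_smul ℂ (hermForm b H)]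
      exact hγ.1.add ((isType_hermForm b _).smul _)
    refine IsType.eq_zero_of_complexFrame (m := 1) h3 fun v => ?_
    have h4 : complexFrame v = ![v 0, Complex.I • v 0] := by
      ext i; fin_cases i <;> rfl
    rw [h4, ContinuousAlternatingMap.sub_apply, sub_eq_zero, hermForm_self_apply, hH]

theorem isPosDef_hermForm {n : ℕ} (b : Module.Basis (Fin n) ℂ E) {H : Matrix (Fin n) (Fin n) ℂ}
    (hH : H.PosDef) : IsPosDef (hermForm b H) := by
  refine ⟨isType_hermForm b H, fun v hv => ?_⟩
  rw [hermForm_self_apply]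
  refine hH.dotProduct_mulVec_pos ?_
  intro h
  apply hv
  rw [← b.sum_repr v]
  exact Finset.sum_eq_zero fun i _ => by rw [congrFun h i]; simp

variable {m : ℕ} (b : Module.Basis (Fin (m + 1)) ℂ E)

theorem IsPosDef.posDef_posMat {γ : E [⋀^Fin 2]→L[ℝ] ℂ} (hγ : IsPosDef γ) :
    (posMat b (wedgePow γ m)).PosDef := by
  obtain ⟨H, hH, rfl⟩ := hγ.exists_hermForm b
  rw [posMat_wedgePow_hermForm b hH]
  exact hH.transpose.inv.smul (mul_pos (hermConst_pos b) hH.det_pos)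

/-- The positive `(1, 1)`-form whose power of order `m` is a given form. -/
def hermRoot (Ω : E [⋀^Fin (2 * m)]→L[ℝ] ℂ) : E [⋀^Fin 2]→L[ℝ] ℂ :=
  hermForm b (((((posMat b Ω).det.re / (hermConst b).re) ^ (m : ℝ)⁻¹ : ℝ) : ℂ) • (posMat b Ω)ᵀ⁻¹)

theorem ofReal_hermConst_re : (((hermConst b).re : ℝ) : ℂ) = hermConst b := by
  have := (Complex.pos_iff.mp (hermConst_pos b)).2
  apply Complex.ext <;> simp [this]

theorem hermConst_re_pos : 0 < (hermConst b).re := (Complex.pos_iff.mp (hermConst_pos b)).1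

theorem ofReal_det_re {n : ℕ} {B : Matrix (Fin n) (Fin n) ℂ} (hB : B.PosDef) :
    ((B.det.re : ℝ) : ℂ) = B.det := by
  have := (Complex.pos_iff.mp hB.det_pos).2
  apply Complex.ext <;> simp [this]

theorem det_re_pos {n : ℕ} {B : Matrix (Fin n) (Fin n) ℂ} (hB : B.PosDef) : 0 < B.det.re :=
  (Complex.pos_iff.mp hB.det_pos).1

theorem isPosDef_hermRoot {Ω : E [⋀^Fin (2 * m)]→L[ℝ] ℂ} (hΩ : (posMat b Ω).PosDef) :
    IsPosDef (hermRoot b Ω) := by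
  refine isPosDef_hermForm b (hΩ.transpose.inv.smul ?_)
  have : 0 < ((posMat b Ω).det.re / (hermConst b).re) ^ (m : ℝ)⁻¹ :=
    Real.rpow_pos_of_pos (div_pos (det_re_pos hΩ) (hermConst_re_pos b)) _
  exact_mod_cast this

/-- Write `B = posMat b Ω` and `κ = hermConst b`. For `H = t • Bᵀ⁻¹` the power has matrix `κ (t^m /
det B) B`, so that `t^m = det B / κ` is forced; this is the factor in `hermRoot`, and it needs `m ≠
0`. -/
theorem wedgePow_hermRoot (hm : m ≠ 0) {Ω : E [⋀^Fin (2 * m)]→L[ℝ] ℂ} (hT : IsType m m Ω)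
    (hΩ : (posMat b Ω).PosDef) : wedgePow (hermRoot b Ω) m = Ω := by
  refine eq_of_posMat_eq b ((isPosDef_hermRoot b hΩ).1.wedgePow m) hT ?_
  set B := posMat b Ω with hB
  have hpos : 0 < B.det.re / (hermConst b).re := div_pos (det_re_pos hΩ) (hermConst_re_pos b)
  set t : ℝ := (B.det.re / (hermConst b).re) ^ (m : ℝ)⁻¹ with ht
  have ht0 : 0 < t := Real.rpow_pos_of_pos hpos _
  have htm : t ^ m = B.det.re / (hermConst b).re := Real.rpow_inv_natCast_pow hpos.le hm
  have htc : (t : ℂ) ≠ 0 := by exact_mod_cast ht0.ne'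
  have hPD : ((t : ℂ) • Bᵀ⁻¹).PosDef := hΩ.transpose.inv.smul (by exact_mod_cast ht0)
  have h1 := posMat_wedgePow_hermForm b hPD
  have h2 : hermRoot b Ω = hermForm b ((t : ℂ) • Bᵀ⁻¹) := rfl
  rw [h2, h1]
  have hBu : IsUnit B.det := hΩ.det_pos.ne'.isUnit
  have hκ : hermConst b ≠ 0 := (hermConst_pos b).ne'
  have h3 : ((t : ℂ) • Bᵀ⁻¹)ᵀ⁻¹ = (t : ℂ)⁻¹ • B := by
    rw [Matrix.transpose_smul, Matrix.transpose_nonsing_inv, Matrix.transpose_transpose]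
    refine Matrix.inv_eq_right_inv ?_
    rw [Matrix.smul_mul, Matrix.mul_smul, smul_smul, Matrix.nonsing_inv_mul _ hBu,
      mul_inv_cancel₀ htc, one_smul]
  have h4 : ((t : ℂ) • Bᵀ⁻¹).det = (t : ℂ) ^ (m + 1) * (B.det)⁻¹ := by
    rw [Matrix.det_smul, Fintype.card_fin, Matrix.det_nonsing_inv, Matrix.det_transpose,
      Ring.inverse_eq_inv]
  have h5 : (t : ℂ) ^ m = B.det / hermConst b := by
    rw [← ofReal_det_re hΩ, ← ofReal_hermConst_re b]
    exact_mod_cast htm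
  rw [h3, h4, smul_smul]
  have h6 : hermConst b * ((t : ℂ) ^ (m + 1) * B.det⁻¹) * (t : ℂ)⁻¹ = 1 := by
    have hB0 : B.det ≠ 0 := hBu.ne_zero
    rw [pow_succ, h5]
    field_simp
  rw [h6, one_smul]

/-- Uniqueness of the root. It makes the root independent of the basis and compatible with pullback,
hence computable in any chart. -/
theorem hermRoot_wedgePow (hm : m ≠ 0) {γ : E [⋀^Fin 2]→L[ℝ] ℂ} (hγ : IsPosDef γ) :
    hermRoot b (wedgePow γ m) = γ := by
  obtain ⟨H, hH, rfl⟩ := hγ.exists_hermForm b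
  have hκ := hermConst_pos b
  have hd := hH.det_pos
  have h1 := posMat_wedgePow_hermForm b hH
  have hHu : IsUnit Hᵀ.det := by rw [Matrix.det_transpose]; exact hd.ne'.isUnit
  set s : ℝ := (hermConst b).re * H.det.re with hs
  have hs0 : 0 < s := mul_pos (hermConst_re_pos b) (det_re_pos hH)
  have hsc : hermConst b * H.det = (s : ℂ) := by
    rw [hs, Complex.ofReal_mul, ofReal_hermConst_re, ofReal_det_re hH]
  have hsne : (s : ℂ) ≠ 0 := by exact_mod_cast hs0.ne'
  rw [hermRoot, h1, hsc]
  congr 1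
  have h2 : ((s : ℂ) • Hᵀ⁻¹)ᵀ⁻¹ = (s : ℂ)⁻¹ • H := by
    rw [Matrix.transpose_smul, Matrix.transpose_nonsing_inv, Matrix.transpose_transpose]
    refine Matrix.inv_eq_right_inv ?_
    rw [Matrix.smul_mul, Matrix.mul_smul, smul_smul, Matrix.nonsing_inv_mul _ hd.ne'.isUnit,
      mul_inv_cancel₀ hsne, one_smul]
  have h3 : ((s : ℂ) • Hᵀ⁻¹).det = ((s ^ (m + 1) * (H.det.re)⁻¹ : ℝ) : ℂ) := by
    rw [Matrix.det_smul, Fintype.card_fin, Matrix.det_nonsing_inv, Matrix.det_transpose,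
      Ring.inverse_eq_inv]
    push_cast
    rw [ofReal_det_re hH]
  rw [h2, h3, Complex.ofReal_re]
  have h4 : s ^ (m + 1) * (H.det.re)⁻¹ / (hermConst b).re = s ^ m := by
    have h5 := (hermConst_re_pos b).ne'
    have h6 := (det_re_pos hH).ne'
    rw [pow_succ, hs]
    field_simp
  rw [h4, Real.pow_rpow_inv_natCast hs0.le hm, smul_smul, mul_inv_cancel₀ hsne, one_smul]

theorem contDiffAt_det {F : Type*} [NormedAddCommGroup F] [NormedSpace ℝ F] {n : ℕ}
    {A : F → Matrix (Fin n) (Fin n) ℂ} {x : F} (hA : ∀ j k, ContDiffAt ℝ ∞ (fun y => A y j k) x) :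
    ContDiffAt ℝ ∞ (fun y => (A y).det) x := by
  simp only [Matrix.det_apply]
  refine ContDiffAt.sum fun σ _ => ?_
  refine ContDiffAt.const_smul _ ?_
  exact contDiffAt_prod fun i _ => hA _ _

theorem contDiffAt_inv {F : Type*} [NormedAddCommGroup F] [NormedSpace ℝ F] {n : ℕ}
    {A : F → Matrix (Fin n) (Fin n) ℂ} {x : F} (hA : ∀ j k, ContDiffAt ℝ ∞ (fun y => A y j k) x)
    (hx : (A x).det ≠ 0) (j k : Fin n) : ContDiffAt ℝ ∞ (fun y => (A y)⁻¹ j k) x := by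
  simp only [Matrix.inv_def, Ring.inverse_eq_inv, Matrix.smul_apply, smul_eq_mul,
    Matrix.adjugate_apply]
  refine ((contDiffAt_det hA).inv hx).mul (contDiffAt_det fun i l => ?_)
  by_cases h : i = k
  · subst h
    simp only [Matrix.updateRow_self]
    exact contDiffAt_const
  · simp only [Matrix.updateRow_ne h]
    exact hA _ _

/-- An entry of the matrix of a form as a real linear map. -/
def posMatEntry (j k : Fin (m + 1)) : (E [⋀^Fin (2 * m)]→L[ℝ] ℂ) →ₗ[ℝ] ℂ where
  toFun α := posMat b α j k
  map_add' α α' := by rw [posMat_add]; rfl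
  map_smul' c α := by
    have h : c • α = (c : ℂ) • α := by
      ext v
      simp
    rw [h, posMat_smul]
    simp

instance finiteDimensional_alternating (k : ℕ) : FiniteDimensional ℝ (E [⋀^Fin k]→L[ℝ] ℂ) := by
  let f : (E [⋀^Fin k]→L[ℝ] ℂ) →ₗ[ℝ] MultilinearMap ℝ (fun _ : Fin k => E) ℂ :=
    { toFun := fun α => α.toMultilinearMap
      map_add' := fun _ _ => rfl
      map_smul' := fun _ _ => rfl }
  refine Module.Finite.of_injective f fun α β h => ?_
  ext v
  exact congrArg (fun g : MultilinearMap ℝ (fun _ : Fin k => E) ℂ => g v) h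

theorem contDiff_posMat (j k : Fin (m + 1)) :
    ContDiff ℝ ∞ (fun α : E [⋀^Fin (2 * m)]→L[ℝ] ℂ => posMat b α j k) :=
  (LinearMap.toContinuousLinearMap (posMatEntry b j k)).contDiff

theorem contDiffAt_hermRoot {Ω : E [⋀^Fin (2 * m)]→L[ℝ] ℂ} (hΩ : (posMat b Ω).PosDef) :
    ContDiffAt ℝ ∞ (hermRoot b) Ω := by
  have hdet : ContDiffAt ℝ ∞ (fun α => (posMat b α).det) Ω :=
    contDiffAt_det fun j k => (contDiff_posMat b j k).contDiffAt
  have hre : ContDiffAt ℝ ∞ (fun α => (posMat b α).det.re / (hermConst b).re) Ω :=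
    (Complex.reCLM.contDiff.contDiffAt.comp Ω hdet).div_const _
  have hpow : ContDiffAt ℝ ∞
      (fun α => ((posMat b α).det.re / (hermConst b).re) ^ (m : ℝ)⁻¹) Ω :=
    hre.rpow_const_of_ne (div_pos (det_re_pos hΩ) (hermConst_re_pos b)).ne'
  have hinv : ∀ j k, ContDiffAt ℝ ∞ (fun α => (posMat b α)ᵀ⁻¹ j k) Ω :=
    contDiffAt_inv (fun j k => (contDiff_posMat b k j).contDiffAt)
      (by rw [Matrix.det_transpose]; exact hΩ.det_pos.ne')
  unfold hermRoot hermForm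
  refine ContDiffAt.sum fun j _ => ContDiffAt.sum fun k _ => ?_
  have hc : ContDiffAt ℝ ∞
      (fun α => ((((posMat b α).det.re / (hermConst b).re) ^ (m : ℝ)⁻¹ : ℝ) : ℂ)) Ω :=
    ContDiffAt.comp Ω (g := Complex.ofRealCLM) Complex.ofRealCLM.contDiff.contDiffAt hpow
  exact (hc.mul (hinv j k)).smul contDiffAt_const

end Root

/-! ### Smoothness of averages of translates. -/

section Averages

open MeasureTheory

universe u

variable {P : Type*} [TopologicalSpace P] [MeasurableSpace P] [OpensMeasurableSpace P]
  [SecondCountableTopology P] {μ : Measure P} [IsLocallyFiniteMeasure μ] {s : Set P}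
  {E : Type u} [NormedAddCommGroup E] [NormedSpace ℝ E] [FiniteDimensional ℝ E] {z : P → E}

/-- An average of translates of a function, with operator weights. -/
def avg {V W : Type*} [NormedAddCommGroup V] [NormedSpace ℝ V] [NormedAddCommGroup W]
    [NormedSpace ℝ W] (μ : Measure P) (s : Set P) (z : P → E) (L : P → V →L[ℝ] W) (f : E → V)
    (y : E) : W :=
  ∫ p in s, L p (f (y + z p)) ∂μ

theorem continuous_avg {V W : Type*} [NormedAddCommGroup V] [NormedSpace ℝ V]
    [NormedAddCommGroup W] [NormedSpace ℝ W] (hs : IsCompact s) (hz : Continuous z)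
    {L : P → V →L[ℝ] W} (hL : Continuous L) {f : E → V} (hf : Continuous f) :
    Continuous (avg μ s z L f) := by
  refine continuous_parametric_integral_of_continuous (f := fun y p => L p (f (y + z p))) ?_ hs
  exact (hL.comp continuous_snd).clm_apply (hf.comp (by fun_prop))

theorem norm_avg_le {V W : Type*} [NormedAddCommGroup V] [NormedSpace ℝ V]
    [NormedAddCommGroup W] [NormedSpace ℝ W] (hs : IsCompact s) {L : P → V →L[ℝ] W}
    {f : E → V} {y : E} {B C : ℝ} (hB : 0 ≤ B) (hL : ∀ p ∈ s, ‖L p‖ ≤ B)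
    (hf : ∀ p ∈ s, ‖f (y + z p)‖ ≤ C) :
    ‖avg μ s z L f y‖ ≤ B * C * μ.real s := by
  refine norm_setIntegral_le_of_norm_le_const hs.measure_lt_top fun p hp => ?_
  exact ((L p).le_opNorm _).trans (mul_le_mul (hL p hp) (hf p hp) (norm_nonneg _) hB)

/-- Differentiation under the integral sign: near `y` the derivatives of the integrand are bounded
by a constant, by compactness of a ball times `s`. -/
theorem hasFDerivAt_avg {V W : Type*} [NormedAddCommGroup V] [NormedSpace ℝ V]
    [NormedAddCommGroup W] [NormedSpace ℝ W] (hs : IsCompact s) (hsm : MeasurableSet s)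
    (hz : Continuous z) {L : P → V →L[ℝ] W} (hL : Continuous L) {f : E → V} (hf : ContDiff ℝ 1 f)
    (y : E) :
    HasFDerivAt (avg μ s z L f)
      (∫ p in s, (L p).comp (fderiv ℝ f (y + z p)) ∂μ) y := by
  have hf' : Continuous (fderiv ℝ f) := hf.continuous_fderiv (by simp)
  have hc : Continuous fun q : E × P => (L q.2).comp (fderiv ℝ f (q.1 + z q.2)) :=
    (hL.comp continuous_snd).clm_comp (hf'.comp (by fun_prop))
  obtain ⟨M, hM⟩ := ((isCompact_closedBall y 1).prod hs).bddAbove_image hc.norm.continuousOn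
  have hMb : ∀ x ∈ Metric.closedBall y 1, ∀ p ∈ s, ‖(L p).comp (fderiv ℝ f (x + z p))‖ ≤ M :=
    fun x hx p hp => hM ⟨(x, p), ⟨hx, hp⟩, rfl⟩
  have hc' : Continuous fun p => (L p).comp (fderiv ℝ f (y + z p)) :=
    hL.clm_comp (hf'.comp (by fun_prop))
  have hmeas : ∀ x, Continuous fun p => L p (f (x + z p)) := fun x =>
    hL.clm_apply (hf.continuous.comp (by fun_prop))
  refine hasFDerivAt_integral_of_dominated_of_fderiv_le (bound := fun _ => M)
    (F' := fun x p => (L p).comp (fderiv ℝ f (x + z p)))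
    (Metric.closedBall_mem_nhds y one_pos) ?_ ?_ ?_ ?_ ?_ ?_
  · exact Filter.Eventually.of_forall fun x => (hmeas x).aestronglyMeasurable
  · exact (hmeas y).continuousOn.integrableOn_compact' hs hsm
  · exact hc'.aestronglyMeasurable
  · refine (ae_restrict_iff' hsm).mpr (Filter.Eventually.of_forall fun p hp x hx => ?_)
    exact hMb x hx p hp
  · exact integrableOn_const hs.measure_lt_top.ne
  · refine Filter.Eventually.of_forall fun p x _ => ?_
    have h1 : HasFDerivAt f (fderiv ℝ f (x + z p)) (x + z p) :=
      (hf.differentiable (by simp) _).hasFDerivAt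
    have h2 : HasFDerivAt (fun x => f (x + z p)) (fderiv ℝ f (x + z p)) x :=
      (hasFDerivAt_comp_add_right (z p)).mpr h1
    exact (L p).hasFDerivAt.comp x h2

theorem clm_fderiv_avg {V W U : Type*} [NormedAddCommGroup V] [NormedSpace ℝ V]
    [NormedAddCommGroup W] [NormedSpace ℝ W] [NormedAddCommGroup U] [NormedSpace ℝ U]
    [CompleteSpace W] [CompleteSpace U] (hs : IsCompact s) (hsm : MeasurableSet s)
    (hz : Continuous z) {L : P → V →L[ℝ] W} (hL : Continuous L) {f : E → V} (hf : ContDiff ℝ 1 f)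
    (y : E) (B : (E →L[ℝ] W) →L[ℝ] U) :
    B (fderiv ℝ (avg μ s z L f) y) = ∫ p in s, B ((L p).comp (fderiv ℝ f (y + z p))) ∂μ := by
  have hc' : Continuous fun p => (L p).comp (fderiv ℝ f (y + z p)) :=
    hL.clm_comp ((hf.continuous_fderiv (by simp)).comp (by fun_prop))
  rw [(hasFDerivAt_avg hs hsm hz hL hf y).fderiv]
  exact (B.integral_comp_comm (hc'.continuousOn.integrableOn_compact' hs hsm)).symm

/-- The derivative of an average is again an average, of the derivative of `f`, with values in other
spaces. The induction therefore runs over all `V` and `W` at once, in the universe of `E` so that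
spaces of linear maps out of `E` remain admissible. -/
theorem contDiff_avg_nat (hs : IsCompact s) (hsm : MeasurableSet s) (hz : Continuous z) (n : ℕ) :
    ∀ {V W : Type u} [NormedAddCommGroup V] [NormedSpace ℝ V] [NormedAddCommGroup W]
      [NormedSpace ℝ W] {L : P → V →L[ℝ] W} (_ : Continuous L) {f : E → V} (_ : ContDiff ℝ n f),
      ContDiff ℝ n (avg μ s z L f) := by
  induction n with
  | zero =>
    intro V W _ _ _ _ L hL f hf
    exact contDiff_zero.mpr (continuous_avg hs hz hL (contDiff_zero.mp hf))
  | succ n ih =>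
    intro V W _ _ _ _ L hL f hf
    have h1 : ContDiff ℝ 1 f := hf.of_le (by norm_cast; omega)
    have hd := hasFDerivAt_avg (μ := μ) hs hsm hz hL h1
    have hf' : ContDiff ℝ n (fderiv ℝ f) := hf.fderiv_right (by norm_cast)
    push_cast
    rw [contDiff_succ_iff_fderiv]
    refine ⟨fun y => (hd y).differentiableAt, by simp, ?_⟩
    have h2 : fderiv ℝ (avg μ s z L f) =
        avg μ s z (fun p => ContinuousLinearMap.compL ℝ E V W (L p)) (fderiv ℝ f) := by
      ext1 y
      exact (hd y).fderiv
    rw [h2]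
    exact ih ((ContinuousLinearMap.compL ℝ E V W).continuous.comp hL) hf'

theorem contDiff_avg {V W : Type u} [NormedAddCommGroup V] [NormedSpace ℝ V]
    [NormedAddCommGroup W] [NormedSpace ℝ W] (hs : IsCompact s) (hsm : MeasurableSet s)
    (hz : Continuous z) {L : P → V →L[ℝ] W} (hL : Continuous L) {f : E → V}
    (hf : ContDiff ℝ ∞ f) : ContDiff ℝ ∞ (avg μ s z L f) :=
  contDiff_infty.mpr fun n => contDiff_avg_nat hs hsm hz n hL (contDiff_infty.mp hf n)

end Averages

/-! ### The homotopy between the identity and convolution on forms. -/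

section Homotopy

open MeasureTheory ContinuousAlternatingMap

variable {E : Type*} [NormedAddCommGroup E] [NormedSpace ℂ E] {k : ℕ}

theorem zero_smul_form (α : E [⋀^Fin k]→L[ℝ] ℂ) : (0 : ℝ) • α = 0 := by
  ext v; simp

/-- Interior product. -/
def contract : E →L[ℝ] (E [⋀^Fin (k + 1)]→L[ℝ] ℂ) →L[ℝ] (E [⋀^Fin k]→L[ℝ] ℂ) :=
  (ContinuousAlternatingMap.curryLeftLI (𝕜 := ℝ) (E := E) (F := ℂ)
    (n := k)).toContinuousLinearMap.flip

theorem contract_apply (a : E) (α : E [⋀^Fin (k + 1)]→L[ℝ] ℂ) (v : Fin k → E) :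
    contract a α v = α (Matrix.vecCons a v) := rfl

/-- The Cartan formula for a constant vector field: in the alternating sum on `(a, v)`, the first
term is `D a v` and the others form the derivative of the contraction with opposite sign. -/
theorem cartan_formula (D : E →L[ℝ] E [⋀^Fin (k + 1)]→L[ℝ] ℂ) (a : E) :
    D a = alternatizeUncurryFin ((contract a).comp D) + contract a (alternatizeUncurryFin D) := by
  ext v
  rw [ContinuousAlternatingMap.add_apply, contract_apply, alternatizeUncurryFin_apply,
    alternatizeUncurryFin_apply, Fin.sum_univ_succ (n := k + 1)]
  have h0 : (0 : Fin (k + 1 + 1)).removeNth (Matrix.vecCons a v) = v := by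
    ext i; simp [Fin.removeNth]
  have hi : ∀ i : Fin (k + 1), (i.succ).removeNth (Matrix.vecCons a v) =
      Matrix.vecCons a (i.removeNth v) := by
    intro i
    ext j
    refine Fin.cases ?_ (fun j => ?_) j
    · simp [Fin.removeNth]
    · simp [Fin.removeNth]
  simp only [h0, hi, Matrix.cons_val_zero, Matrix.cons_val_succ, Fin.val_zero, pow_zero, one_smul,
    Fin.val_succ, pow_succ, mul_neg, mul_one, neg_smul, Finset.sum_neg_distrib,
    ContinuousLinearMap.comp_apply, contract_apply]
  abel

variable [FiniteDimensional ℂ E] [MeasurableSpace E] [BorelSpace E]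

/-- Haar measure on the parameter space `E × ℝ`. -/
def paramMeasure (E : Type*) [NormedAddCommGroup E] [NormedSpace ℂ E] [FiniteDimensional ℂ E]
    [MeasurableSpace E] [BorelSpace E] : Measure (E × ℝ) :=
  (Measure.addHaar : Measure E).prod volume

variable (φ : ContDiffBump (0 : E))

/-- The parameters of the homotopy between the identity and the convolution with `φ`. -/
def paramSet : Set (E × ℝ) := Metric.closedBall 0 φ.rOut ×ˢ Set.Icc 0 1

theorem isCompact_paramSet : IsCompact (paramSet φ) :=
  have : ProperSpace E := FiniteDimensional.proper ℂ E
  (isCompact_closedBall _ _).prod isCompact_Icc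

theorem measurableSet_paramSet : MeasurableSet (paramSet φ) :=
  measurableSet_closedBall.prod measurableSet_Icc

/-- The mean of the translates of `f` for the weight `φ`. -/
def mollify (f : E → E [⋀^Fin k]→L[ℝ] ℂ) : E → E [⋀^Fin k]→L[ℝ] ℂ :=
  avg (Measure.addHaar : Measure E) (Metric.closedBall 0 φ.rOut) id
    (fun a => φ.normed Measure.addHaar a • ContinuousLinearMap.id ℝ _) f

/-- The homotopy operator between the identity and `mollify φ`. -/
def homOp (f : E → E [⋀^Fin (k + 1)]→L[ℝ] ℂ) : E → E [⋀^Fin k]→L[ℝ] ℂ :=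
  avg (paramMeasure E) (paramSet φ) (fun p => p.2 • p.1)
    (fun p => φ.normed Measure.addHaar p.1 • contract p.1) f

theorem continuous_homOp_weight : Continuous fun p : E × ℝ =>
    (φ.normed Measure.addHaar p.1 • contract p.1 :
      (E [⋀^Fin (k + 1)]→L[ℝ] ℂ) →L[ℝ] (E [⋀^Fin k]→L[ℝ] ℂ)) :=
  (φ.continuous_normed.comp continuous_fst).smul ((contract (k := k)).continuous.comp continuous_fst)

theorem continuous_mollify_weight : Continuous fun a : E =>
    (φ.normed Measure.addHaar a • ContinuousLinearMap.id ℝ (E [⋀^Fin k]→L[ℝ] ℂ)) :=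
  φ.continuous_normed.smul continuous_const

instance : IsLocallyFiniteMeasure (paramMeasure E) := by
  unfold paramMeasure; infer_instance

theorem continuous_homOp {f : E → E [⋀^Fin (k + 1)]→L[ℝ] ℂ} (hf : Continuous f) :
    Continuous (homOp φ f) :=
  continuous_avg (isCompact_paramSet φ) (by fun_prop) (continuous_homOp_weight φ) hf

theorem contDiff_homOp {f : E → E [⋀^Fin (k + 1)]→L[ℝ] ℂ} (hf : ContDiff ℝ ∞ f) :
    ContDiff ℝ ∞ (homOp φ f) :=
  contDiff_avg (isCompact_paramSet φ) (measurableSet_paramSet φ) (by fun_prop)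
    (continuous_homOp_weight φ) hf

/-- The average uses `y + a` and the convolution `y - a`; the bump function is even. Smoothness of
`mollify` for merely continuous `f` follows. -/
theorem mollify_eq_convolution (f : E → E [⋀^Fin k]→L[ℝ] ℂ) :
    mollify φ f = MeasureTheory.convolution (φ.normed Measure.addHaar) f
      (ContinuousLinearMap.lsmul ℝ ℝ) Measure.addHaar := by
  ext1 y
  unfold mollify avg MeasureTheory.convolution
  rw [setIntegral_eq_integral_of_forall_compl_eq_zero, ← integral_neg_eq_self]
  · refine integral_congr_ae (Filter.Eventually.of_forall fun a => ?_)
    simp [φ.normed_neg, sub_eq_add_neg]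
  · intro a ha
    have : a ∉ Function.support (φ.normed Measure.addHaar) := by
      rw [φ.support_normed_eq]
      exact fun h => ha (Metric.ball_subset_closedBall h)
    simp only [Function.notMem_support.mp this]
    exact zero_smul_form (f (y + a))

theorem contDiff_mollify {f : E → E [⋀^Fin k]→L[ℝ] ℂ} (hf : Continuous f) :
    ContDiff ℝ ∞ (mollify φ f) := by
  have : ProperSpace E := FiniteDimensional.proper ℂ E
  rw [mollify_eq_convolution]
  exact φ.hasCompactSupport_normed.contDiff_convolution_left _ φ.contDiff_normed
    hf.locallyIntegrable

/-- Locality: the translations are by `t • a` with `t ∈ [0, 1]` and `‖a‖ ≤ rOut`, so only values in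
that ball are used. -/
theorem homOp_congr {f g : E → E [⋀^Fin (k + 1)]→L[ℝ] ℂ} {y : E}
    (h : ∀ w ∈ Metric.closedBall y φ.rOut, f w = g w) : homOp φ f y = homOp φ g y := by
  refine setIntegral_congr_fun (measurableSet_paramSet φ) fun p hp => ?_
  simp only
  rw [h]
  rw [mem_closedBall_iff_norm, add_sub_cancel_left, norm_smul]
  have h1 : ‖p.1‖ ≤ φ.rOut := by simpa using hp.1
  have h2 : ‖p.2‖ ≤ 1 := by
    rw [Real.norm_eq_abs, abs_le]
    exact ⟨by linarith [hp.2.1], hp.2.2⟩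
  calc ‖p.2‖ * ‖p.1‖ ≤ 1 * φ.rOut := mul_le_mul h2 h1 (norm_nonneg _) zero_le_one
    _ = φ.rOut := one_mul _

/-- By locality `f` may be cut off outside a ball slightly larger than that of radius `rOut`, which
reduces the claim to forms that are smooth everywhere. -/
theorem contDiffAt_homOp {f : E → E [⋀^Fin (k + 1)]→L[ℝ] ℂ} {y : E} {r : ℝ} (hr : φ.rOut < r)
    (hf : ∀ w ∈ Metric.ball y r, ContDiffAt ℝ ∞ f w) : ContDiffAt ℝ ∞ (homOp φ f) y := by
  have h0 := φ.rOut_pos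
  let θ : ContDiffBump y := ⟨φ.rOut + (r - φ.rOut) / 3, φ.rOut + 2 * ((r - φ.rOut) / 3),
    by linarith, by linarith⟩
  have hθ : ContDiff ℝ ∞ fun w => θ w • f w := by
    refine contDiff_iff_contDiffAt.mpr fun w => ?_
    by_cases hw : w ∈ Metric.ball y r
    · exact θ.contDiffAt.smul (hf w hw)
    · have : (fun w => θ w • f w) =ᶠ[𝓝 w] fun _ => 0 := by
        have hw' : w ∈ (Metric.closedBall y θ.rOut)ᶜ := by
          intro h
          apply hw
          rw [Metric.mem_closedBall] at h
          rw [Metric.mem_ball]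
          have : θ.rOut = φ.rOut + 2 * ((r - φ.rOut) / 3) := rfl
          linarith
        filter_upwards [Metric.isClosed_closedBall.isOpen_compl.mem_nhds hw'] with z hz
        have hz' : θ.rOut < dist z y := not_le.mp fun h => hz (Metric.mem_closedBall.mpr h)
        rw [θ.zero_of_le_dist hz'.le]
        exact zero_smul_form (f z)
      exact contDiffAt_const.congr_of_eventuallyEq this
  refine ((contDiff_homOp φ hθ).contDiffAt).congr_of_eventuallyEq ?_
  filter_upwards [Metric.ball_mem_nhds y (by linarith : 0 < (r - φ.rOut) / 3)] with w hw
  refine homOp_congr φ fun z hz => ?_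
  rw [θ.one_of_mem_closedBall, one_smul]
  rw [Metric.mem_closedBall] at hz ⊢
  rw [Metric.mem_ball] at hw
  have : θ.rIn = φ.rOut + (r - φ.rOut) / 3 := rfl
  linarith [dist_triangle z w y]

/-- The homotopy formula. -/
theorem mollify_sub_self {f : E → E [⋀^Fin (k + 1)]→L[ℝ] ℂ} (hf : ContDiff ℝ 1 f) (y : E) :
    mollify φ f y - f y = extDeriv (homOp φ f) y + homOp φ (extDeriv f) y := by
  have : ProperSpace E := FiniteDimensional.proper ℂ E
  set ρ := φ.normed (Measure.addHaar : Measure E) with hρ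
  have hρc : Continuous ρ := φ.continuous_normed
  have hf' : Continuous (fderiv ℝ f) := hf.continuous_fderiv (by simp)
  have hS := isCompact_paramSet φ
  have hSm := measurableSet_paramSet φ
  have hW := continuous_homOp_weight (k := k) φ
  have hW' := continuous_homOp_weight (k := k + 1) φ
  have hD : Continuous fun p : E × ℝ => fderiv ℝ f (y + p.2 • p.1) := hf'.comp (by fun_prop)
  -- the right-hand side
  have h1 : extDeriv (homOp φ f) y = ∫ p in paramSet φ,
      alternatizeUncurryFin ((ρ p.1 • contract p.1).comp (fderiv ℝ f (y + p.2 • p.1)))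
      ∂(paramMeasure E) := by
    have h := clm_fderiv_avg (μ := paramMeasure E) hS hSm
      (by fun_prop : Continuous fun p : E × ℝ => p.2 • p.1) hW hf y
      (alternatizeUncurryFinCLM ℝ E ℂ)
    exact h
  -- By Cartan's formula the two integrands add up to the derivative of `f` in the direction `a` at
  -- `y + t • a`, which is a derivative in `t` and integrates to `f (y + a) - f y`.
  have h2 : extDeriv (homOp φ f) y + homOp φ (extDeriv f) y =
      ∫ p in paramSet φ, ρ p.1 • fderiv ℝ f (y + p.2 • p.1) p.1 ∂(paramMeasure E) := by
    rw [h1, homOp, avg, ← integral_add]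
    · refine setIntegral_congr_fun hSm fun p _ => ?_
      have hc := cartan_formula (fderiv ℝ f (y + p.2 • p.1)) p.1
      have hs : alternatizeUncurryFin ((ρ p.1 • contract p.1).comp (fderiv ℝ f (y + p.2 • p.1))) =
          ρ p.1 • alternatizeUncurryFin ((contract p.1).comp (fderiv ℝ f (y + p.2 • p.1))) := by
        rw [ContinuousLinearMap.smul_comp, alternatizeUncurryFin_smul]
      simp only [hs]
      conv_rhs => rw [hc]
      rw [smul_add]
      rfl
    · exact (((alternatizeUncurryFinCLM ℝ E ℂ).continuous.comp
        (hW.clm_comp hD))).continuousOn.integrableOn_compact' hS hSm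
    · refine (hW'.clm_apply ?_).continuousOn.integrableOn_compact' hS hSm
      exact (alternatizeUncurryFinCLM ℝ E ℂ).continuous.comp hD
  rw [h2]
  have hIntegrable : IntegrableOn (fun p : E × ℝ => ρ p.1 • fderiv ℝ f (y + p.2 • p.1) p.1) (paramSet φ)
      (paramMeasure E) := by
    refine Continuous.continuousOn ?_ |>.integrableOn_compact' hS hSm
    exact (hρc.comp continuous_fst).smul (hD.clm_apply continuous_fst)
  rw [paramMeasure, paramSet] at hIntegrable ⊢
  rw [setIntegral_prod _ hIntegrable]
  -- the inner integral
  have h3 : ∀ a : E, ∫ t in Set.Icc (0 : ℝ) 1, ρ a • fderiv ℝ f (y + t • a) a =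
      ρ a • f (y + a) - ρ a • f y := by
    intro a
    have hsub : ρ a • f (y + a) - ρ a • f y = ρ a • (f (y + a) - f y) := (smul_sub _ _ _).symm
    rw [integral_smul, hsub, integral_Icc_eq_integral_Ioc,
      ← intervalIntegral.integral_of_le zero_le_one]
    congr 1
    have hder : ∀ t ∈ Set.uIcc (0 : ℝ) 1,
        HasDerivAt (fun t : ℝ => f (y + t • a)) (fderiv ℝ f (y + t • a) a) t := by
      intro t _
      have hl : HasDerivAt (fun t : ℝ => y + t • a) a t := by
        simpa using ((hasDerivAt_id t).smul_const a).const_add y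
      exact ((hf.differentiable (by simp) (y + t • a)).hasFDerivAt).comp_hasDerivAt t hl
    rw [intervalIntegral.integral_eq_sub_of_hasDerivAt hder]
    · simp
    · refine Continuous.intervalIntegrable ?_ _ _
      exact (hf'.comp (by fun_prop)).clm_apply continuous_const
  simp only [h3]
  have hb : ∀ a ∉ Metric.closedBall (0 : E) φ.rOut, ρ a = 0 := by
    intro a ha
    have : a ∉ Function.support ρ := by
      rw [hρ, φ.support_normed_eq]
      exact fun h => ha (Metric.ball_subset_closedBall h)
    exact Function.notMem_support.mp this
  rw [integral_sub]
  · congr 1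
    rw [setIntegral_eq_integral_of_forall_compl_eq_zero fun a ha => by
      rw [hb a ha]; exact zero_smul_form (f y), φ.integral_normed_smul]
  · refine Continuous.continuousOn ?_ |>.integrableOn_compact' (isCompact_closedBall _ _)
      measurableSet_closedBall
    exact hρc.smul (hf.continuous.comp (by fun_prop))
  · refine Continuous.continuousOn ?_ |>.integrableOn_compact' (isCompact_closedBall _ _)
      measurableSet_closedBall
    exact hρc.smul continuous_const

end Homotopy

/-! ### Smooth dependence of form-valued maps. -/

section FormValued

variable {E : Type*} [NormedAddCommGroup E] [NormedSpace ℂ E] [FiniteDimensional ℂ E] {k : ℕ}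
  {Z : Type*} [NormedAddCommGroup Z] [NormedSpace ℝ Z] {n : WithTop ℕ∞}

/-- In finite dimension, forms are determined linearly by finitely many of their values. -/
theorem exists_leftInverse_evaluation :
    ∃ (ι : Type) (_ : Fintype ι) (w : ι → Fin k → E)
      (G : (ι → ℂ) →L[ℝ] (E [⋀^Fin k]→L[ℝ] ℂ)), ∀ α, G (fun s => α (w s)) = α := by
  let b := Module.finBasis ℝ E
  let f : (E [⋀^Fin k]→L[ℝ] ℂ) →ₗ[ℝ] ((Fin k → Fin (Module.finrank ℝ E)) → ℂ) :=
    { toFun := fun α s => α (fun i => b (s i))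
      map_add' := fun _ _ => rfl
      map_smul' := fun _ _ => rfl }
  have hf : LinearMap.ker f = ⊥ := by
    refine LinearMap.ker_eq_bot.mpr fun α β h => ?_
    apply ContinuousAlternatingMap.toAlternatingMap_injective
    apply AlternatingMap.coe_multilinearMap_injective
    exact Module.Basis.ext_multilinear (fun _ => b) fun s => congrFun h s
  obtain ⟨g, hg⟩ := LinearMap.exists_leftInverse_of_injective f hf
  refine ⟨_, inferInstance, fun s i => b (s i), LinearMap.toContinuousLinearMap g, fun α => ?_⟩
  exact LinearMap.congr_fun hg α

theorem contDiffAt_form {F : Z → E [⋀^Fin k]→L[ℝ] ℂ} {z : Z}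
    (h : ∀ v, ContDiffAt ℝ n (fun x => F x v) z) : ContDiffAt ℝ n F z := by
  obtain ⟨ι, _, w, G, hG⟩ := exists_leftInverse_evaluation (E := E) (k := k)
  have h1 : F = fun x => G (fun s => F x (w s)) := by
    ext1 x; exact (hG _).symm
  rw [h1]
  exact ContDiffAt.comp z (g := G) G.contDiff.contDiffAt (contDiffAt_pi.mpr fun s => h (w s))

/-- Pullback is smooth in both variables. -/
theorem ContDiffAt.form_comp {F : Z → E [⋀^Fin k]→L[ℝ] ℂ} {L : Z → E →L[ℝ] E} {z : Z}
    (hF : ContDiffAt ℝ n F z) (hL : ContDiffAt ℝ n L z) :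
    ContDiffAt ℝ n (fun x => (F x).compContinuousLinearMap (L x)) z := by
  refine contDiffAt_form fun v => ?_
  let b := Module.finBasis ℝ (E [⋀^Fin k]→L[ℝ] ℂ)
  have h1 : (fun x => (F x).compContinuousLinearMap (L x) v) =
      fun x => ∑ j, b.repr (F x) j • b j (fun i => L x (v i)) := by
    ext1 x
    have h2 : ∀ w, F x w = ∑ j, b.repr (F x) j • b j w := by
      intro w
      have h3 := congrArg (fun α : E [⋀^Fin k]→L[ℝ] ℂ => α w) (b.sum_repr (F x))
      simp only [ContinuousAlternatingMap.sum_apply, ContinuousAlternatingMap.smul_apply] at h3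
      exact h3.symm
    exact h2 _
  rw [h1]
  have hc : ∀ j, ContDiffAt ℝ n (fun x => b.repr (F x) j) z := fun j =>
    ContDiffAt.comp z (g := LinearMap.toContinuousLinearMap (b.coord j))
      (LinearMap.toContinuousLinearMap (b.coord j)).contDiff.contDiffAt hF
  have hv : ∀ j, ContDiffAt ℝ n (fun x => b j (fun i => L x (v i))) z := fun j =>
    ContDiffAt.comp z (g := (b j).toContinuousMultilinearMap)
      (b j).toContinuousMultilinearMap.contDiff.contDiffAt
      (contDiffAt_pi.mpr fun i => hL.clm_apply contDiffAt_const)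
  exact ContDiffAt.sum fun j _ => (hc j).smul (hv j)

end FormValued

/-! ### Regularity at a point, and transport of forms between a chart and the manifold. -/

section Charts

variable {E : Type*} [NormedAddCommGroup E] [NormedSpace ℂ E] [FiniteDimensional ℂ E]
  {X : Type*} [TopologicalSpace X] [ChartedSpace E X] [IsManifold 𝓘(ℂ, E) ω X] {k : ℕ}
  {e e' : OpenPartialHomeomorph X E} {n : WithTop ℕ∞}

theorem isManifold_one : IsManifold 𝓘(ℂ, E) 1 X := IsManifold.of_le (n := ω) le_top

theorem mfderiv_symm_apply_mfderiv (he : e ∈ atlas E X) {x : X} (hx : x ∈ e.source)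
    (v : TangentSpace 𝓘(ℂ, E) x) :
    mfderiv 𝓘(ℂ, E) 𝓘(ℂ, E) e.symm (e x) (mfderiv 𝓘(ℂ, E) 𝓘(ℂ, E) e x v) = v := by
  have := isManifold_one (E := E) (X := X)
  exact congrArg (fun L : TangentSpace 𝓘(ℂ, E) x →L[ℂ] TangentSpace 𝓘(ℂ, E) x => L v)
    ((mdifferentiable_of_mem_atlas (I := 𝓘(ℂ, E)) he).symm_comp_deriv hx)

theorem mfderiv_apply_mfderiv_symm (he : e ∈ atlas E X) {y : E} (hy : y ∈ e.target)
    (v : E) :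
    mfderiv 𝓘(ℂ, E) 𝓘(ℂ, E) e (e.symm y) (mfderiv 𝓘(ℂ, E) 𝓘(ℂ, E) e.symm y v) = v := by
  have := isManifold_one (E := E) (X := X)
  exact congrArg (fun L : E →L[ℂ] E => L v)
    ((mdifferentiable_of_mem_atlas (I := 𝓘(ℂ, E)) he).comp_symm_deriv hy)

theorem inChart_apply_mfderiv (φ : RoughForm E X k) (he : e ∈ atlas E X) {x : X}
    (hx : x ∈ e.source) (v : Fin k → TangentSpace 𝓘(ℂ, E) x) :
    inChart φ e (e x) (fun i => (mfderiv 𝓘(ℂ, E) 𝓘(ℂ, E) e x (v i) : E)) = φ x v := by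
  refine (inChart_apply φ e (e x) _).trans ?_
  have h1 := e.left_inv hx
  have h2 : (fun j => (mfderiv 𝓘(ℂ, E) 𝓘(ℂ, E) e.symm (e x)
      (mfderiv 𝓘(ℂ, E) 𝓘(ℂ, E) e x (v j)) : E)) = v := by
    ext1 j; exact mfderiv_symm_apply_mfderiv he hx (v j)
  exact (congrArg (φ (e.symm (e x))) h2).trans
    (congrArg (fun z : X => φ z (fun j => (v j : E))) h1)

theorem eq_of_inChart_eq {φ ψ : RoughForm E X k} (he : e ∈ atlas E X) {x : X} (hx : x ∈ e.source)
    (h : inChart φ e (e x) = inChart ψ e (e x)) : φ x = ψ x := by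
  ext v
  rw [← inChart_apply_mfderiv φ he hx, ← inChart_apply_mfderiv ψ he hx, h]

/-- Regularity of a form at a point. -/
def RegularAt (n : WithTop ℕ∞) (φ : RoughForm E X k) (x : X) : Prop :=
  ∀ e ∈ atlas E X, x ∈ e.source → ContDiffAt ℝ n (inChart φ e) (e x)

theorem contDiffAt_transition_real (he : e ∈ atlas E X) (he' : e' ∈ atlas E X) {y : E}
    (hy : y ∈ (e.symm.trans e').source) : ContDiffAt ℝ ω (e' ∘ e.symm) y :=
  (contDiffAt_transition he he' hy).restrict_scalars ℝ

theorem mem_transition_source {x : X} (hx : x ∈ e.source) (hx' : x ∈ e'.source) :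
    e x ∈ (e.symm.trans e').source := by
  simp [hx, hx']

/-- Expressions in two charts differ by pullback under a smooth transition map, so one chart
decides. -/
theorem regularAt_of_chart {φ : RoughForm E X k} (he : e ∈ atlas E X) {x : X} (hx : x ∈ e.source)
    (h : ContDiffAt ℝ n (inChart φ e) (e x)) : RegularAt n φ x := by
  intro e' he' hx'
  have hy := mem_transition_source (e := e') (e' := e) hx' hx
  have hT := contDiffAt_transition_real he' he hy
  have h1 : inChart φ e' =ᶠ[𝓝 (e' x)] fun z => (inChart φ e ((e ∘ e'.symm) z)).compContinuousLinearMap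
      (fderiv ℝ (e ∘ e'.symm) z) := by
    filter_upwards [(e'.symm.trans e).open_source.mem_nhds hy] with z hz
    exact inChart_eq_pullback φ he' he hz
  refine ContDiffAt.congr_of_eventuallyEq ?_ h1
  refine ContDiffAt.form_comp ?_ ?_
  · refine ContDiffAt.comp (e' x) (g := inChart φ e) ?_ (hT.of_le le_top)
    rw [Function.comp_apply, e'.left_inv hx']
    exact h
  · exact (hT.fderiv_right (m := ω) (by simp)).of_le le_top

theorem isSmooth_iff {φ : RoughForm E X k} : IsSmooth φ ↔ ∀ x, RegularAt ∞ φ x := by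
  constructor
  · intro h x e he hx
    exact (h e he).contDiffAt (e.open_target.mem_nhds (e.map_source hx))
  · intro h e he y hy
    have := h (e.symm y) e he (e.map_target hy)
    rw [e.right_inv hy] at this
    exact this.contDiffWithinAt

theorem RegularAt.of_le {m : WithTop ℕ∞} {φ : RoughForm E X k} {x : X} (h : RegularAt n φ x)
    (hm : m ≤ n) : RegularAt m φ x := fun e he hx => (h e he hx).of_le hm

theorem eventually_inChart_eq {φ ψ : RoughForm E X k} {x : X} (hx : x ∈ e.source)
    (h : ∀ᶠ z in 𝓝 x, φ z = ψ z) : inChart φ e =ᶠ[𝓝 (e x)] inChart ψ e := by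
  have h1 : Filter.Tendsto e.symm (𝓝 (e x)) (𝓝 x) := by
    have := e.symm.continuousAt (e.map_source hx)
    rw [ContinuousAt, e.left_inv hx] at this
    exact this
  filter_upwards [h1.eventually h] with y hy
  ext v
  rw [inChart_apply, inChart_apply, hy]

theorem RegularAt.congr {φ ψ : RoughForm E X k} {x : X} (h : RegularAt n φ x)
    (hφ : ∀ᶠ z in 𝓝 x, ψ z = φ z) : RegularAt n ψ x := fun e he hx =>
  (h e he hx).congr_of_eventuallyEq (eventually_inChart_eq hx hφ)

theorem RegularAt.zero (x : X) : RegularAt n (0 : RoughForm E X k) x := fun e _ _ => by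
  rw [inChart_zero]; exact contDiffAt_const

theorem RegularAt.add {φ ψ : RoughForm E X k} {x : X} (h : RegularAt n φ x)
    (h' : RegularAt n ψ x) : RegularAt n (φ + ψ) x := fun e he hx => by
  rw [inChart_add]; exact (h e he hx).add (h' e he hx)

theorem RegularAt.smul {φ : RoughForm E X k} {x : X} (h : RegularAt n φ x) (c : ℂ) :
    RegularAt n (c • φ) x := fun e he hx => by
  rw [inChart_smul]; exact (h e he hx).const_smul c

theorem RegularAt.sum {ι : Type*} {s : Finset ι} {φ : ι → RoughForm E X k} {x : X}
    (h : ∀ i ∈ s, RegularAt n (φ i) x) : RegularAt n (∑ i ∈ s, φ i) x := by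
  classical
  induction s using Finset.induction_on with
  | empty => simpa using RegularAt.zero x
  | insert a s ha ih =>
    rw [Finset.sum_insert ha]
    exact (h a (Finset.mem_insert_self a s)).add
      (ih fun i hi => h i (Finset.mem_insert_of_mem hi))

/-- The pullback of a form under a chart, extended by zero. -/
def ofChart (e : OpenPartialHomeomorph X E) (g : E → E [⋀^Fin k]→L[ℝ] ℂ) : RoughForm E X k :=
  open scoped Classical in
  fun x => if x ∈ e.source then (g (e x)).compContinuousLinearMap
    ((mfderiv 𝓘(ℂ, E) 𝓘(ℂ, E) e x).restrictScalars ℝ) else 0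

theorem ofChart_apply {g : E → E [⋀^Fin k]→L[ℝ] ℂ} {x : X} (hx : x ∈ e.source) :
    ofChart e g x = (g (e x)).compContinuousLinearMap
      ((mfderiv 𝓘(ℂ, E) 𝓘(ℂ, E) e x).restrictScalars ℝ) := if_pos hx

theorem ofChart_eq_zero {g : E → E [⋀^Fin k]→L[ℝ] ℂ} {x : X}
    (h : x ∈ e.source → g (e x) = 0) : ofChart e g x = 0 := by
  by_cases hx : x ∈ e.source
  · rw [ofChart_apply hx, h hx]
    rfl
  · exact if_neg hx

theorem inChart_ofChart (he : e ∈ atlas E X) (g : E → E [⋀^Fin k]→L[ℝ] ℂ) {y : E}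
    (hy : y ∈ e.target) : inChart (ofChart e g) e y = g y := by
  ext v
  rw [inChart_apply, ofChart_apply (e.map_target hy)]
  have h1 : (fun j => (mfderiv 𝓘(ℂ, E) 𝓘(ℂ, E) e (e.symm y)
      (mfderiv 𝓘(ℂ, E) 𝓘(ℂ, E) e.symm y (v j)) : E)) = v := by
    ext1 j; exact mfderiv_apply_mfderiv_symm he hy (v j)
  exact (congrArg (g (e (e.symm y))) h1).trans (congrArg (fun z => g z v) (e.right_inv hy))

theorem ofChart_inChart (he : e ∈ atlas E X) (φ : RoughForm E X k) {x : X} (hx : x ∈ e.source) :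
    ofChart e (inChart φ e) x = φ x :=
  eq_of_inChart_eq he hx (inChart_ofChart he _ (e.map_source hx))

theorem ofChart_add (g h : E → E [⋀^Fin k]→L[ℝ] ℂ) :
    ofChart e (g + h) = ofChart e g + ofChart e h := by
  ext1 x
  by_cases hx : x ∈ e.source
  · rw [Pi.add_apply, ofChart_apply hx, ofChart_apply hx, ofChart_apply hx]; rfl
  · rw [Pi.add_apply, ofChart, ofChart, ofChart, if_neg hx, if_neg hx, if_neg hx, add_zero]

theorem ofChart_smul (c : ℝ) (g : E → E [⋀^Fin k]→L[ℝ] ℂ) :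
    ofChart e (c • g) = c • ofChart e g := by
  ext1 x
  by_cases hx : x ∈ e.source
  · rw [Pi.smul_apply, ofChart_apply hx, ofChart_apply hx]; rfl
  · rw [Pi.smul_apply, ofChart, ofChart, if_neg hx, if_neg hx]
    ext v
    simp

variable [T2Space X]

theorem isClosed_symm_image {K : Set E} (hK : IsCompact K) (hKe : K ⊆ e.target) :
    IsClosed (e.symm '' K) :=
  (hK.image_of_continuousOn (e.continuousOn_symm.mono hKe)).isClosed

theorem mem_symm_image {K : Set E} (hKe : K ⊆ e.target) {x : X} :
    x ∈ e.symm '' K ↔ x ∈ e.source ∧ e x ∈ K := by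
  constructor
  · rintro ⟨y, hy, rfl⟩
    exact ⟨e.map_target (hKe hy), by rwa [e.right_inv (hKe hy)]⟩
  · rintro ⟨hx, h⟩
    exact ⟨e x, h, e.left_inv hx⟩

/-- In a Hausdorff space the image of `K` is closed, so outside of it the extended form vanishes in
a neighbourhood; inside, the chart decides. -/
theorem regularAt_ofChart (he : e ∈ atlas E X) {g : E → E [⋀^Fin k]→L[ℝ] ℂ} {x : X}
    {K : Set E} (hK : IsCompact K) (hKe : K ⊆ e.target) (hg : ∀ y ∉ K, g y = 0)
    (h : e x ∈ K → ContDiffAt ℝ n g (e x)) : RegularAt n (ofChart e g) x := by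
  by_cases hx : x ∈ e.symm '' K
  · obtain ⟨hs, hxK⟩ := (mem_symm_image hKe).mp hx
    refine regularAt_of_chart he hs ((h hxK).congr_of_eventuallyEq ?_)
    filter_upwards [e.open_target.mem_nhds (e.map_source hs)] with y hy
    exact inChart_ofChart he g hy
  · refine (RegularAt.zero x).congr ?_
    filter_upwards [(isClosed_symm_image hK hKe).isOpen_compl.mem_nhds hx] with z hz
    exact ofChart_eq_zero fun hs => hg _ fun h => hz ((mem_symm_image hKe).mpr ⟨hs, h⟩)

end Charts

/-! ### The exterior derivative on the manifold, and comparison of norms in two charts. -/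

section Local

variable {E : Type*} [NormedAddCommGroup E] [NormedSpace ℂ E] [FiniteDimensional ℂ E]
  {X : Type*} [TopologicalSpace X] [ChartedSpace E X] [IsManifold 𝓘(ℂ, E) ω X] {k : ℕ}
  {e e' : OpenPartialHomeomorph X E}

theorem extD_congr {φ ψ : RoughForm E X k} {x : X} (h : ∀ᶠ z in 𝓝 x, φ z = ψ z) :
    extD φ x = extD ψ x := by
  have h1 := eventually_inChart_eq (e := chartAt E x) (mem_chart_source E x) h
  simp only [extD, viaChart]
  rw [h1.extDeriv_eq]

theorem extD_zero : extD (0 : RoughForm E X k) = 0 := by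
  ext x v
  simp only [extD, viaChart, inChart_zero]
  have : extDeriv (0 : E → E [⋀^Fin k]→L[ℝ] ℂ) = 0 := by
    ext1 y
    have h : fderiv ℝ (0 : E → E [⋀^Fin k]→L[ℝ] ℂ) y = 0 := fderiv_const_apply _
    simp only [extDeriv, h]
    exact map_zero (ContinuousAlternatingMap.alternatizeUncurryFinCLM ℝ E ℂ)
  rw [this]
  rfl

theorem extD_add {φ ψ : RoughForm E X k} (hφ : IsSmooth φ) (hψ : IsSmooth ψ) :
    extD (φ + ψ) = extD φ + extD ψ := by
  ext1 x
  refine eq_of_inChart_eq (chart_mem_atlas E x) (mem_chart_source E x) ?_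
  have hy := mem_chart_target E x
  have hs : IsSmooth (φ + ψ) := (smoothForms E X k).add_mem hφ hψ
  have he := chart_mem_atlas E x
  have hd : ∀ {u : RoughForm E X k}, IsSmooth u →
      DifferentiableAt ℝ (inChart u (chartAt E x)) (chartAt E x x) := fun h =>
    ((h _ he).contDiffAt ((chartAt E x).open_target.mem_nhds hy)).differentiableAt (by simp)
  rw [inChart_add, Pi.add_apply, inChart_extD hs he hy, inChart_extD hφ he hy,
    inChart_extD hψ he hy, inChart_add]
  exact extDeriv_add (hd hφ) (hd hψ)

theorem extD_smul (c : ℂ) {φ : RoughForm E X k} (hφ : IsSmooth φ) :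
    extD (c • φ) = c • extD φ := by
  ext1 x
  refine eq_of_inChart_eq (chart_mem_atlas E x) (mem_chart_source E x) ?_
  have hy := mem_chart_target E x
  have hs : IsSmooth (c • φ) := (smoothForms E X k).smul_mem c hφ
  have he := chart_mem_atlas E x
  have hd : DifferentiableAt ℝ (inChart φ (chartAt E x)) (chartAt E x x) :=
    ((hφ _ he).contDiffAt ((chartAt E x).open_target.mem_nhds hy)).differentiableAt (by simp)
  rw [inChart_smul, Pi.smul_apply, inChart_extD hs he hy, inChart_extD hφ he hy, inChart_smul]
  simp only [extDeriv]
  rw [fderiv_const_smul hd, ContinuousAlternatingMap.alternatizeUncurryFin_smul]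

theorem extD_extD {φ : RoughForm E X k} (hφ : IsSmooth φ) : extD (extD φ) = 0 := by
  ext1 x
  refine eq_of_inChart_eq (chart_mem_atlas E x) (mem_chart_source E x) ?_
  have hy := mem_chart_target E x
  have he := chart_mem_atlas E x
  rw [inChart_extD (isSmooth_extD hφ) he hy, inChart_zero]
  have h1 : inChart (extD φ) (chartAt E x) =ᶠ[𝓝 (chartAt E x x)]
      extDeriv (inChart φ (chartAt E x)) := by
    filter_upwards [(chartAt E x).open_target.mem_nhds hy] with z hz
    exact inChart_extD hφ he hz
  rw [h1.extDeriv_eq]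
  exact extDeriv_extDeriv_apply (r := ∞)
    ((hφ _ he).contDiffAt ((chartAt E x).open_target.mem_nhds hy)) 
    (by simpa using (WithTop.coe_le_coe.mpr le_top : ((2 : ℕ∞) : WithTop ℕ∞) ≤ ∞))

/-- Comparison of the sizes of a form in two charts. -/
theorem exists_transition_bound [T2Space X] (he : e ∈ atlas E X) (he' : e' ∈ atlas E X)
    {K K' : Set E} (hK : IsCompact K) (hK' : IsCompact K') (hKe : K ⊆ e.target)
    (hKe' : K' ⊆ e'.target) (k : ℕ) :
    ∃ C : ℝ, 0 ≤ C ∧ ∀ (φ : RoughForm E X k), ∀ y ∈ K, ∀ y' ∈ K', e.symm y = e'.symm y' →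
      ‖inChart φ e y‖ ≤ C * ‖inChart φ e' y'‖ := by
  -- The points of `K` whose image also lies over `K'` form a compact set inside the domain of the
  -- transition map, on which its derivative is bounded.
  set A : Set E := K ∩ e.symm ⁻¹' (e'.symm '' K') with hA
  have hAc : IsCompact A := by
    refine hK.of_isClosed_subset ?_ Set.inter_subset_left
    exact (e.continuousOn_symm.mono hKe).preimage_isClosed_of_isClosed hK.isClosed
      (isClosed_symm_image hK' hKe')
  have hAs : ∀ y ∈ A, y ∈ (e.symm.trans e').source := by
    rintro y ⟨hy, hy'⟩
    have := ((mem_symm_image hKe').mp hy').1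
    simpa using ⟨hKe hy, this⟩
  have hcont : ContinuousOn (fun y => ‖fderiv ℝ (e' ∘ e.symm) y‖ ^ k) A := by
    intro y hy
    have h1 : ContDiffAt ℝ ω (fderiv ℝ (e' ∘ e.symm)) y :=
      (contDiffAt_transition_real he he' (hAs y hy)).fderiv_right (by simp)
    exact (h1.continuousAt.norm.pow k).continuousWithinAt
  obtain ⟨C, hC⟩ := hAc.bddAbove_image hcont
  refine ⟨max C 0, le_max_right _ _, fun φ y hy y' hy' h => ?_⟩
  have hyA : y ∈ A := ⟨hy, y', hy', h.symm⟩
  have h2 : (e' ∘ e.symm) y = y' := by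
    rw [Function.comp_apply, h, e'.right_inv (hKe' hy')]
  rw [inChart_eq_pullback φ he he' (hAs y hyA), h2]
  refine (ContinuousAlternatingMap.norm_compContinuousLinearMap_le _ _).trans ?_
  rw [Fintype.card_fin, mul_comm]
  exact mul_le_mul_of_nonneg_right ((hC ⟨y, hyA, rfl⟩).trans (le_max_left _ _)) (norm_nonneg _)

theorem extD_ofChart [T2Space X] (he : e ∈ atlas E X) {g : E → E [⋀^Fin k]→L[ℝ] ℂ}
    {K : Set E} (hK : IsCompact K) (hKe : K ⊆ e.target) (hg : ∀ y ∉ K, g y = 0)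
    (hs : IsSmooth (ofChart e g)) : extD (ofChart e g) = ofChart e (extDeriv g) := by
  ext1 x
  by_cases hx : x ∈ e.source
  · refine eq_of_inChart_eq he hx ?_
    rw [inChart_extD hs he (e.map_source hx), inChart_ofChart he _ (e.map_source hx)]
    refine Filter.EventuallyEq.extDeriv_eq ?_
    filter_upwards [e.open_target.mem_nhds (e.map_source hx)] with z hz
    exact inChart_ofChart he g hz
  · rw [ofChart_eq_zero fun h => absurd h hx]
    have h1 : ∀ᶠ z in 𝓝 x, ofChart e g z = (0 : RoughForm E X k) z := by
      have : x ∈ (e.symm '' K)ᶜ := fun h => hx ((mem_symm_image hKe).mp h).1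
      filter_upwards [(isClosed_symm_image hK hKe).isOpen_compl.mem_nhds this] with z hz
      exact ofChart_eq_zero fun hs => hg _ fun h => hz ((mem_symm_image hKe).mpr ⟨hs, h⟩)
    rw [extD_congr h1, extD_zero]
    rfl

end Local

/-! ### Finite covers by coordinate balls, and sup norms of continuous forms. -/

section Covers

variable (E : Type*) [NormedAddCommGroup E] [NormedSpace ℂ E] [FiniteDimensional ℂ E]
  (X : Type*) [TopologicalSpace X] [ChartedSpace E X] [IsManifold 𝓘(ℂ, E) ω X] (k : ℕ)

/-- A finite cover by coordinate balls, each of which has a concentric ball of eight times its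
radius in the same chart. -/
structure DiscCover where
  /-- The centres. -/
  points : Finset X
  /-- Twice the radii. -/
  radius : X → ℝ
  radius_pos : ∀ x, 0 < radius x
  subset_target : ∀ x, Metric.closedBall (chartAt E x x) (4 * radius x) ⊆ (chartAt E x).target
  exists_mem : ∀ x, ∃ i ∈ points, x ∈ (chartAt E i).source ∧
    chartAt E i x ∈ Metric.ball (chartAt E i i) (radius i / 2)

theorem exists_discCover [CompactSpace X] : Nonempty (DiscCover E X) := by
  have h : ∀ x : X, ∃ r > 0, Metric.closedBall (chartAt E x x) (4 * r) ⊆ (chartAt E x).target := by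
    intro x
    obtain ⟨ε, hε, h⟩ := Metric.nhds_basis_closedBall.mem_iff.mp
      ((chartAt E x).open_target.mem_nhds (mem_chart_target E x))
    exact ⟨ε / 4, by positivity, by rwa [mul_div_cancel₀ _ (by norm_num : (4 : ℝ) ≠ 0)]⟩
  choose r hr hrt using h
  let U : X → Set X := fun i => (chartAt E i).source ∩
    chartAt E i ⁻¹' Metric.ball (chartAt E i i) (r i / 2)
  have hU : ∀ i, IsOpen (U i) := fun i =>
    (chartAt E i).isOpen_inter_preimage Metric.isOpen_ball
  obtain ⟨t, ht⟩ := isCompact_univ.elim_finite_subcover U hU fun x _ =>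
    Set.mem_iUnion.mpr ⟨x, mem_chart_source E x, Metric.mem_ball_self (by have := hr x; positivity)⟩
  refine ⟨⟨t, r, hr, hrt, fun x => ?_⟩⟩
  obtain ⟨i, hi⟩ := Set.mem_iUnion.mp (ht (Set.mem_univ x))
  obtain ⟨hit, hx⟩ := Set.mem_iUnion.mp hi
  exact ⟨i, hit, hx⟩

/-- The real vector space of continuous forms. -/
def ContForm : Submodule ℝ (RoughForm E X k) where
  carrier := {φ | ∀ x, RegularAt 0 φ x}
  add_mem' hφ hψ x := (hφ x).add (hψ x)
  zero_mem' x := RegularAt.zero x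
  smul_mem' c φ hφ x := by
    have : c • φ = (c : ℂ) • φ := by
      ext x v
      simp
    rw [this]
    exact (hφ x).smul (c : ℂ)

variable {E X k}

theorem ContForm.continuousOn (u : ContForm E X k) {e : OpenPartialHomeomorph X E}
    (he : e ∈ atlas E X) : ContinuousOn (inChart u.1 e) e.target := by
  intro y hy
  have := u.2 (e.symm y) e he (e.map_target hy)
  rw [e.right_inv hy] at this
  exact this.continuousAt.continuousWithinAt

theorem IsSmooth.mem_contForm {φ : RoughForm E X k} (h : IsSmooth φ) : φ ∈ ContForm E X k :=
  fun x => (isSmooth_iff.mp h x).of_le (by simp)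

/-- A smooth form as a continuous form. -/
def Form.toCont (φ : Form E X k) : ContForm E X k := ⟨φ.val, IsSmooth.mem_contForm φ.2⟩

namespace DiscCover

variable (D : DiscCover E X)

/-- The closed coordinate balls on which forms are compared. -/
def disc (i : X) : Set E := Metric.closedBall (chartAt E i i) (D.radius i)

theorem isCompact_disc (i : X) : IsCompact (D.disc i) :=
  have : ProperSpace E := FiniteDimensional.proper ℂ E
  isCompact_closedBall _ _

theorem disc_subset (i : X) : D.disc i ⊆ (chartAt E i).target :=
  (Metric.closedBall_subset_closedBall (by linarith [D.radius_pos i])).trans (D.subset_target i)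

instance (i : X) : CompactSpace (D.disc i) := isCompact_iff_compactSpace.mp (D.isCompact_disc i)

variable (k) in
/-- Tuples of continuous functions on the discs. -/
def SupSpace : Type _ := ∀ i : D.points, C(D.disc i, E [⋀^Fin k]→L[ℝ] ℂ)

instance : NormedAddCommGroup (D.SupSpace k) :=
  inferInstanceAs (NormedAddCommGroup (∀ i : D.points, C(D.disc i, E [⋀^Fin k]→L[ℝ] ℂ)))

instance : NormedSpace ℂ (D.SupSpace k) :=
  inferInstanceAs (NormedSpace ℂ (∀ i : D.points, C(D.disc i, E [⋀^Fin k]→L[ℝ] ℂ)))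

instance : CompleteSpace (D.SupSpace k) :=
  inferInstanceAs (CompleteSpace (∀ i : D.points, C(D.disc i, E [⋀^Fin k]→L[ℝ] ℂ)))

theorem SupSpace.norm_apply_le (f : D.SupSpace k) (i : D.points) (y : D.disc i) :
    ‖f i y‖ ≤ ‖f‖ :=
  ((f i).norm_coe_le_norm y).trans
    (norm_le_pi_norm (f : ∀ i : D.points, C(D.disc i, E [⋀^Fin k]→L[ℝ] ℂ)) i)

theorem SupSpace.norm_le {f : D.SupSpace k} {C : ℝ} (hC : 0 ≤ C) (h : ∀ i y, ‖f i y‖ ≤ C) :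
    ‖f‖ ≤ C :=
  (pi_norm_le_iff_of_nonneg (x := (f : ∀ i : D.points, C(D.disc i, E [⋀^Fin k]→L[ℝ] ℂ))) hC).mpr
    fun i => (ContinuousMap.norm_le _ hC).mpr fun y => h i y

variable {D} in
theorem SupSpace.ext {f g : D.SupSpace k} (h : ∀ i y, f i y = g i y) : f = g :=
  funext fun i => ContinuousMap.ext fun y => h i y

/-- The expressions of a continuous form on the discs. -/
def lift : ContForm E X k →ₗ[ℝ] D.SupSpace k where
  toFun u i := ⟨fun y => inChart u.1 (chartAt E (i : X)) y,
    ((ContForm.continuousOn u (chart_mem_atlas E (i : X))).mono (D.disc_subset i)).comp_continuous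
      continuous_subtype_val fun y => y.2⟩
  map_add' u v := by
    exact SupSpace.ext fun i y => rfl
  map_smul' c u := by
    exact SupSpace.ext fun i y => rfl

theorem norm_inChart_le_lift (u : ContForm E X k) (i : D.points) {y : E} (hy : y ∈ D.disc i) :
    ‖inChart u.1 (chartAt E (i : X)) y‖ ≤ ‖D.lift u‖ :=
  SupSpace.norm_apply_le D (D.lift u) i ⟨y, hy⟩

theorem norm_lift_le {u : ContForm E X k} {C : ℝ} (hC : 0 ≤ C)
    (h : ∀ i ∈ D.points, ∀ y ∈ D.disc i, ‖inChart u.1 (chartAt E i) y‖ ≤ C) : ‖D.lift u‖ ≤ C :=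
  SupSpace.norm_le D hC fun i y => h i i.2 y y.2

variable [T2Space X]

/-- Every point of `K` is covered by one of the finitely many discs, and the transition to that disc
costs a bounded factor. The sup norm over the discs thus controls the expression in any chart over a
compact set. -/
theorem exists_bound_inChart {e : OpenPartialHomeomorph X E} (he : e ∈ atlas E X) {K : Set E}
    (hK : IsCompact K) (hKe : K ⊆ e.target) (k : ℕ) :
    ∃ C : ℝ, 0 ≤ C ∧ ∀ (u : ContForm E X k), ∀ y ∈ K, ‖inChart u.1 e y‖ ≤ C * ‖D.lift u‖ := by
  choose C hC0 hC using fun i : X => exists_transition_bound he (chart_mem_atlas E i) hK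
    (D.isCompact_disc i) hKe (D.disc_subset i) k
  refine ⟨∑ i ∈ D.points, C i, Finset.sum_nonneg fun i _ => hC0 i, fun u y hy => ?_⟩
  obtain ⟨i, hi, hs, hb⟩ := D.exists_mem (e.symm y)
  have hyi : chartAt E i (e.symm y) ∈ D.disc i :=
    Metric.ball_subset_closedBall (Metric.ball_subset_ball (by linarith [D.radius_pos i]) hb)
  have h1 := hC i u.1 y hy _ hyi ((chartAt E i).left_inv hs).symm
  refine h1.trans (mul_le_mul ?_ (D.norm_inChart_le_lift u ⟨i, hi⟩ hyi) (norm_nonneg _)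
    (Finset.sum_nonneg fun i _ => hC0 i))
  exact Finset.single_le_sum (f := C) (fun i _ => hC0 i) hi

theorem exists_bound_ofChart {e : OpenPartialHomeomorph X E} (he : e ∈ atlas E X) {K : Set E}
    (hK : IsCompact K) (hKe : K ⊆ e.target) (k : ℕ) :
    ∃ C : ℝ, 0 ≤ C ∧ ∀ (g : E → E [⋀^Fin k]→L[ℝ] ℂ) (M : ℝ) (u : ContForm E X k),
      (∀ y ∉ K, g y = 0) → 0 ≤ M → (∀ y ∈ K, ‖g y‖ ≤ M) → u.1 = ofChart e g →
        ‖D.lift u‖ ≤ C * M := by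
  choose C hC0 hC using fun i : X => exists_transition_bound (chart_mem_atlas E i) he
    (D.isCompact_disc i) hK (D.disc_subset i) hKe k
  have hs0 : 0 ≤ ∑ i ∈ D.points, C i := Finset.sum_nonneg fun i _ => hC0 i
  refine ⟨∑ i ∈ D.points, C i, hs0, fun g M u hg hM hgM hu => ?_⟩
  refine D.norm_lift_le (mul_nonneg hs0 hM) fun i hi y hy => ?_
  by_cases h : (chartAt E i).symm y ∈ e.symm '' K
  · obtain ⟨y', hy', h'⟩ := h
    have h1 := hC i u.1 y hy y' hy' h'.symm
    have h2 : inChart u.1 e y' = g y' := by rw [hu, inChart_ofChart he g (hKe hy')]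
    rw [h2] at h1
    exact h1.trans (mul_le_mul (Finset.single_le_sum (f := C) (fun i _ => hC0 i) hi) (hgM y' hy')
      (norm_nonneg _) hs0)
  · have h1 : inChart u.1 (chartAt E i) y = 0 := by
      have h2 : u.1 ((chartAt E i).symm y) = 0 := by
        rw [hu]
        exact ofChart_eq_zero fun hs => hg _ fun hk => h ((mem_symm_image hKe).mpr ⟨hs, hk⟩)
      ext v
      rw [inChart_apply, h2]
      rfl
    rw [h1, norm_zero]
    exact mul_nonneg hs0 hM

end DiscCover

end Covers

/-! ### Estimates for averages and for products with differentials of cutoff functions. -/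

section Bilinear

variable {Z A V W : Type*} [NormedAddCommGroup Z] [NormedSpace ℝ Z] [NormedAddCommGroup A]
  [NormedSpace ℝ A] [NormedAddCommGroup V] [NormedSpace ℝ V] [NormedAddCommGroup W]
  [NormedSpace ℝ W]

theorem contDiffAt_bilinear (B : A →L[ℝ] V →L[ℝ] W) {n : WithTop ℕ∞} {a : Z → A} {v : Z → V}
    {z : Z} (ha : ContDiffAt ℝ n a z) (hv : ContDiffAt ℝ n v z) :
    ContDiffAt ℝ n (fun x => B (a x) (v x)) z :=
  (ContDiffAt.comp z (g := B) B.contDiff.contDiffAt ha).clm_apply hv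

theorem exists_norm_bilinear_le (B : A →L[ℝ] V →L[ℝ] W) :
    ∃ C : ℝ, 0 ≤ C ∧ ∀ a v, ‖B a v‖ ≤ C * ‖a‖ * ‖v‖ :=
  ⟨‖B‖, B.opNorm_nonneg, B.le_opNorm₂⟩

end Bilinear

section Averages

open MeasureTheory

variable {P : Type*} [TopologicalSpace P] [MeasurableSpace P] [OpensMeasurableSpace P]
  [SecondCountableTopology P] {μ : Measure P} [IsLocallyFiniteMeasure μ] {s : Set P}
  {E : Type*} [NormedAddCommGroup E] [NormedSpace ℝ E] [FiniteDimensional ℝ E] {z : P → E}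
  {V W : Type*} [NormedAddCommGroup V] [NormedSpace ℝ V] [NormedAddCommGroup W] [NormedSpace ℝ W]
  {L : P → V →L[ℝ] W}

theorem avg_add (hs : IsCompact s) (hsm : MeasurableSet s) (hz : Continuous z) (hL : Continuous L)
    {f g : E → V} (hf : Continuous f) (hg : Continuous g) :
    avg μ s z L (f + g) = avg μ s z L f + avg μ s z L g := by
  have hi : ∀ {f : E → V}, Continuous f → ∀ y, IntegrableOn (fun p => L p (f (y + z p))) s μ :=
    fun hf y => (hL.clm_apply (hf.comp (by fun_prop))).continuousOn.integrableOn_compact' hs hsm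
  ext1 y
  rw [Pi.add_apply, avg, avg, avg, ← integral_add (hi hf y) (hi hg y)]
  simp only [Pi.add_apply, map_add]

theorem avg_smul (c : ℝ) (f : E → V) : avg μ s z L (c • f) = c • avg μ s z L f := by
  ext1 y
  rw [Pi.smul_apply, avg, avg, ← integral_smul]
  simp only [Pi.smul_apply, map_smul]

theorem exists_norm_avg_le (μ : Measure P) [IsLocallyFiniteMeasure μ] (z : P → E)
    (hs : IsCompact s) (hL : Continuous L) :
    ∃ C : ℝ, 0 ≤ C ∧ ∀ (f : E → V) (M : ℝ), (∀ y, ‖f y‖ ≤ M) → ∀ y, ‖avg μ s z L f y‖ ≤ C * M := by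
  obtain ⟨B, hB⟩ := hs.bddAbove_image hL.norm.continuousOn
  refine ⟨max B 0 * μ.real s, by positivity, fun f M hM y => ?_⟩
  have := norm_avg_le (μ := μ) (z := z) (f := f) (y := y) (C := M) hs
    (le_max_right B 0) (fun p hp => (hB ⟨p, hp, rfl⟩).trans (le_max_left _ _)) (fun _ _ => hM _)
  exact this.trans_eq (by ring)

end Averages

section Regularization

open MeasureTheory ContinuousAlternatingMap

variable {E : Type*} [NormedAddCommGroup E] [NormedSpace ℂ E] [FiniteDimensional ℂ E]
  [MeasurableSpace E] [BorelSpace E] {k : ℕ} (φ : ContDiffBump (0 : E))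

theorem mollify_add {f g : E → E [⋀^Fin k]→L[ℝ] ℂ} (hf : Continuous f) (hg : Continuous g) :
    mollify φ (f + g) = mollify φ f + mollify φ g :=
  have : ProperSpace E := FiniteDimensional.proper ℂ E
  avg_add (isCompact_closedBall _ _) measurableSet_closedBall continuous_id
    (continuous_mollify_weight φ) hf hg

theorem homOp_add {f g : E → E [⋀^Fin (k + 1)]→L[ℝ] ℂ} (hf : Continuous f) (hg : Continuous g) :
    homOp φ (f + g) = homOp φ f + homOp φ g :=
  avg_add (isCompact_paramSet φ) (measurableSet_paramSet φ) (by fun_prop)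
    (continuous_homOp_weight φ) hf hg

theorem mollify_smul (c : ℝ) (f : E → E [⋀^Fin k]→L[ℝ] ℂ) :
    mollify φ (c • f) = c • mollify φ f := avg_smul c f

theorem homOp_smul (c : ℝ) (f : E → E [⋀^Fin (k + 1)]→L[ℝ] ℂ) :
    homOp φ (c • f) = c • homOp φ f := avg_smul c f

theorem exists_norm_mollify_le (k : ℕ) :
    ∃ C : ℝ, 0 ≤ C ∧ ∀ (f : E → E [⋀^Fin k]→L[ℝ] ℂ) (M : ℝ), (∀ y, ‖f y‖ ≤ M) →
      ∀ y, ‖mollify φ f y‖ ≤ C * M := by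
  have : ProperSpace E := FiniteDimensional.proper ℂ E
  exact exists_norm_avg_le _ _ (isCompact_closedBall _ _) (continuous_mollify_weight φ)

theorem exists_norm_homOp_le (k : ℕ) :
    ∃ C : ℝ, 0 ≤ C ∧ ∀ (f : E → E [⋀^Fin (k + 1)]→L[ℝ] ℂ) (M : ℝ), (∀ y, ‖f y‖ ≤ M) →
      ∀ y, ‖homOp φ f y‖ ≤ C * M := by
  exact exists_norm_avg_le _ _ (isCompact_paramSet φ) (continuous_homOp_weight φ)

/-- The exterior product of the differential of a function with a form. -/
def dWedge (χ : E → ℝ) (g : E → E [⋀^Fin k]→L[ℝ] ℂ) (y : E) : E [⋀^Fin (k + 1)]→L[ℝ] ℂ :=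
  alternatizeUncurryFin ((fderiv ℝ χ y).smulRight (g y))

/-- Exterior multiplication by a real covector. -/
def covectorWedge (k : ℕ) : (E →L[ℝ] ℝ) →L[ℝ] (E [⋀^Fin k]→L[ℝ] ℂ) →L[ℝ]
    (E [⋀^Fin (k + 1)]→L[ℝ] ℂ) :=
  (ContinuousLinearMap.compL ℝ (E [⋀^Fin k]→L[ℝ] ℂ) (E →L[ℝ] E [⋀^Fin k]→L[ℝ] ℂ)
    (E [⋀^Fin (k + 1)]→L[ℝ] ℂ) (alternatizeUncurryFinCLM ℝ E ℂ)).comp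
    (ContinuousLinearMap.smulRightL ℝ E (E [⋀^Fin k]→L[ℝ] ℂ))

theorem dWedge_eq (χ : E → ℝ) (g : E → E [⋀^Fin k]→L[ℝ] ℂ) (y : E) :
    dWedge χ g y = covectorWedge k (fderiv ℝ χ y) (g y) := rfl

theorem dWedge_eq_zero {χ : E → ℝ} {g : E → E [⋀^Fin k]→L[ℝ] ℂ} {y : E}
    (h : fderiv ℝ χ y = 0) : dWedge χ g y = 0 := by
  have h1 : covectorWedge (E := E) k 0 = 0 := _root_.map_zero _
  rw [dWedge_eq, h, h1]
  rfl

theorem contDiffAt_dWedge {n : WithTop ℕ∞} {χ : E → ℝ} {g : E → E [⋀^Fin k]→L[ℝ] ℂ} {y : E}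
    (hχ : ContDiffAt ℝ n (fderiv ℝ χ) y) (hg : ContDiffAt ℝ n g y) :
    ContDiffAt ℝ n (dWedge χ g) y :=
  contDiffAt_bilinear (covectorWedge k) hχ hg

theorem exists_norm_dWedge_le (k : ℕ) : ∃ C : ℝ, 0 ≤ C ∧ ∀ (χ : E → ℝ)
    (g : E → E [⋀^Fin k]→L[ℝ] ℂ) (y : E), ‖dWedge χ g y‖ ≤ C * ‖fderiv ℝ χ y‖ * ‖g y‖ := by
  obtain ⟨C, hC0, hC⟩ := exists_norm_bilinear_le (covectorWedge (E := E) k)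
  exact ⟨C, hC0, fun χ g y => hC _ _⟩

theorem extDeriv_smul_fun {χ : E → ℝ} {g : E → E [⋀^Fin k]→L[ℝ] ℂ} {y : E}
    (hχ : DifferentiableAt ℝ χ y) (hg : DifferentiableAt ℝ g y) :
    extDeriv (fun z => χ z • g z) y = χ y • extDeriv g y + dWedge χ g y := by
  simp only [extDeriv, dWedge]
  have h : fderiv ℝ (fun z => χ z • g z) y =
      χ y • fderiv ℝ g y + (fderiv ℝ χ y).smulRight (g y) := (hχ.hasFDerivAt.smul hg.hasFDerivAt).fderiv
  rw [h, alternatizeUncurryFin_add, alternatizeUncurryFin_smul]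

end Regularization

/-! ### Smoothing in one coordinate ball, globally homotopic to the identity. -/

section DiscRegularization

open MeasureTheory ContinuousAlternatingMap

variable {E : Type*} [NormedAddCommGroup E] [NormedSpace ℂ E] [FiniteDimensional ℂ E]
  [MeasurableSpace E] [BorelSpace E]
  {X : Type*} [TopologicalSpace X] [ChartedSpace E X] [IsManifold 𝓘(ℂ, E) ω X] {k : ℕ}

namespace DiscCover

variable (D : DiscCover E X) (i : X) (φ : ContDiffBump (0 : E))

/-- A cutoff function that is `1` on the ball of radius `r` and has its support in the ball of
radius `2 r`. -/
def innerBump : ContDiffBump (chartAt E i i) :=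
  ⟨D.radius i, 2 * D.radius i, D.radius_pos i, by linarith [D.radius_pos i]⟩

/-- A cutoff function that is `1` on the ball of radius `3 r` and has its support in the ball of
radius `4 r`. -/
def outerBump : ContDiffBump (chartAt E i i) :=
  ⟨3 * D.radius i, 4 * D.radius i, by linarith [D.radius_pos i], by linarith [D.radius_pos i]⟩

/-- The ball that contains the support of the inner cutoff function. -/
def midBall : Set E := Metric.closedBall (chartAt E i i) (2 * D.radius i)

/-- The ball that contains the support of the outer cutoff function. -/
def outerBall : Set E := Metric.closedBall (chartAt E i i) (4 * D.radius i)

theorem isCompact_midBall : IsCompact (D.midBall i) :=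
  have : ProperSpace E := FiniteDimensional.proper ℂ E
  isCompact_closedBall _ _

theorem isCompact_outerBall : IsCompact (D.outerBall i) :=
  have : ProperSpace E := FiniteDimensional.proper ℂ E
  isCompact_closedBall _ _

theorem midBall_subset : D.midBall i ⊆ (chartAt E i).target :=
  (Metric.closedBall_subset_closedBall (by linarith [D.radius_pos i])).trans (D.subset_target i)

theorem outerBall_subset : D.outerBall i ⊆ (chartAt E i).target := D.subset_target i

theorem innerBump_eq_zero {y : E} (hy : y ∉ D.midBall i) : D.innerBump i y = 0 :=
  (D.innerBump i).zero_of_le_dist (not_le.mp fun h => hy (Metric.mem_closedBall.mpr h)).le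

theorem outerBump_eq_zero {y : E} (hy : y ∉ D.outerBall i) : D.outerBump i y = 0 :=
  (D.outerBump i).zero_of_le_dist (not_le.mp fun h => hy (Metric.mem_closedBall.mpr h)).le

theorem fderiv_innerBump_eq_zero {y : E} (hy : y ∉ D.midBall i) :
    fderiv ℝ (D.innerBump i) y = 0 := by
  have h : (D.innerBump i : E → ℝ) =ᶠ[𝓝 y] fun _ => 0 := by
    filter_upwards [Metric.isClosed_closedBall.isOpen_compl.mem_nhds hy] with z hz
    exact D.innerBump_eq_zero i hz
  rw [h.fderiv_eq]
  exact fderiv_const_apply _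

/-- The expression of a form in a chart, cut off. -/
def cutForm (u : RoughForm E X k) (y : E) : E [⋀^Fin k]→L[ℝ] ℂ :=
  D.outerBump i y • inChart u (chartAt E i) y

variable {i} in
theorem contDiffAt_cutForm {n : WithTop ℕ∞} (hn : n ≤ ∞) {u : RoughForm E X k} {y : E}
    (h : y ∈ D.outerBall i → RegularAt n u ((chartAt E i).symm y)) :
    ContDiffAt ℝ n (D.cutForm i u) y := by
  by_cases hy : y ∈ D.outerBall i
  · have ht := D.outerBall_subset i hy
    have h1 := h hy _ (chart_mem_atlas E i) ((chartAt E i).map_target ht)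
    rw [(chartAt E i).right_inv ht] at h1
    have h2 : ContDiffAt ℝ n (D.outerBump i) y := (D.outerBump i).contDiffAt.of_le hn
    exact h2.smul h1
  · have h1 : D.cutForm i u =ᶠ[𝓝 y] fun _ => 0 := by
      filter_upwards [Metric.isClosed_closedBall.isOpen_compl.mem_nhds hy] with z hz
      rw [cutForm, D.outerBump_eq_zero i hz]
      exact zero_smul_form _
    exact contDiffAt_const.congr_of_eventuallyEq h1

theorem continuous_cutForm (u : ContForm E X k) : Continuous (D.cutForm i u.1) :=
  contDiff_zero.mp (contDiff_iff_contDiffAt.mpr fun y =>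
    D.contDiffAt_cutForm (by simp) fun _ => u.2 _)

theorem contDiff_cutForm {u : RoughForm E X k} (hu : IsSmooth u) : ContDiff ℝ ∞ (D.cutForm i u) :=
  contDiff_iff_contDiffAt.mpr fun _ => D.contDiffAt_cutForm le_rfl fun _ => isSmooth_iff.mp hu _

theorem cutForm_add (u v : RoughForm E X k) :
    D.cutForm i (u + v) = D.cutForm i u + D.cutForm i v := by
  ext1 y
  rw [Pi.add_apply, cutForm, cutForm, cutForm, inChart_add, Pi.add_apply]
  exact smul_add _ _ _

theorem cutForm_smul (c : ℝ) (u : RoughForm E X k) :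
    D.cutForm i (c • u) = c • D.cutForm i u := by
  ext y v
  exact smul_comm (D.outerBump i y) c (inChart u (chartAt E i) y v)

/-- The local modification of a form. -/
def locOp (f : E → E [⋀^Fin (k + 1)]→L[ℝ] ℂ) (y : E) : E [⋀^Fin (k + 1)]→L[ℝ] ℂ :=
  D.innerBump i y • (mollify φ f y - f y) + dWedge (D.innerBump i) (homOp φ f) y

/-- The localized homotopy operator. -/
def locHom (f : E → E [⋀^Fin (k + 1)]→L[ℝ] ℂ) (y : E) : E [⋀^Fin k]→L[ℝ] ℂ :=
  D.innerBump i y • homOp φ f y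

theorem locOp_eq_zero (f : E → E [⋀^Fin (k + 1)]→L[ℝ] ℂ) {y : E} (hy : y ∉ D.midBall i) :
    D.locOp i φ f y = 0 := by
  rw [locOp, dWedge_eq_zero (D.fderiv_innerBump_eq_zero i hy), D.innerBump_eq_zero i hy]
  exact (add_zero _).trans (zero_smul_form _)

theorem locHom_eq_zero (f : E → E [⋀^Fin (k + 1)]→L[ℝ] ℂ) {y : E} (hy : y ∉ D.midBall i) :
    D.locHom i φ f y = 0 := by
  rw [locHom, D.innerBump_eq_zero i hy]
  exact zero_smul_form _

theorem contDiff_fderiv_innerBump : ContDiff ℝ ∞ (fderiv ℝ (D.innerBump i)) :=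
  ((D.innerBump i).contDiff (n := ⊤)).fderiv_right (by simp)

theorem contDiffAt_locOp {n : WithTop ℕ∞} (hn : n ≤ ∞) {f : E → E [⋀^Fin (k + 1)]→L[ℝ] ℂ} {y : E}
    (hf : Continuous f) (hy : ContDiffAt ℝ n f y) (hh : ContDiffAt ℝ n (homOp φ f) y) :
    ContDiffAt ℝ n (D.locOp i φ f) y := by
  have h1 : ContDiffAt ℝ n (D.innerBump i) y := (D.innerBump i).contDiffAt.of_le hn
  have h2 : ContDiffAt ℝ n (fderiv ℝ (D.innerBump i)) y :=
    (D.contDiff_fderiv_innerBump i).contDiffAt.of_le hn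
  have h3 : ContDiffAt ℝ n (mollify φ f) y := (contDiff_mollify φ hf).contDiffAt.of_le hn
  exact (h1.smul (h3.sub hy)).add (contDiffAt_dWedge h2 hh)

theorem contDiffAt_locHom {n : WithTop ℕ∞} (hn : n ≤ ∞) {f : E → E [⋀^Fin (k + 1)]→L[ℝ] ℂ} {y : E}
    (hh : ContDiffAt ℝ n (homOp φ f) y) :
    ContDiffAt ℝ n (D.locHom i φ f) y := by
  have h1 : ContDiffAt ℝ n (D.innerBump i) y := (D.innerBump i).contDiffAt.of_le hn
  exact h1.smul hh

theorem locOp_add {f g : E → E [⋀^Fin (k + 1)]→L[ℝ] ℂ} (hf : Continuous f) (hg : Continuous g) :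
    D.locOp i φ (f + g) = D.locOp i φ f + D.locOp i φ g := by
  ext1 y
  simp only [locOp, dWedge_eq, mollify_add φ hf hg, homOp_add φ hf hg, Pi.add_apply, map_add]
  ext v
  simp
  ring

theorem locOp_smul (c : ℝ) (f : E → E [⋀^Fin (k + 1)]→L[ℝ] ℂ) :
    D.locOp i φ (c • f) = c • D.locOp i φ f := by
  ext1 y
  simp only [locOp, dWedge_eq, mollify_smul, homOp_smul, Pi.smul_apply, map_smul]
  ext v
  simp
  ring

variable [T2Space X]

/-- The modification of a continuous form in a disc. -/
def regOp : ContForm E X (k + 1) →ₗ[ℝ] ContForm E X (k + 1) where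
  toFun u := ⟨u.1 + ofChart (chartAt E i) (D.locOp i φ (D.cutForm i u.1)), fun x => by
    refine (u.2 x).add (regularAt_ofChart (chart_mem_atlas E i) (D.isCompact_midBall i)
      (D.midBall_subset i) (fun y hy => D.locOp_eq_zero i φ _ hy) fun _ => ?_)
    have hc := D.continuous_cutForm i u
    exact D.contDiffAt_locOp i φ (by simp) hc (contDiff_zero.mpr hc).contDiffAt
      (contDiff_zero.mpr (continuous_homOp φ hc)).contDiffAt⟩
  map_add' u v := by
    ext1
    simp only [Submodule.coe_add, cutForm_add,
      D.locOp_add i φ (D.continuous_cutForm i u) (D.continuous_cutForm i v), ofChart_add]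
    abel
  map_smul' c u := by
    ext1
    simp only [Submodule.coe_smul, cutForm_smul, locOp_smul, ofChart_smul, RingHom.id_apply]
    ext x v
    simp

/-- The homotopy operator for `regOp`. -/
def homForm (u : RoughForm E X (k + 1)) : RoughForm E X k :=
  ofChart (chartAt E i) (D.locHom i φ (D.cutForm i u))

/-- For smooth `u` the correction is `d(χ h u) + χ h(du)`, with `h` the local homotopy and `χ` the
inner cutoff. Written as in `locOp`, it involves no derivative of `u` and so acts on continuous
forms. -/
theorem regOp_coe (u : ContForm E X (k + 1)) :
    (D.regOp i φ u).1 = u.1 + ofChart (chartAt E i) (D.locOp i φ (D.cutForm i u.1)) := rfl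

theorem isSmooth_ofChart_locOp {u : RoughForm E X (k + 1)} (hu : IsSmooth u) :
    IsSmooth (ofChart (chartAt E i) (D.locOp i φ (D.cutForm i u))) := by
  refine isSmooth_iff.mpr fun x => regularAt_ofChart (chart_mem_atlas E i) (D.isCompact_midBall i)
    (D.midBall_subset i) (fun y hy => D.locOp_eq_zero i φ _ hy) fun _ => ?_
  have hc := D.contDiff_cutForm i hu
  exact D.contDiffAt_locOp i φ le_rfl hc.continuous hc.contDiffAt
    (contDiff_homOp φ hc).contDiffAt

theorem isSmooth_regOp {u : ContForm E X (k + 1)} (hu : IsSmooth u.1) :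
    IsSmooth (D.regOp i φ u).1 :=
  (smoothForms E X (k + 1)).add_mem hu (D.isSmooth_ofChart_locOp i φ hu)

theorem isSmooth_homForm {u : RoughForm E X (k + 1)} (hu : IsSmooth u) :
    IsSmooth (D.homForm i φ u) := by
  refine isSmooth_iff.mpr fun x => regularAt_ofChart (chart_mem_atlas E i) (D.isCompact_midBall i)
    (D.midBall_subset i) (fun y hy => D.locHom_eq_zero i φ _ hy) fun _ => ?_
  exact D.contDiffAt_locHom i φ le_rfl (contDiff_homOp φ (D.contDiff_cutForm i hu)).contDiffAt

theorem extDeriv_cutForm {u : RoughForm E X k} (hu : IsSmooth u) {w : E}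
    (hw : w ∈ Metric.ball (chartAt E i i) (3 * D.radius i)) :
    extDeriv (D.cutForm i u) w = D.cutForm i (extD u) w := by
  have h1 : ∀ z ∈ Metric.ball (chartAt E i i) (3 * D.radius i), D.outerBump i z = 1 := fun z hz =>
    (D.outerBump i).one_of_mem_closedBall (Metric.ball_subset_closedBall hz)
  have hwt : w ∈ (chartAt E i).target :=
    D.outerBall_subset i ((Metric.ball_subset_closedBall.trans
      (Metric.closedBall_subset_closedBall (by linarith [D.radius_pos i]))) hw)
  have h2 : D.cutForm i u =ᶠ[𝓝 w] inChart u (chartAt E i) := by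
    filter_upwards [Metric.isOpen_ball.mem_nhds hw] with z hz
    rw [cutForm, h1 z hz]
    exact one_smul ℝ _
  rw [h2.extDeriv_eq, cutForm, h1 w hw, inChart_extD hu (chart_mem_atlas E i) hwt]
  exact (one_smul ℝ _).symm

variable {φ} in
/-- The homotopy formula for `regOp`. -/
theorem regOp_eq (hφ : φ.rOut < D.radius i) {u : ContForm E X (k + 1)} (hu : IsSmooth u.1) :
    (D.regOp i φ u).1 = u.1 + (extD (D.homForm i φ u.1) + D.homForm i φ (extD u.1)) := by
  rw [regOp_coe]
  congr 1
  have hc := D.contDiff_cutForm i hu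
  rw [homForm, extD_ofChart (chart_mem_atlas E i) (D.isCompact_midBall i) (D.midBall_subset i)
    (fun y hy => D.locHom_eq_zero i φ _ hy) (D.isSmooth_homForm i φ hu), homForm, ← ofChart_add]
  congr 1
  ext1 y
  have hh : DifferentiableAt ℝ (homOp φ (D.cutForm i u.1)) y :=
    (contDiff_homOp φ hc).contDiffAt.differentiableAt (by simp)
  have hb : DifferentiableAt ℝ (D.innerBump i) y :=
    ((D.innerBump i).contDiffAt (n := 1)).differentiableAt (by simp)
  -- The derivative of the cutoff produces the second term of `locOp`.
  have h1 : extDeriv (D.locHom i φ (D.cutForm i u.1)) y =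
      D.innerBump i y • extDeriv (homOp φ (D.cutForm i u.1)) y +
        dWedge (D.innerBump i) (homOp φ (D.cutForm i u.1)) y := extDeriv_smul_fun hb hh
  -- On the support of the inner cutoff, within radius `2r`, the homotopy uses points within `2r +
  -- rOut < 3r`, where the outer cutoff is `1` and commutes with `d`.
  have h2 : D.locHom i φ (D.cutForm i (extD u.1)) y =
      D.innerBump i y • homOp φ (extDeriv (D.cutForm i u.1)) y := by
    by_cases hy : y ∈ D.midBall i
    · rw [locHom, homOp_congr φ fun w hw => ?_]
      refine (D.extDeriv_cutForm i hu ?_).symm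
      rw [Metric.mem_ball]
      have h3 := Metric.mem_closedBall.mp hw
      have h4 := Metric.mem_closedBall.mp hy
      linarith [dist_triangle w y (chartAt E i i)]
    · rw [D.locHom_eq_zero i φ _ hy, D.innerBump_eq_zero i hy]
      exact (zero_smul_form _).symm
  rw [Pi.add_apply, h1, h2, locOp, mollify_sub_self φ (hc.of_le (by simp)) y]
  ext v
  simp
  ring

theorem homForm_zero : D.homForm i φ (0 : RoughForm E X (k + 1)) = 0 := by
  have h1 : D.cutForm i (0 : RoughForm E X (k + 1)) = (0 : ℝ) • 0 := by
    ext y v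
    simp [cutForm, inChart_zero]
  ext1 x
  refine ofChart_eq_zero fun _ => ?_
  rw [locHom, h1, homOp_smul]
  ext v
  simp

-- Apply `d` to the homotopy formula for `u`, and compare it with the formula for `du`: both are `du
-- + d(h du)`, where `h` denotes `homForm`.
variable {φ} in
theorem extD_regOp (hφ : φ.rOut < D.radius i) {u : ContForm E X (k + 1)} (hu : IsSmooth u.1) :
    extD (D.regOp i φ u).1 = (D.regOp i φ ⟨extD u.1, (isSmooth_extD hu).mem_contForm⟩).1 := by
  have h1 := isSmooth_extD hu
  have h2 := D.isSmooth_homForm i φ hu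
  have h3 := D.isSmooth_homForm i φ h1
  rw [D.regOp_eq i hφ hu, D.regOp_eq i hφ (u := ⟨extD u.1, _⟩) h1,
    extD_add hu ((smoothForms E X _).add_mem (isSmooth_extD h2) h3),
    extD_add (isSmooth_extD h2) h3, extD_extD h2, extD_extD hu, homForm_zero]
  abel

theorem exists_bound_cutForm (k : ℕ) : ∃ C : ℝ, 0 ≤ C ∧ ∀ (u : ContForm E X k) (y : E),
    ‖D.cutForm i u.1 y‖ ≤ C * ‖D.lift u‖ := by
  obtain ⟨C, hC0, hC⟩ := D.exists_bound_inChart (chart_mem_atlas E i) (D.isCompact_outerBall i)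
    (D.outerBall_subset i) k
  refine ⟨C, hC0, fun u y => ?_⟩
  by_cases hy : y ∈ D.outerBall i
  · refine (norm_smul_le _ _).trans ((mul_le_of_le_one_left (norm_nonneg _) ?_).trans (hC u y hy))
    rw [Real.norm_of_nonneg (D.outerBump i).nonneg]
    exact (D.outerBump i).le_one
  · rw [cutForm, D.outerBump_eq_zero i hy]
    have := zero_smul_form (inChart u.1 (chartAt E i) y)
    rw [this, norm_zero]
    positivity

theorem exists_bound_homForm (k : ℕ) : ∃ C : ℝ, 0 ≤ C ∧ ∀ (v : ContForm E X (k + 1))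
    (w : ContForm E X k), w.1 = D.homForm i φ v.1 → ‖D.lift w‖ ≤ C * ‖D.lift v‖ := by
  obtain ⟨C₁, hC₁0, hC₁⟩ := D.exists_bound_cutForm i (k + 1)
  obtain ⟨C₂, hC₂0, hC₂⟩ := exists_norm_homOp_le φ k
  obtain ⟨C₃, hC₃0, hC₃⟩ := D.exists_bound_ofChart (chart_mem_atlas E i) (D.isCompact_midBall i)
    (D.midBall_subset i) k
  refine ⟨C₃ * (C₂ * C₁), by positivity, fun v w hw => ?_⟩
  have h := hC₃ _ (C₂ * (C₁ * ‖D.lift v‖)) w (fun y hy => D.locHom_eq_zero i φ _ hy) (by positivity)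
    (fun y _ => ?_) hw
  · exact h.trans_eq (by ring)
  · refine (norm_smul_le _ _).trans ((mul_le_of_le_one_left (norm_nonneg _) ?_).trans
      (hC₂ _ _ (hC₁ v) y))
    rw [Real.norm_of_nonneg (D.innerBump i).nonneg]
    exact (D.innerBump i).le_one

/-- The correction contains no derivative of the form, so the operator is bounded in the sup norm.
-/
theorem exists_bound_regOp (k : ℕ) : ∃ C : ℝ, 0 ≤ C ∧ ∀ u : ContForm E X (k + 1),
    ‖D.lift (D.regOp i φ u)‖ ≤ C * ‖D.lift u‖ := by
  obtain ⟨C₁, hC₁0, hC₁⟩ := D.exists_bound_cutForm i (k + 1)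
  obtain ⟨C₂, hC₂0, hC₂⟩ := exists_norm_homOp_le φ k
  obtain ⟨C₃, hC₃0, hC₃⟩ := D.exists_bound_ofChart (chart_mem_atlas E i) (D.isCompact_midBall i)
    (D.midBall_subset i) (k + 1)
  obtain ⟨C₄, hC₄0, hC₄⟩ := exists_norm_mollify_le φ (k + 1)
  obtain ⟨C₆, hC₆0, hC₆⟩ := exists_norm_dWedge_le (E := E) k
  have hcont : Continuous fun y => C₆ * ‖fderiv ℝ (D.innerBump i) y‖ :=
    continuous_const.mul (D.contDiff_fderiv_innerBump i).continuous.norm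
  obtain ⟨C₅, hC₅⟩ := (D.isCompact_midBall i).bddAbove_image hcont.continuousOn
  have hC₅' : ∀ y ∈ D.midBall i, C₆ * ‖fderiv ℝ (D.innerBump i) y‖ ≤ max C₅ 0 :=
    fun y hy => (hC₅ ⟨y, hy, rfl⟩).trans (le_max_left _ _)
  have h5 : 0 ≤ max C₅ 0 := le_max_right _ _
  refine ⟨1 + C₃ * (C₄ * C₁ + C₁ + max C₅ 0 * (C₂ * C₁)), by positivity, fun u => ?_⟩
  have hd : (D.regOp i φ u - u).1 = ofChart (chartAt E i) (D.locOp i φ (D.cutForm i u.1)) := by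
    rw [Submodule.coe_sub, regOp_coe, add_sub_cancel_left]
  have h := hC₃ _ ((C₄ * C₁ + C₁ + max C₅ 0 * (C₂ * C₁)) * ‖D.lift u‖) (D.regOp i φ u - u)
    (fun y hy => D.locOp_eq_zero i φ _ hy) (by positivity) (fun y hy => ?_) hd
  · have h6 : D.lift (D.regOp i φ u) = D.lift u + D.lift (D.regOp i φ u - u) := by
      rw [← map_add]
      exact congrArg D.lift (add_sub_cancel u (D.regOp i φ u)).symm
    rw [h6]
    refine (norm_add_le _ _).trans ?_
    linarith
  · have h7 : ‖D.innerBump i y • (mollify φ (D.cutForm i u.1) y - D.cutForm i u.1 y)‖ ≤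
        C₄ * (C₁ * ‖D.lift u‖) + C₁ * ‖D.lift u‖ := by
      refine (norm_smul_le _ _).trans ((mul_le_of_le_one_left (norm_nonneg _) ?_).trans
        ((norm_sub_le _ _).trans (add_le_add (hC₄ _ _ (hC₁ u) y) (hC₁ u y))))
      rw [Real.norm_of_nonneg (D.innerBump i).nonneg]
      exact (D.innerBump i).le_one
    have h8 : ‖dWedge (D.innerBump i) (homOp φ (D.cutForm i u.1)) y‖ ≤
        max C₅ 0 * (C₂ * (C₁ * ‖D.lift u‖)) :=
      (hC₆ _ _ _).trans
        (mul_le_mul (hC₅' y hy) (hC₂ _ _ (hC₁ u) y) (norm_nonneg _) h5)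
    refine (norm_add_le _ _).trans ((add_le_add h7 h8).trans_eq (by ring))

/-- Where the inner cutoff is identically `1`, the operator replaces `u` by its convolution, which
is smooth even if `u` is only continuous. -/
theorem regularAt_regOp_of_mem (u : ContForm E X (k + 1)) {x : X} (hx : x ∈ (chartAt E i).source)
    (hxb : chartAt E i x ∈ Metric.ball (chartAt E i i) (D.radius i)) :
    RegularAt ∞ (D.regOp i φ u).1 x := by
  refine regularAt_of_chart (chart_mem_atlas E i) hx
    ((contDiff_mollify φ (D.continuous_cutForm i u)).contDiffAt.congr_of_eventuallyEq ?_)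
  filter_upwards [Metric.isOpen_ball.mem_nhds hxb] with y hy
  have hy' := Metric.ball_subset_closedBall hy
  have ht : y ∈ (chartAt E i).target := D.disc_subset i hy'
  have h1 : (D.innerBump i : E → ℝ) =ᶠ[𝓝 y] fun _ => 1 := by
    filter_upwards [Metric.isOpen_ball.mem_nhds hy] with z hz
    exact (D.innerBump i).one_of_mem_closedBall (Metric.ball_subset_closedBall hz)
  have h2 : fderiv ℝ (D.innerBump i) y = 0 := by
    rw [h1.fderiv_eq]
    exact fderiv_const_apply _
  have h3 : D.cutForm i u.1 y = inChart u.1 (chartAt E i) y := by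
    rw [cutForm, (D.outerBump i).one_of_mem_closedBall]
    · exact one_smul ℝ _
    · refine Metric.closedBall_subset_closedBall ?_ hy'
      change D.radius i ≤ 3 * D.radius i
      linarith [D.radius_pos i]
  rw [regOp_coe, inChart_add, Pi.add_apply, inChart_ofChart (chart_mem_atlas E i) _ ht, locOp,
    dWedge_eq_zero h2, h1.eq_of_nhds, h3]
  ext v
  simp

-- Smoothness already gained is kept: at a point of the supporting ball the correction depends only
-- on `u` at distance less than `δ`.
variable {φ} in
theorem regularAt_regOp {δ : ℝ} (hδ : φ.rOut < δ)
    (u : ContForm E X (k + 1)) {x : X} (hx : RegularAt ∞ u.1 x)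
    (h : x ∈ (chartAt E i).source → chartAt E i x ∈ D.midBall i →
      ∀ w ∈ Metric.ball (chartAt E i x) δ, RegularAt ∞ u.1 ((chartAt E i).symm w)) :
    RegularAt ∞ (D.regOp i φ u).1 x := by
  rw [regOp_coe]
  refine hx.add ?_
  by_cases hs : x ∈ (chartAt E i).source
  · refine regularAt_ofChart (chart_mem_atlas E i) (D.isCompact_midBall i) (D.midBall_subset i)
      (fun y hy => D.locOp_eq_zero i φ _ hy) fun hm => ?_
    have hc : ∀ w ∈ Metric.ball (chartAt E i x) δ, ContDiffAt ℝ ∞ (D.cutForm i u.1) w :=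
      fun w hw => D.contDiffAt_cutForm le_rfl fun _ => h hs hm w hw
    exact D.contDiffAt_locOp i φ le_rfl (D.continuous_cutForm i u)
      (hc _ (Metric.mem_ball_self (φ.rOut_pos.trans hδ))) (contDiffAt_homOp φ hδ hc)
  · refine (RegularAt.zero x).congr ?_
    have : x ∈ ((chartAt E i).symm '' D.midBall i)ᶜ :=
      fun h => hs ((mem_symm_image (D.midBall_subset i)).mp h).1
    filter_upwards [(isClosed_symm_image (D.isCompact_midBall i)
      (D.midBall_subset i)).isOpen_compl.mem_nhds this] with z hz
    exact ofChart_eq_zero fun hs => D.locOp_eq_zero i φ _ fun h =>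
      hz ((mem_symm_image (D.midBall_subset i)).mpr ⟨hs, h⟩)

end DiscCover

end DiscRegularization

/-! ### Regularizing operators on the whole manifold. -/

section GlobalRegularization

open MeasureTheory ContinuousAlternatingMap

variable {E : Type*} [NormedAddCommGroup E] [NormedSpace ℂ E] [FiniteDimensional ℂ E]
  {X : Type*} [TopologicalSpace X] [ChartedSpace E X] [IsManifold 𝓘(ℂ, E) ω X] {k : ℕ}

/-- The exterior derivative of a smooth form, as a continuous form. -/
def dCont (u : ContForm E X k) (hu : IsSmooth u.1) : ContForm E X (k + 1) :=
  ⟨extD u.1, (isSmooth_extD hu).mem_contForm⟩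

namespace DiscCover

variable (D : DiscCover E X)

theorem lift_sub (u v : ContForm E X k) : D.lift (u - v) = D.lift u - D.lift v :=
  SupSpace.ext fun _ _ => rfl

/-- An operator on continuous forms that is homotopic to the identity and takes its values in the
forms that are smooth on `Ω`. -/
structure IsRegularizer (Ω : Set X) (R : ContForm E X k →ₗ[ℝ] ContForm E X k) : Prop where
  bound : ∃ C : ℝ, 0 ≤ C ∧ ∀ u, ‖D.lift (R u)‖ ≤ C * ‖D.lift u‖
  regular : ∀ u, ∀ x ∈ Ω, RegularAt ∞ (R u).1 x
  smooth : ∀ u : ContForm E X k, IsSmooth u.1 → IsSmooth (R u).1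
  deriv : ∃ C : ℝ, 0 ≤ C ∧ ∀ (u : ContForm E X k) (hu : IsSmooth u.1) (hR : IsSmooth (R u).1),
    ‖D.lift (dCont (R u) hR)‖ ≤ C * ‖D.lift (dCont u hu)‖
  homotopic : ∃ C : ℝ, 0 ≤ C ∧ ∀ (u : ContForm E X k) (hu : IsSmooth u.1), ∃ ζ : ContForm E X k,
    IsSmooth ζ.1 ∧ extD ζ.1 = 0 ∧ ‖D.lift (u - R u - ζ)‖ ≤ C * ‖D.lift (dCont u hu)‖

theorem isRegularizer_id :
    D.IsRegularizer ∅ (LinearMap.id : ContForm E X k →ₗ[ℝ] ContForm E X k) where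
  bound := ⟨1, zero_le_one, fun u => by simp⟩
  regular u x hx := hx.elim
  smooth u hu := hu
  deriv := ⟨1, zero_le_one, fun u hu _ => by simp⟩
  homotopic := ⟨0, le_rfl, fun u hu => ⟨0, (smoothForms E X k).zero_mem, extD_zero, by
    have : u - u - 0 = 0 := (sub_zero _).trans (sub_self u)
    rw [LinearMap.id_apply, this, _root_.map_zero, norm_zero, zero_mul]⟩⟩

variable [T2Space X]

section

variable [MeasurableSpace E] [BorelSpace E]

/-- The bounds multiply, since `regOp` commutes with `d` on smooth forms. Only the region of
smoothness has to be supplied. -/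
theorem IsRegularizer.regOp_comp {Ω Ω' : Set X}
    {R : ContForm E X (k + 1) →ₗ[ℝ] ContForm E X (k + 1)} (hR : D.IsRegularizer Ω R) (i : X)
    {φ : ContDiffBump (0 : E)} (hφ : φ.rOut < D.radius i)
    (hΩ : ∀ u, ∀ x ∈ Ω', RegularAt ∞ (D.regOp i φ (R u)).1 x) :
    D.IsRegularizer Ω' ((D.regOp i φ).comp R) := by
  obtain ⟨C₁, hC₁0, hC₁⟩ := hR.bound
  obtain ⟨C₂, hC₂0, hC₂⟩ := hR.deriv
  obtain ⟨C₃, hC₃0, hC₃⟩ := hR.homotopic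
  obtain ⟨B₁, hB₁0, hB₁⟩ := D.exists_bound_regOp i φ k
  obtain ⟨B₂, hB₂0, hB₂⟩ := D.exists_bound_regOp i φ (k + 1)
  obtain ⟨B₃, hB₃0, hB₃⟩ := D.exists_bound_homForm i φ (k + 1)
  refine ⟨⟨B₁ * C₁, by positivity, fun u => ?_⟩, hΩ, fun u hu => D.isSmooth_regOp i φ (hR.smooth u hu),
    ⟨B₂ * C₂, by positivity, fun u hu hRu => ?_⟩, ⟨C₃ + B₃ * C₂, by positivity, fun u hu => ?_⟩⟩
  · rw [mul_assoc]
    exact (hB₁ (R u)).trans (mul_le_mul_of_nonneg_left (hC₁ u) hB₁0)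
  · have hs := hR.smooth u hu
    have h1 : dCont (D.regOp i φ (R u)) hRu = D.regOp i φ (dCont (R u) hs) :=
      Subtype.ext (D.extD_regOp i hφ hs)
    have h2 : ‖D.lift (dCont (D.regOp i φ (R u)) hRu)‖ ≤ B₂ * ‖D.lift (dCont (R u) hs)‖ := by
      rw [h1]
      exact hB₂ _
    rw [mul_assoc]
    exact h2.trans (mul_le_mul_of_nonneg_left (hC₂ u hu hs) hB₂0)
  · have hs := hR.smooth u hu
    obtain ⟨ζ, hζ, hdζ, hζb⟩ := hC₃ u hu
    have hh := D.isSmooth_homForm i φ hs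
    have hh' := D.isSmooth_homForm i φ (isSmooth_extD hs)
    let w : ContForm E X (k + 1) := ⟨extD (D.homForm i φ (R u).1), (isSmooth_extD hh).mem_contForm⟩
    let w' : ContForm E X (k + 1) := ⟨D.homForm i φ (extD (R u).1), hh'.mem_contForm⟩
    have hw : D.regOp i φ (R u) = R u + (w + w') := Subtype.ext (D.regOp_eq i hφ hs)
    have hneg : extD (-w.1) = 0 := by
      rw [← neg_one_smul ℂ w.1, extD_smul _ (isSmooth_extD hh), extD_extD hh]
      ext x v
      simp
    have hnegs : IsSmooth (-w.1) := (smoothForms E X (k + 1)).neg_mem (isSmooth_extD hh)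
    -- In the homotopy formula for `R u`, the exact term `w` is absorbed in the closed form, and the
    -- remaining term `w'` is the homotopy applied to `d(R u)`, hence of the size of `du`.
    refine ⟨ζ + -w, (smoothForms E X (k + 1)).add_mem hζ hnegs, ?_, ?_⟩
    · refine (extD_add hζ hnegs).trans ?_
      rw [hdζ, hneg, add_zero]
    · have h1 : u - (D.regOp i φ ∘ₗ R) u - (ζ + -w) = (u - R u - ζ) - w' := by
        rw [LinearMap.comp_apply, hw]
        abel
      rw [h1, lift_sub]
      refine (norm_sub_le _ _).trans ?_
      have h2 := hB₃ (dCont (R u) hs) w' rfl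
      have h3 := mul_le_mul_of_nonneg_left (hC₂ u hu hs) hB₃0
      calc _ ≤ C₃ * ‖D.lift (dCont u hu)‖ + B₃ * (C₂ * ‖D.lift (dCont u hu)‖) :=
            add_le_add hζb (h2.trans h3)
        _ = _ := by ring

end

/-- The part of a disc that has to be covered. -/
def core (i : X) : Set X := (chartAt E i).symm '' Metric.closedBall (chartAt E i i) (D.radius i / 2)

theorem halfBall_subset (i : X) :
    Metric.closedBall (chartAt E i i) (D.radius i / 2) ⊆ (chartAt E i).target :=
  (Metric.closedBall_subset_closedBall (by linarith [D.radius_pos i])).trans (D.subset_target i)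

theorem isCompact_core (i : X) : IsCompact (D.core i) :=
  have : ProperSpace E := FiniteDimensional.proper ℂ E
  (isCompact_closedBall _ _).image_of_continuousOn
    ((chartAt E i).continuousOn_symm.mono (D.halfBall_subset i))

theorem exists_isRegularizer_finset (k : ℕ) (s : Finset X) :
    ∃ (Ω : Set X) (R : ContForm E X (k + 1) →ₗ[ℝ] ContForm E X (k + 1)),
      IsOpen Ω ∧ (⋃ i ∈ s, D.core i) ⊆ Ω ∧ D.IsRegularizer Ω R := by
  classical
  let _ : MeasurableSpace E := borel E
  have : BorelSpace E := ⟨rfl⟩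
  induction s using Finset.induction_on with
  | empty => exact ⟨∅, LinearMap.id, isOpen_empty, by simp, D.isRegularizer_id⟩
  | insert i s _ ih =>
    obtain ⟨Ω, R, hΩ, hsΩ, hR⟩ := ih
    set e := chartAt E i with he
    have hr := D.radius_pos i
    have hDs : IsClosed (⋃ j ∈ s, D.core j) :=
      (s.isCompact_biUnion fun j _ => D.isCompact_core j).isClosed
    -- Here smoothness gained in the previous discs could be lost to the new operation. The compact
    -- set `K` has a margin `δ₀` inside `Ω`.
    set K : Set E := D.midBall i ∩ e.symm ⁻¹' (⋃ j ∈ s, D.core j) with hKdef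
    have hK : IsCompact K := by
      refine (D.isCompact_midBall i).of_isClosed_subset ?_ Set.inter_subset_left
      exact (e.continuousOn_symm.mono (D.midBall_subset i)).preimage_isClosed_of_isClosed
        (D.isCompact_midBall i).isClosed hDs
    have hO : IsOpen (e.target ∩ e.symm ⁻¹' Ω) := e.symm.isOpen_inter_preimage hΩ
    have hKO : K ⊆ e.target ∩ e.symm ⁻¹' Ω := fun y hy => ⟨D.midBall_subset i hy.1, hsΩ hy.2⟩
    obtain ⟨δ₀, hδ₀, hδO⟩ := hK.exists_cthickening_subset_open hO hKO
    set δ : ℝ := min δ₀ (D.radius i) / 2 with hδdef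
    have hmin : 0 < min δ₀ (D.radius i) := lt_min hδ₀ hr
    have hδ : 0 < δ := by positivity
    have hδ₁ : 2 * δ ≤ δ₀ := by
      have := min_le_left δ₀ (D.radius i)
      linarith
    have hδ₂ : 2 * δ ≤ D.radius i := by
      have := min_le_right δ₀ (D.radius i)
      linarith
    let φ : ContDiffBump (0 : E) := ⟨δ / 4, δ / 2, by positivity, by linarith⟩
    have hφ : φ.rOut = δ / 2 := rfl
    -- Away from the new ball nothing changes; in the new disc the form becomes smooth; within `δ`
    -- of `K` the convolution uses points within `δ` more, and `2δ ≤ δ₀` keeps them in `Ω`.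
    let Ω₁ : Set X := Ω ∩ (e.symm '' D.midBall i)ᶜ
    let Ω₂ : Set X := e.source ∩ e ⁻¹' Metric.ball (e i) (D.radius i)
    let Ω₃ : Set X := Ω ∩ (e.source ∩ e ⁻¹' Metric.thickening δ K)
    refine ⟨Ω₁ ∪ Ω₂ ∪ Ω₃, (D.regOp i φ).comp R, ?_, ?_,
      hR.regOp_comp D i (by rw [hφ]; linarith) ?_⟩
    · refine ((hΩ.inter ?_).union ?_).union (hΩ.inter ?_)
      · exact (isClosed_symm_image (D.isCompact_midBall i) (D.midBall_subset i)).isOpen_compl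
      · exact e.isOpen_inter_preimage Metric.isOpen_ball
      · exact e.isOpen_inter_preimage Metric.isOpen_thickening
    · intro x hx
      rw [Finset.set_biUnion_insert] at hx
      rcases hx with hx | hx
      · obtain ⟨hxs, hxb⟩ := (mem_symm_image (D.halfBall_subset i)).mp hx
        refine Or.inl (Or.inr ⟨hxs, ?_⟩)
        exact Metric.closedBall_subset_ball (by linarith) hxb
      · by_cases hm : x ∈ e.symm '' D.midBall i
        · obtain ⟨hxs, hxm⟩ := (mem_symm_image (D.midBall_subset i)).mp hm
          refine Or.inr ⟨hsΩ hx, hxs, Metric.self_subset_thickening hδ K ⟨hxm, ?_⟩⟩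
          rw [Set.mem_preimage, e.left_inv hxs]
          exact hx
        · exact Or.inl (Or.inl ⟨hsΩ hx, hm⟩)
    · rintro u x ((⟨hxΩ, hxm⟩ | ⟨hxs, hxb⟩) | ⟨hxΩ, hxs, hxt⟩)
      · refine D.regularAt_regOp i (δ := δ) (by rw [hφ]; linarith) (R u) (hR.regular u x hxΩ) ?_
        intro hs hm
        exact absurd ((mem_symm_image (D.midBall_subset i)).mpr ⟨hs, hm⟩) hxm
      · exact D.regularAt_regOp_of_mem i φ (R u) hxs hxb
      · refine D.regularAt_regOp i (δ := δ) (by rw [hφ]; linarith) (R u) (hR.regular u x hxΩ) ?_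
        intro _ _ w hw
        refine hR.regular u _ (hδO ?_).2
        obtain ⟨z, hz, hzd⟩ := Metric.mem_thickening_iff.mp hxt
        refine Metric.mem_cthickening_of_dist_le w z δ₀ K hz ?_
        have := dist_triangle w (e x) z
        rw [Metric.mem_ball] at hw
        linarith

theorem exists_isRegularizer (k : ℕ) :
    ∃ R : ContForm E X (k + 1) →ₗ[ℝ] ContForm E X (k + 1), D.IsRegularizer Set.univ R := by
  obtain ⟨Ω, R, _, hΩ, hR⟩ := D.exists_isRegularizer_finset k D.points
  have : Ω = Set.univ := by
    refine Set.eq_univ_of_forall fun x => hΩ ?_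
    obtain ⟨i, hi, hs, hb⟩ := D.exists_mem x
    exact Set.mem_biUnion hi ((mem_symm_image (D.halfBall_subset i)).mpr
      ⟨hs, Metric.ball_subset_closedBall hb⟩)
  exact ⟨R, this ▸ hR⟩

end DiscCover

end GlobalRegularization

/-! ### Uniform boundedness and the Arzelà-Ascoli theorem. -/

section FunctionalAnalysis

/-- The uniform boundedness principle, for linear maps that are known to be bounded. -/
theorem exists_uniform_bound {ι Y V : Type*} [NormedAddCommGroup Y] [NormedSpace ℝ Y]
    [CompleteSpace Y] [NormedAddCommGroup V] [NormedSpace ℝ V] (L : ι → Y →ₗ[ℝ] V)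
    (hL : ∀ i, ∃ C : ℝ, ∀ f, ‖L i f‖ ≤ C * ‖f‖) (h : ∀ f, ∃ C, ∀ i, ‖L i f‖ ≤ C) :
    ∃ C : ℝ, 0 ≤ C ∧ ∀ i f, ‖L i f‖ ≤ C * ‖f‖ := by
  choose B hB using hL
  obtain ⟨C, hC⟩ := banach_steinhaus (g := fun i => (L i).mkContinuous (B i) (hB i)) h
  refine ⟨max C 0, le_max_right _ _, fun i f => ?_⟩
  exact (((L i).mkContinuous (B i) (hB i)).le_opNorm f).trans
    (mul_le_mul_of_nonneg_right ((hC i).trans (le_max_left _ _)) (norm_nonneg _))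

/-- A closed, pointwise bounded and equicontinuous family, to which Arzelà-Ascoli applies. -/
theorem isCompact_lipschitz_bounded (α β : Type*) [PseudoMetricSpace α] [CompactSpace α]
    [NormedAddCommGroup β] [ProperSpace β] (M L : ℝ) :
    IsCompact {h : C(α, β) | (∀ y, ‖h y‖ ≤ M) ∧ ∀ y y', ‖h y - h y'‖ ≤ L * dist y y'} := by
  let A : Set (BoundedContinuousFunction α β) :=
    {h | (∀ y, ‖h y‖ ≤ M) ∧ ∀ y y', ‖h y - h y'‖ ≤ L * dist y y'}
  have hA : IsCompact A := by
    refine BoundedContinuousFunction.arzela_ascoli₂ (Metric.closedBall 0 M)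
      (isCompact_closedBall _ _) A ?_ (fun f x hf => by simpa using hf.1 x) ?_
    · have h1 : A = (⋂ y, {h | ‖h y‖ ≤ M}) ∩
          ⋂ y, ⋂ y', {h | ‖h y - h y'‖ ≤ L * dist y y'} := by
        ext h
        simp [A]
      have hev : ∀ y : α, Continuous fun h : BoundedContinuousFunction α β => h y := fun y =>
        continuous_eval_const y
      rw [h1]
      refine (isClosed_iInter fun y => isClosed_le (hev y).norm continuous_const).inter
        (isClosed_iInter fun y => isClosed_iInter fun y' =>
          isClosed_le ((hev y).sub (hev y')).norm continuous_const)
    · intro x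
      refine Metric.equicontinuousAt_of_continuity_modulus (fun y => L * dist x y) ?_ _ ?_
      · have : Continuous fun y => L * dist x y := by fun_prop
        simpa using this.tendsto x
      · refine Filter.Eventually.of_forall fun y h => ?_
        rw [dist_eq_norm]
        exact h.2.2 x y
  have h2 : {h : C(α, β) | (∀ y, ‖h y‖ ≤ M) ∧ ∀ y y', ‖h y - h y'‖ ≤ L * dist y y'} =
      (ContinuousMap.isometryEquivBoundedOfCompact α β).toHomeomorph ⁻¹' A := by
    ext h
    rfl
  rw [h2]
  exact (ContinuousMap.isometryEquivBoundedOfCompact α β).toHomeomorph.isCompact_preimage.mpr hA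

end FunctionalAnalysis

/-! ### A bounded left inverse of the embedding of forms into tuples of functions. -/

section Retraction

variable {E : Type*} [NormedAddCommGroup E] [NormedSpace ℂ E] [FiniteDimensional ℂ E]
  {X : Type*} [TopologicalSpace X] [ChartedSpace E X] [IsManifold 𝓘(ℂ, E) ω X] {k : ℕ}

theorem ofChart_smul_fun {e : OpenPartialHomeomorph X E} (a : E → ℝ)
    (g : E → E [⋀^Fin k]→L[ℝ] ℂ) {x : X} (hx : x ∈ e.source) :
    ofChart e (fun y => a y • g y) x = a (e x) • ofChart e g x := by
  rw [ofChart_apply hx, ofChart_apply hx]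
  rfl

namespace DiscCover

variable (D : DiscCover E X)

/-- The extension by zero of a component of a tuple. -/
def extend (f : D.SupSpace k) (i : D.points) (y : E) : E [⋀^Fin k]→L[ℝ] ℂ :=
  open scoped Classical in if h : y ∈ D.disc i then f i ⟨y, h⟩ else 0

theorem extend_of_mem (f : D.SupSpace k) (i : D.points) {y : E} (hy : y ∈ D.disc i) :
    D.extend f i y = f i ⟨y, hy⟩ := dif_pos hy

theorem continuousOn_extend (f : D.SupSpace k) (i : D.points) :
    ContinuousOn (D.extend f i) (D.disc i) := by
  rw [continuousOn_iff_continuous_domRestrict]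
  refine (f i).continuous.congr fun y => ?_
  exact (D.extend_of_mem f i y.2).symm

/-- A coordinate ball. -/
def coordBall (i : X) : Set X :=
  (chartAt E i).source ∩ chartAt E i ⁻¹' Metric.ball (chartAt E i i) (D.radius i / 2)

theorem exists_partitionOfUnity [CompactSpace X] [T2Space X] :
    ∃ ρ : PartitionOfUnity D.points X, ρ.IsSubordinate fun i => D.coordBall i := by
  refine PartitionOfUnity.exists_isSubordinate_of_locallyFinite isClosed_univ _ (fun i => ?_)
    (locallyFinite_of_finite _) fun x _ => ?_
  · exact (chartAt E (i : X)).isOpen_inter_preimage Metric.isOpen_ball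
  · obtain ⟨i, hi, h⟩ := D.exists_mem x
    exact Set.mem_iUnion.mpr ⟨⟨i, hi⟩, h⟩

variable {D} (ρ : PartitionOfUnity D.points X)

/-- A component of a tuple, multiplied by a function of a partition of unity. -/
def gluePiece (f : D.SupSpace k) (i : D.points) (y : E) : E [⋀^Fin k]→L[ℝ] ℂ :=
  ρ i ((chartAt E (i : X)).symm y) • D.extend f i y

/-- The closed ball of half radius. -/
abbrev halfBall (D : DiscCover E X) (i : X) : Set E :=
  Metric.closedBall (chartAt E i i) (D.radius i / 2)

variable {ρ} in
theorem gluePiece_eq_zero (hρ : ρ.IsSubordinate fun i => D.coordBall i) (f : D.SupSpace k)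
    (i : D.points) {y : E} (hy : y ∉ D.halfBall i) : gluePiece ρ f i y = 0 := by
  by_cases hd : y ∈ D.disc i
  · have h0 : ρ i ((chartAt E (i : X)).symm y) = 0 := by
      by_contra h
      have h1 := hρ i (subset_tsupport _ (Function.mem_support.mpr h))
      have h2 : chartAt E (i : X) ((chartAt E (i : X)).symm y) ∈
        Metric.ball (chartAt E (i : X) i) (D.radius i / 2) := h1.2
      rw [(chartAt E (i : X)).right_inv (D.disc_subset i hd)] at h2
      exact hy (Metric.ball_subset_closedBall h2)
    rw [gluePiece, h0]
    exact zero_smul_form _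
  · rw [gluePiece, extend, dif_neg hd]
    ext v
    simp

theorem norm_gluePiece_le (f : D.SupSpace k) (i : D.points) (y : E) :
    ‖gluePiece ρ f i y‖ ≤ ‖f‖ := by
  refine (norm_smul_le _ _).trans
    ((mul_le_of_le_one_left (norm_nonneg (D.extend f i y)) ?_).trans ?_)
  · rw [Real.norm_of_nonneg (ρ.nonneg _ _)]
    exact ρ.le_one _ _
  · by_cases hd : y ∈ D.disc i
    · rw [D.extend_of_mem f i hd]
      exact SupSpace.norm_apply_le D f i ⟨y, hd⟩
    · rw [extend, dif_neg hd, norm_zero]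
      exact norm_nonneg f

variable [T2Space X]

variable {ρ} in
theorem regularAt_gluePiece (hρ : ρ.IsSubordinate fun i => D.coordBall i) (f : D.SupSpace k)
    (i : D.points) (x : X) :
    RegularAt 0 (ofChart (chartAt E (i : X)) (gluePiece ρ f i)) x := by
  have : ProperSpace E := FiniteDimensional.proper ℂ E
  refine regularAt_ofChart (chart_mem_atlas E (i : X)) (isCompact_closedBall _ _)
    (D.halfBall_subset i) (fun y hy => gluePiece_eq_zero hρ f i hy) fun hx => ?_
  refine contDiffAt_zero.mpr ⟨D.disc i, ?_, ?_⟩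
  · refine Filter.mem_of_superset (Metric.isOpen_ball.mem_nhds ?_) Metric.ball_subset_closedBall
    exact Metric.closedBall_subset_ball (by linarith [D.radius_pos i]) hx
  · have h1 : ContinuousOn (fun y => ρ i ((chartAt E (i : X)).symm y)) (D.disc i) :=
      (ρ i).continuous.comp_continuousOn
        ((chartAt E (i : X)).continuousOn_symm.mono (D.disc_subset i))
    exact h1.smul (D.continuousOn_extend f i)

/-- The form glued from a tuple by a partition of unity. -/
def glue (hρ : ρ.IsSubordinate fun i => D.coordBall i) : D.SupSpace k →ₗ[ℝ] ContForm E X k where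
  toFun f := ⟨∑ i : D.points, ofChart (chartAt E (i : X)) (gluePiece ρ f i), fun x =>
    RegularAt.sum fun i _ => regularAt_gluePiece hρ f i x⟩
  map_add' f g := by
    ext1
    simp only [Submodule.coe_add, ← Finset.sum_add_distrib, ← ofChart_add]
    refine Finset.sum_congr rfl fun i _ => congrArg _ ?_
    ext1 y
    rw [Pi.add_apply, gluePiece, gluePiece, gluePiece]
    have : D.extend (f + g) i y = D.extend f i y + D.extend g i y := by
      by_cases hd : y ∈ D.disc i
      · rw [D.extend_of_mem _ i hd, D.extend_of_mem _ i hd, D.extend_of_mem _ i hd]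
        rfl
      · rw [extend, extend, extend, dif_neg hd, dif_neg hd, dif_neg hd, add_zero]
    rw [this]
    exact smul_add _ _ _
  map_smul' c f := by
    ext1
    simp only [Submodule.coe_smul, RingHom.id_apply, Finset.smul_sum]
    refine Finset.sum_congr rfl fun i _ => ?_
    rw [← ofChart_smul]
    congr 1
    ext1 y
    rw [Pi.smul_apply, gluePiece, gluePiece]
    have : D.extend (c • f) i y = c • D.extend f i y := by
      by_cases hd : y ∈ D.disc i
      · rw [D.extend_of_mem _ i hd, D.extend_of_mem _ i hd]
        rfl
      · rw [extend, extend, dif_neg hd, dif_neg hd]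
        ext v
        simp
    rw [this]
    exact smul_comm _ _ _

/-- At each point the pieces are `ρ i x` times the form, and the weights sum to `1`. With this
retraction, theorems about the Banach space `SupSpace` apply to operators on forms by precomposition
with `glue`. -/
theorem glue_lift (hρ : ρ.IsSubordinate fun i => D.coordBall i) (u : ContForm E X k) :
    glue ρ hρ (D.lift u) = u := by
  refine Subtype.ext ?_
  ext1 x
  have h1 : ∀ i : D.points, ofChart (chartAt E (i : X)) (gluePiece ρ (D.lift u) i) x =
      ρ i x • u.1 x := by
    intro i
    by_cases hx : x ∈ D.coordBall i
    · have hd : chartAt E (i : X) x ∈ D.disc i :=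
        Metric.ball_subset_closedBall (Metric.ball_subset_ball (by linarith [D.radius_pos i]) hx.2)
      have h2 := ofChart_smul_fun (e := chartAt E (i : X))
        (fun y => ρ i ((chartAt E (i : X)).symm y)) (D.extend (D.lift u) i) hx.1
      refine h2.trans ?_
      have h3 : D.extend (D.lift u) i (chartAt E (i : X) x) =
        inChart u.1 (chartAt E (i : X)) (chartAt E (i : X) x) := D.extend_of_mem _ i hd
      have h4 : ofChart (chartAt E (i : X)) (D.extend (D.lift u) i) x =
          ofChart (chartAt E (i : X)) (inChart u.1 (chartAt E (i : X))) x := by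
        rw [ofChart_apply hx.1, ofChart_apply hx.1, h3]
      rw [h4, ofChart_inChart (chart_mem_atlas E (i : X)) u.1 hx.1,
        (chartAt E (i : X)).left_inv hx.1]
    · have h0 : ρ i x = 0 := by
        by_contra h
        exact hx (hρ i (subset_tsupport _ (Function.mem_support.mpr h)))
      rw [h0]
      have h2 : ofChart (chartAt E (i : X)) (gluePiece ρ (D.lift u) i) x = 0 := by
        refine ofChart_eq_zero fun hs => ?_
        rw [gluePiece, (chartAt E (i : X)).left_inv hs, h0]
        exact zero_smul_form _
      rw [h2]
      ext v
      simp
  have h2 : (glue ρ hρ (D.lift u)).1 x = ∑ i, ρ i x • u.1 x := by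
    have : (glue ρ hρ (D.lift u)).1 x =
        ∑ i : D.points, ofChart (chartAt E (i : X)) (gluePiece ρ (D.lift u) i) x := Finset.sum_apply _ _ _
    rw [this]
    exact Finset.sum_congr rfl fun i _ => h1 i
  have h3 : ∑ i, ρ i x = 1 := by
    rw [← finsum_eq_sum_of_fintype]
    exact ρ.sum_eq_one (Set.mem_univ x)
  rw [h2]
  ext v
  rw [ContinuousAlternatingMap.sum_apply]
  have h4 : ∀ i, (ρ i x • u.1 x) v = ρ i x • u.1 x v := fun i => rfl
  simp only [h4]
  rw [← Finset.sum_smul, h3, one_smul]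

theorem exists_bound_glue (hρ : ρ.IsSubordinate fun i => D.coordBall i) (k : ℕ) :
    ∃ C : ℝ, 0 ≤ C ∧ ∀ f : D.SupSpace k, ‖D.lift (glue ρ hρ f)‖ ≤ C * ‖f‖ := by
  have : ProperSpace E := FiniteDimensional.proper ℂ E
  choose C hC0 hC using fun i : D.points => D.exists_bound_ofChart (chart_mem_atlas E (i : X))
    (isCompact_closedBall _ _) (D.halfBall_subset i) k
  refine ⟨∑ i, C i, Finset.sum_nonneg fun i _ => hC0 i, fun f => ?_⟩
  let u : D.points → ContForm E X k := fun i =>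
    ⟨ofChart (chartAt E (i : X)) (gluePiece ρ f i), fun x => regularAt_gluePiece hρ f i x⟩
  have h1 : glue ρ hρ f = ∑ i, u i := by
    refine Subtype.ext ?_
    exact (AddSubmonoidClass.coe_finsetSum (S := ContForm E X k) u Finset.univ).symm
  rw [h1, map_sum, Finset.sum_mul]
  refine (norm_sum_le _ _).trans (Finset.sum_le_sum fun i _ => ?_)
  exact hC i _ ‖f‖ (u i) (fun y hy => gluePiece_eq_zero hρ f i hy) (norm_nonneg f)
    (fun y _ => norm_gluePiece_le ρ f i y) rfl

end DiscCover

end Retraction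

/-! ### Lipschitz estimates and exterior derivatives. -/

section Lipschitz

theorem exists_lipschitz_of_contDiffOn {E V : Type*} [NormedAddCommGroup E] [NormedSpace ℝ E]
    [NormedAddCommGroup V] [NormedSpace ℝ V] {f : E → V} {O K : Set E} (hO : IsOpen O)
    (hf : ContDiffOn ℝ ∞ f O) (hK : IsCompact K) (hKO : K ⊆ O) (hc : Convex ℝ K) :
    ∃ C : ℝ, ∀ y ∈ K, ∀ y' ∈ K, ‖f y - f y'‖ ≤ C * ‖y - y'‖ := by
  have h1 : ContinuousOn (fderiv ℝ f) K :=
    (hf.continuousOn_fderiv_of_isOpen hO (by simp)).mono hKO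
  obtain ⟨C, hC⟩ := hK.bddAbove_image h1.norm
  refine ⟨C, fun y hy y' hy' => ?_⟩
  exact hc.norm_image_sub_le_of_norm_fderiv_le
    (fun x hx => (hf.contDiffAt (hO.mem_nhds (hKO hx))).differentiableAt (by simp))
    (fun x hx => hC ⟨x, hx, rfl⟩) hy' hy

theorem norm_extDeriv_le_of_lip {E : Type*} [NormedAddCommGroup E] [NormedSpace ℂ E] {k : ℕ}
    {f : E → E [⋀^Fin k]→L[ℝ] ℂ} {y : E} {C : ℝ} (hC : 0 ≤ C)
    (h : ∀ᶠ z in 𝓝 y, ‖f z - f y‖ ≤ C * ‖z - y‖) : ‖extDeriv f y‖ ≤ (k + 1) * C :=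
  (ContinuousAlternatingMap.norm_alternatizeUncurryFin_le _).trans
    (mul_le_mul_of_nonneg_left (norm_fderiv_le_of_lip' ℝ hC h) (by positivity))

end Lipschitz

/-! ### Compactness of the regularizer, and normalized sequences. -/

section ClosedRange

variable {E : Type*} [NormedAddCommGroup E] [NormedSpace ℂ E] [FiniteDimensional ℂ E]
  {X : Type*} [TopologicalSpace X] [ChartedSpace E X] [IsManifold 𝓘(ℂ, E) ω X] {k : ℕ}

theorem extD_real_smul (c : ℝ) {φ : RoughForm E X k} (hφ : IsSmooth φ) :
    extD (c • φ) = c • extD φ := by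
  have h : ∀ {l : ℕ} (ψ : RoughForm E X l), c • ψ = (c : ℂ) • ψ := by
    intro l ψ
    ext x v
    simp
  rw [h, h, extD_smul _ hφ]

variable (E X k) in
/-- The smooth closed forms. -/
def closedForms : Submodule ℝ (ContForm E X k) where
  carrier := {ζ | IsSmooth ζ.1 ∧ extD ζ.1 = 0}
  add_mem' {ζ ζ'} h h' := ⟨(smoothForms E X k).add_mem h.1 h'.1, by
    refine (extD_add h.1 h'.1).trans ?_
    rw [h.2, h'.2, add_zero]⟩
  zero_mem' := ⟨(smoothForms E X k).zero_mem, extD_zero⟩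
  smul_mem' c ζ h := by
    refine ⟨?_, (extD_real_smul c h.1).trans ?_⟩
    · have : (c • ζ).1 = (c : ℂ) • ζ.1 := by
        ext x v
        simp
      rw [this]
      exact (smoothForms E X k).smul_mem _ h.1
    · rw [h.2]
      ext x v
      simp

namespace DiscCover

variable {D : DiscCover E X} [T2Space X] {ρ : PartitionOfUnity D.points X}
  (hρ : ρ.IsSubordinate fun i => D.coordBall i)
  {R : ContForm E X k →ₗ[ℝ] ContForm E X k}

/-- Banach-Steinhaus for the difference quotients: each one is bounded as an operator, and for a
fixed tuple all of them are bounded together because the regularized form is smooth on the compact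
discs. This gives a uniform constant without any explicit estimate of derivatives of `R`. -/
theorem exists_lipschitz_bound (hR : D.IsRegularizer Set.univ R) :
    ∃ L : ℝ, 0 ≤ L ∧ ∀ (f : D.SupSpace k) (i : D.points), ∀ y ∈ D.disc i, ∀ y' ∈ D.disc i,
      ‖inChart (R (glue ρ hρ f)).1 (chartAt E (i : X)) y -
        inChart (R (glue ρ hρ f)).1 (chartAt E (i : X)) y'‖ ≤ L * ‖f‖ * ‖y - y'‖ := by
  obtain ⟨C₁, hC₁0, hC₁⟩ := hR.bound
  obtain ⟨C₂, hC₂0, hC₂⟩ := exists_bound_glue ρ hρ k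
  let ι := Σ i : D.points, {p : E × E // p.1 ∈ D.disc i ∧ p.2 ∈ D.disc i}
  let Q : ι → D.SupSpace k →ₗ[ℝ] (E [⋀^Fin k]→L[ℝ] ℂ) := fun j =>
    { toFun := fun f => ‖j.2.1.1 - j.2.1.2‖⁻¹ •
        (inChart (R (glue ρ hρ f)).1 (chartAt E (j.1 : X)) j.2.1.1 -
          inChart (R (glue ρ hρ f)).1 (chartAt E (j.1 : X)) j.2.1.2)
      map_add' := fun f g => by
        rw [map_add, map_add, Submodule.coe_add, inChart_add]
        ext v
        simp
        ring
      map_smul' := fun c f => by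
        rw [map_smul, map_smul]
        ext v
        have h : ∀ y, inChart (c • (R (glue ρ hρ f)).1) (chartAt E (j.1 : X)) y v =
          c • inChart (R (glue ρ hρ f)).1 (chartAt E (j.1 : X)) y v := fun y => rfl
        simp [h]
        ring }
  have hb : ∀ f (i : D.points), ∀ y ∈ D.disc i,
      ‖inChart (R (glue ρ hρ f)).1 (chartAt E (i : X)) y‖ ≤ C₁ * (C₂ * ‖f‖) := fun f i y hy =>
    (D.norm_inChart_le_lift _ i hy).trans ((hC₁ _).trans (mul_le_mul_of_nonneg_left (hC₂ f) hC₁0))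
  have hQ : ∀ j f, ‖Q j f‖ = ‖j.2.1.1 - j.2.1.2‖⁻¹ *
      ‖inChart (R (glue ρ hρ f)).1 (chartAt E (j.1 : X)) j.2.1.1 -
          inChart (R (glue ρ hρ f)).1 (chartAt E (j.1 : X)) j.2.1.2‖ := fun j f => by
    change ‖‖j.2.1.1 - j.2.1.2‖⁻¹ • (inChart (R (glue ρ hρ f)).1 (chartAt E (j.1 : X)) j.2.1.1 -
          inChart (R (glue ρ hρ f)).1 (chartAt E (j.1 : X)) j.2.1.2)‖ = _
    rw [norm_smul, norm_inv, norm_norm]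
  have hQ₁ : ∀ j, ∃ C : ℝ, ∀ f, ‖Q j f‖ ≤ C * ‖f‖ := by
    intro j
    refine ⟨‖j.2.1.1 - j.2.1.2‖⁻¹ * (2 * (C₁ * C₂)), fun f => ?_⟩
    rw [hQ, mul_assoc]
    refine mul_le_mul_of_nonneg_left ?_ (inv_nonneg.mpr (norm_nonneg _))
    refine (norm_sub_le _ _).trans ?_
    have h1 := hb f j.1 _ j.2.2.1
    have h2 := hb f j.1 _ j.2.2.2
    linarith
  have hQ₂ : ∀ f, ∃ C, ∀ j, ‖Q j f‖ ≤ C := by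
    intro f
    have hs : IsSmooth (R (glue ρ hρ f)).1 :=
      isSmooth_iff.mpr fun x => hR.regular _ x (Set.mem_univ x)
    choose C hC using fun i : D.points => exists_lipschitz_of_contDiffOn
      (chartAt E (i : X)).open_target (hs _ (chart_mem_atlas E (i : X))) (D.isCompact_disc i)
      (D.disc_subset i) (convex_closedBall _ _)
    refine ⟨∑ i, |C i|, fun j => ?_⟩
    have h1 := hC j.1 _ j.2.2.1 _ j.2.2.2
    have h2 : |C j.1| ≤ ∑ i, |C i| :=
      Finset.single_le_sum (f := fun i => |C i|) (fun i _ => abs_nonneg _) (Finset.mem_univ j.1)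
    rw [hQ]
    by_cases h : j.2.1.1 - j.2.1.2 = 0
    · rw [h, norm_zero, inv_zero, zero_mul]
      exact Finset.sum_nonneg fun i _ => abs_nonneg _
    · have h3 : 0 < ‖j.2.1.1 - j.2.1.2‖ := norm_pos_iff.mpr h
      rw [inv_mul_le_iff₀ h3, mul_comm]
      exact h1.trans (mul_le_mul_of_nonneg_right ((le_abs_self _).trans h2) h3.le)
  obtain ⟨L, hL0, hL⟩ := exists_uniform_bound Q hQ₁ hQ₂
  refine ⟨L, hL0, fun f i y hy y' hy' => ?_⟩
  have h1 := hL ⟨i, (y, y'), hy, hy'⟩ f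
  by_cases h : y = y'
  · subst h
    simp
  · have h2 : 0 < ‖y - y'‖ := norm_pos_iff.mpr (sub_ne_zero.mpr h)
    have h3 : ‖y - y'‖⁻¹ * ‖inChart (R (glue ρ hρ f)).1 (chartAt E (i : X)) y -
        inChart (R (glue ρ hρ f)).1 (chartAt E (i : X)) y'‖ ≤ L * ‖f‖ := by
      rwa [hQ] at h1
    rwa [inv_mul_le_iff₀ h2, mul_comm] at h3

/-- A Lipschitz constant bounds the first derivative. Open balls suffice, since the balls of half
radius already cover. -/
theorem exists_bound_extD (hR : D.IsRegularizer Set.univ R) :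
    ∃ L : ℝ, 0 ≤ L ∧ ∀ (f : D.SupSpace k) (i : D.points),
      ∀ y ∈ Metric.ball (chartAt E (i : X) i) (D.radius i),
        ‖inChart (extD (R (glue ρ hρ f)).1) (chartAt E (i : X)) y‖ ≤ L * ‖f‖ := by
  obtain ⟨L, hL0, hL⟩ := exists_lipschitz_bound hρ hR
  refine ⟨(k + 1) * L, by positivity, fun f i y hy => ?_⟩
  have hs : IsSmooth (R (glue ρ hρ f)).1 :=
    isSmooth_iff.mpr fun x => hR.regular _ x (Set.mem_univ x)
  have hyd : y ∈ D.disc i := Metric.ball_subset_closedBall hy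
  rw [inChart_extD hs (chart_mem_atlas E (i : X)) (D.disc_subset i hyd), mul_assoc]
  refine norm_extDeriv_le_of_lip (by positivity) ?_
  filter_upwards [Metric.isOpen_ball.mem_nhds hy] with z hz
  exact hL f i z (Metric.ball_subset_closedBall hz) y hyd

variable (D) in
theorem lift_smul (c : ℝ) (u : ContForm E X k) : D.lift (c • u) = c • D.lift u :=
  D.lift.map_smul c u

variable (ρ) in
theorem lift_injective (hρ : ρ.IsSubordinate fun i => D.coordBall i) :
    Function.Injective (D.lift : ContForm E X k →ₗ[ℝ] D.SupSpace k) :=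
  Function.LeftInverse.injective (g := glue ρ hρ) (glue_lift ρ hρ)

/-- If forms cannot be approximated by closed ones in terms of their differentials, then there are
normalized forms with small differential far from the closed ones. -/
theorem exists_normalized
    (h : ∀ C : ℝ, 0 ≤ C → ∃ (u : ContForm E X k) (hu : IsSmooth u.1), ∀ ζ ∈ closedForms E X k,
      C * ‖D.lift (dCont u hu)‖ < ‖D.lift (u - ζ)‖) {ε : ℝ} (hε : 0 < ε)
      (hinj : Function.Injective (D.lift : ContForm E X (k + 1) →ₗ[ℝ] D.SupSpace (k + 1))) :
    ∃ (v : ContForm E X k) (hv : IsSmooth v.1), ‖D.lift v‖ ≤ 1 ∧ ‖D.lift (dCont v hv)‖ ≤ ε ∧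
      ∀ ζ ∈ closedForms E X k, 1 / 2 ≤ ‖D.lift (v - ζ)‖ := by
  -- As in Riesz's lemma: the distance `d` of `u` from the closed forms is at least `ε⁻¹ ‖du‖`.
  -- Subtracting an almost nearest closed form and normalizing leaves a differential of size at most
  -- `ε`.
  obtain ⟨u, hu, hζ⟩ := h ε⁻¹ (by positivity)
  have hdu : 0 < ‖D.lift (dCont u hu)‖ := by
    by_contra h0
    have h1 : D.lift (dCont u hu) = 0 := norm_le_zero_iff.mp (not_lt.mp h0)
    have h2 : dCont u hu = 0 := hinj (h1.trans (map_zero D.lift).symm)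
    have h3 := hζ u ⟨hu, congrArg Subtype.val h2⟩
    rw [h1, D.lift_sub, sub_self, norm_zero, mul_zero, norm_zero] at h3
    exact lt_irrefl _ h3
  let A : Set ℝ := (fun ζ => ‖D.lift (u - ζ)‖) '' (closedForms E X k : Set (ContForm E X k))
  have hA : A.Nonempty := ⟨_, 0, (closedForms E X k).zero_mem, rfl⟩
  have hAb : ∀ a ∈ A, ε⁻¹ * ‖D.lift (dCont u hu)‖ ≤ a := by
    rintro a ⟨ζ, hζ', rfl⟩
    exact (hζ ζ hζ').le
  have hAbdd : BddBelow A := ⟨_, hAb⟩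
  set d := sInf A with hd
  have hd1 : ε⁻¹ * ‖D.lift (dCont u hu)‖ ≤ d := le_csInf hA hAb
  have hd0 : 0 < d := lt_of_lt_of_le (by positivity) hd1
  -- The infimum need not be attained; allowing twice its value is the origin of the bound `1 / 2`.
  obtain ⟨_, ⟨ζ₀, hζ₀, rfl⟩, hlt⟩ := exists_lt_of_csInf_lt hA (by linarith : sInf A < 2 * d)
  set N := ‖D.lift (u - ζ₀)‖ with hN
  have hdN : d ≤ N := csInf_le hAbdd ⟨ζ₀, hζ₀, rfl⟩
  have hN0 : 0 < N := hd0.trans_le hdN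
  have hvs : IsSmooth (N⁻¹ • (u - ζ₀) : ContForm E X k).1 := by
    have h1 : (N⁻¹ • (u - ζ₀) : ContForm E X k).1 = ((N⁻¹ : ℝ) : ℂ) • (u.1 - ζ₀.1) := by
      ext x v
      simp
    rw [h1]
    exact (smoothForms E X k).smul_mem _ ((smoothForms E X k).sub_mem hu hζ₀.1)
  refine ⟨N⁻¹ • (u - ζ₀), hvs, ?_, ?_, fun ζ hζ' => ?_⟩
  · rw [D.lift_smul, norm_smul, Real.norm_of_nonneg (by positivity), ← hN, inv_mul_cancel₀ hN0.ne']
  · have h1 : dCont (N⁻¹ • (u - ζ₀)) hvs = N⁻¹ • dCont u hu := by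
      refine Subtype.ext ?_
      have h2 : IsSmooth (u.1 + -ζ₀.1) :=
        (smoothForms E X k).add_mem hu ((smoothForms E X k).neg_mem hζ₀.1)
      have h3 : (N⁻¹ • (u - ζ₀) : ContForm E X k).1 = N⁻¹ • (u.1 + -ζ₀.1) := by
        ext x v
        simp [sub_eq_add_neg]
      have h4 : extD (-ζ₀.1) = 0 := by
        rw [← neg_one_smul ℂ ζ₀.1, extD_smul _ hζ₀.1, hζ₀.2]
        ext x v
        simp
      change extD (N⁻¹ • (u - ζ₀) : ContForm E X k).1 = N⁻¹ • extD u.1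
      rw [h3, extD_real_smul _ h2, extD_add hu ((smoothForms E X k).neg_mem hζ₀.1), h4, add_zero]
    rw [h1, D.lift_smul, norm_smul, Real.norm_of_nonneg (by positivity), inv_mul_le_iff₀ hN0]
    have h2 : ‖D.lift (dCont u hu)‖ ≤ ε * d := by rwa [inv_mul_le_iff₀ hε] at hd1
    calc _ ≤ ε * d := h2
      _ ≤ ε * N := mul_le_mul_of_nonneg_left hdN hε.le
      _ = N * ε := mul_comm _ _
  · have h1 : N⁻¹ • (u - ζ₀) - ζ = N⁻¹ • (u - (ζ₀ + N • ζ)) := by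
      refine Subtype.ext ?_
      ext x v
      have hNc : (N : ℂ) ≠ 0 := by exact_mod_cast hN0.ne'
      simp
      field_simp
      ring
    rw [h1, D.lift_smul, norm_smul, Real.norm_of_nonneg (by positivity)]
    have h2 : d ≤ ‖D.lift (u - (ζ₀ + N • ζ))‖ := csInf_le hAbdd
      ⟨_, (closedForms E X k).add_mem hζ₀ ((closedForms E X k).smul_mem N hζ'), rfl⟩
    rw [← div_eq_inv_mul, le_div_iff₀ hN0]
    linarith

end DiscCover

end ClosedRange

/-! ### Approximation by closed forms, with an error controlled by the differential. -/

section ClosedApproximation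

variable {E : Type*} [NormedAddCommGroup E] [NormedSpace ℂ E] [FiniteDimensional ℂ E]
  {X : Type*} [TopologicalSpace X] [ChartedSpace E X] [IsManifold 𝓘(ℂ, E) ω X] {k : ℕ}

theorem eq_zero_of_forall_le_mul {V : Type*} [NormedAddCommGroup V] {a : V} {B : ℝ} (hB : 0 ≤ B)
    (h : ∀ δ > 0, ‖a‖ ≤ B * δ) : a = 0 := by
  by_contra ha
  have h1 : 0 < ‖a‖ := norm_pos_iff.mpr ha
  have h2 := h (‖a‖ / (2 * (B + 1))) (by positivity)
  have h3 : B * (‖a‖ / (2 * (B + 1))) < ‖a‖ := by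
    rw [← mul_div_assoc, div_lt_iff₀ (by positivity)]
    nlinarith
  linarith

namespace DiscCover

variable {D : DiscCover E X} [T2Space X] {ρ : PartitionOfUnity D.points X}
  (hρ : ρ.IsSubordinate fun i => D.coordBall i)
  {R : ContForm E X k →ₗ[ℝ] ContForm E X k}

theorem IsRegularizer.isSmooth (hR : D.IsRegularizer Set.univ R) (u : ContForm E X k) :
    IsSmooth (R u).1 :=
  isSmooth_iff.mpr fun x => hR.regular _ x (Set.mem_univ x)

theorem regularizer_glue_eq (g : D.SupSpace k) (v : ContForm E X k) :
    R (glue ρ hρ g) = R (glue ρ hρ (g - D.lift v)) + R v := by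
  have h1 : g = (g - D.lift v) + D.lift v := (sub_add_cancel g (D.lift v)).symm
  have h2 : glue ρ hρ g = glue ρ hρ (g - D.lift v) + v := by
    conv_lhs => rw [h1]
    rw [map_add, glue_lift]
  rw [h2, map_add]

/-- Compare `R (glue g)` with `R (R v)`: the derivative of the difference is bounded by `‖g - R v‖`,
and that of `R (R v)` by `‖dv‖`, both up to constants. Since both can be made arbitrarily small, the
derivative vanishes. -/
theorem extD_regularizer_glue_eq_zero (hR : D.IsRegularizer Set.univ R) (g : D.SupSpace k)
    (h : ∀ δ > 0, ∃ (v : ContForm E X k) (hv : IsSmooth v.1), ‖D.lift (dCont v hv)‖ ≤ δ ∧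
      ‖g - D.lift (R v)‖ ≤ δ) : extD (R (glue ρ hρ g)).1 = 0 := by
  obtain ⟨L, hL0, hL⟩ := exists_bound_extD hρ hR
  obtain ⟨C, hC0, hC⟩ := hR.deriv
  have key : ∀ (i : D.points), ∀ y ∈ Metric.ball (chartAt E (i : X) i) (D.radius i),
      inChart (extD (R (glue ρ hρ g)).1) (chartAt E (i : X)) y = 0 := by
    intro i y hy
    refine eq_zero_of_forall_le_mul (B := L + C * C) (by positivity) fun δ hδ => ?_
    obtain ⟨v, hv, hvd, hvg⟩ := h δ hδ
    have h1 : extD (R (glue ρ hρ g)).1 =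
        extD (R (glue ρ hρ (g - D.lift (R v)))).1 + extD (R (R v)).1 := by
      rw [regularizer_glue_eq hρ g (R v), Submodule.coe_add,
        extD_add (hR.isSmooth _) (hR.isSmooth _)]
    have h2 := hL (g - D.lift (R v)) i y hy
    have h3 := D.norm_inChart_le_lift (dCont (R (R v)) (hR.isSmooth _)) i
      (Metric.ball_subset_closedBall hy)
    have h4 := hC (R v) (hR.isSmooth _) (hR.isSmooth _)
    have h5 := hC v hv (hR.isSmooth _)
    rw [h1, inChart_add]
    refine (norm_add_le _ _).trans ?_
    have h6 : ‖inChart (extD (R (R v)).1) (chartAt E (i : X)) y‖ ≤ C * (C * δ) :=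
      h3.trans (h4.trans (mul_le_mul_of_nonneg_left
        (h5.trans (mul_le_mul_of_nonneg_left hvd hC0)) hC0))
    have h7 := h2.trans (mul_le_mul_of_nonneg_left hvg hL0)
    have h8 := add_le_add h7 h6
    refine h8.trans (le_of_eq ?_)
    ring
  funext x
  obtain ⟨i, hi, hs, hb⟩ := D.exists_mem x
  refine eq_of_inChart_eq (chart_mem_atlas E i) hs ?_
  rw [key ⟨i, hi⟩ _ (Metric.ball_subset_ball (by linarith [D.radius_pos i]) hb)]
  rfl

/-- Telescope: `v - R v` and `R v - R (R v)` are almost closed by the homotopy, and `R (R v)` is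
close to the closed form `R (glue g)`. The regularizer enters twice because `g` approximates `R v`
and need not itself come from a smooth form. -/
theorem exists_closed_near (hR : D.IsRegularizer Set.univ R) :
    ∃ B : ℝ, 0 ≤ B ∧ ∀ (g : D.SupSpace k) (v : ContForm E X k) (hv : IsSmooth v.1) (δ : ℝ),
      ‖D.lift (dCont v hv)‖ ≤ δ → ‖g - D.lift (R v)‖ ≤ δ → extD (R (glue ρ hρ g)).1 = 0 →
        ∃ ζ ∈ closedForms E X k, ‖D.lift (v - ζ)‖ ≤ B * δ := by
  obtain ⟨C₁, hC₁0, hC₁⟩ := hR.bound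
  obtain ⟨C₂, hC₂0, hC₂⟩ := exists_bound_glue ρ hρ k
  obtain ⟨C, hC0, hC⟩ := hR.deriv
  obtain ⟨H, hH0, hH⟩ := hR.homotopic
  refine ⟨H + H * C + C₁ * C₂, by positivity, fun g v hv δ hvd hvg hg => ?_⟩
  obtain ⟨ζ₁, hζ₁, hdζ₁, hn₁⟩ := hH v hv
  obtain ⟨ζ₂, hζ₂, hdζ₂, hn₂⟩ := hH (R v) (hR.isSmooth _)
  set w := R (glue ρ hρ g) with hw
  have hwc : w ∈ closedForms E X k := ⟨hR.isSmooth _, hg⟩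
  refine ⟨ζ₁ + ζ₂ + w, (closedForms E X k).add_mem ((closedForms E X k).add_mem ⟨hζ₁, hdζ₁⟩
    ⟨hζ₂, hdζ₂⟩) hwc, ?_⟩
  set q := R (glue ρ hρ (g - D.lift (R v))) with hq
  have h1 : w = q + R (R v) := regularizer_glue_eq hρ g (R v)
  have h2 : v - (ζ₁ + ζ₂ + w) = (v - R v - ζ₁) + (R v - R (R v) - ζ₂) - q := by
    rw [h1]
    abel
  have h3 : ‖D.lift q‖ ≤ C₁ * (C₂ * δ) :=
    (hC₁ _).trans (mul_le_mul_of_nonneg_left ((hC₂ _).trans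
      (mul_le_mul_of_nonneg_left hvg hC₂0)) hC₁0)
  have h4 := hn₁.trans (mul_le_mul_of_nonneg_left hvd hH0)
  have h5 := hn₂.trans (mul_le_mul_of_nonneg_left
    ((hC v hv (hR.isSmooth _)).trans (mul_le_mul_of_nonneg_left hvd hC0)) hH0)
  rw [h2, D.lift_sub, map_add]
  refine (norm_sub_le _ _).trans ?_
  refine (add_le_add (norm_add_le _ _) le_rfl).trans ?_
  refine (add_le_add (add_le_add h4 h5) h3).trans (le_of_eq ?_)
  ring

theorem isCompact_lipschitz (D : DiscCover E X) (M L : ℝ) :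
    IsCompact {f : D.SupSpace k | ∀ i, (∀ y, ‖f i y‖ ≤ M) ∧
      ∀ y y', ‖f i y - f i y'‖ ≤ L * dist y y'} := by
  have : FiniteDimensional ℝ E := FiniteDimensional.complexToReal E
  have : ProperSpace (E [⋀^Fin k]→L[ℝ] ℂ) := FiniteDimensional.proper ℝ _
  have h := isCompact_univ_pi fun i : D.points =>
    isCompact_lipschitz_bounded (D.disc i) (E [⋀^Fin k]→L[ℝ] ℂ) M L
  convert! h using 1
  ext f
  exact ⟨fun hf i _ => hf i, fun hf i => hf i trivial⟩

end DiscCover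

/-- A smooth form differs from a closed one by a continuous form that is bounded in terms of the
exterior derivative. -/
theorem DiscCover.exists_closed_approx [CompactSpace X] [T2Space X] (D : DiscCover E X) (k : ℕ) :
    ∃ C : ℝ, 0 ≤ C ∧ ∀ (u : ContForm E X (k + 1)) (hu : IsSmooth u.1),
      ∃ ζ ∈ closedForms E X (k + 1), ‖D.lift (u - ζ)‖ ≤ C * ‖D.lift (dCont u hu)‖ := by
  obtain ⟨ρ, hρ⟩ := D.exists_partitionOfUnity
  obtain ⟨R, hR⟩ := D.exists_isRegularizer k
  by_contra hcon
  push Not at hcon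
  -- If no constant works, there are forms of norm at most `1`, at distance at least `1 / 2` from
  -- the closed ones, whose differentials tend to zero.
  choose v hv hv1 hvd hvζ using fun n : ℕ => exists_normalized (D := D) hcon
    (Nat.one_div_pos_of_nat (α := ℝ) (n := n)) (lift_injective ρ hρ)
  obtain ⟨L, hL0, hL⟩ := exists_lipschitz_bound hρ hR
  obtain ⟨C₁, hC₁0, hC₁⟩ := hR.bound
  have hmem : ∀ n, D.lift (R (v n)) ∈ {f : D.SupSpace (k + 1) | ∀ i, (∀ y, ‖f i y‖ ≤ C₁) ∧
      ∀ y y', ‖f i y - f i y'‖ ≤ L * dist y y'} := by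
    intro n i
    refine ⟨fun y => ?_, fun y y' => ?_⟩
    · refine (SupSpace.norm_apply_le D _ i y).trans ((hC₁ _).trans ?_)
      exact (mul_le_mul_of_nonneg_left (hv1 n) hC₁0).trans (by rw [mul_one])
    · have h1 := hL (D.lift (v n)) i y y.2 y' y'.2
      rw [glue_lift] at h1
      refine h1.trans ?_
      rw [Subtype.dist_eq, dist_eq_norm]
      refine mul_le_mul_of_nonneg_right ?_ (norm_nonneg _)
      exact (mul_le_mul_of_nonneg_left (hv1 n) hL0).trans (by rw [mul_one])
  -- The regularized sequence is bounded and uniformly Lipschitz, so a subsequence converges.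
  obtain ⟨g, _, φ, hφ, hlim⟩ := (isCompact_lipschitz D C₁ L).tendsto_subseq hmem
  have happ : ∀ δ > 0, ∃ n, ‖D.lift (dCont (v n) (hv n))‖ ≤ δ ∧ ‖g - D.lift (R (v n))‖ ≤ δ := by
    intro δ hδ
    have h1 : ∀ᶠ n in Filter.atTop, ‖g - D.lift (R (v (φ n)))‖ < δ := by
      have := Metric.tendsto_nhds.mp hlim δ hδ
      filter_upwards [this] with n hn
      rwa [dist_comm, dist_eq_norm] at hn
    have h2 : ∀ᶠ n in Filter.atTop, 1 / ((φ n : ℝ) + 1) < δ :=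
      (tendsto_one_div_add_atTop_nhds_zero_nat.comp hφ.tendsto_atTop).eventually_lt_const hδ
    obtain ⟨n, h3, h4⟩ := (h1.and h2).exists
    exact ⟨φ n, (hvd _).trans h4.le, h3.le⟩
  have hg : extD (R (glue ρ hρ g)).1 = 0 := by
    refine extD_regularizer_glue_eq_zero hρ hR g fun δ hδ => ?_
    obtain ⟨n, h⟩ := happ δ hδ
    exact ⟨v n, hv n, h⟩
  obtain ⟨B, hB0, hB⟩ := exists_closed_near hρ hR
  -- With this accuracy the distance from a closed form is at most `B / (4 (B + 1)) < 1 / 2`, a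
  -- contradiction.
  obtain ⟨n, h1, h2⟩ := happ (1 / (4 * (B + 1))) (by positivity)
  obtain ⟨ζ, hζ, hζn⟩ := hB g (v n) (hv n) _ h1 h2 hg
  have h3 := (hvζ n ζ hζ).trans hζn
  rw [mul_one_div, div_le_div_iff₀ (by norm_num) (by positivity)] at h3
  linarith

end ClosedApproximation

/-! ### Complex conjugation, components, and values on complex frames. -/

section Conjugation

variable {M : Type*} [AddCommGroup M] [Module ℂ M] [TopologicalSpace M] {k : ℕ}

/-- The complex conjugate of a form. -/
def conjForm (f : M [⋀^Fin k]→L[ℝ] ℂ) : M [⋀^Fin k]→L[ℝ] ℂ :=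
  (Complex.conjCLE : ℂ →L[ℝ] ℂ).compContinuousAlternatingMap f

@[simp] theorem conjForm_apply (f : M [⋀^Fin k]→L[ℝ] ℂ) (v : Fin k → M) :
    conjForm f v = starRingEnd ℂ (f v) := rfl

theorem IsType.conjForm {p q : ℕ} {f : M [⋀^Fin k]→L[ℝ] ℂ} (hf : IsType p q f) :
    IsType q p (conjForm f) := by
  intro c v
  rw [conjForm_apply, conjForm_apply, hf c v]
  simp only [map_mul, map_pow, Complex.conj_conj]
  ring

theorem typeProj_add [ContinuousConstSMul ℂ M] (p : ℕ) (f g : M [⋀^Fin k]→L[ℝ] ℂ) :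
    typeProj p (f + g) = typeProj p f + typeProj p g := by
  ext v
  rw [ContinuousAlternatingMap.add_apply, typeProj_apply, typeProj_apply, typeProj_apply, ← mul_add,
    ← Finset.sum_add_distrib]
  simp only [ContinuousAlternatingMap.add_apply, mul_add]

theorem typeProj_real_smul [ContinuousConstSMul ℂ M] (p : ℕ) (c : ℝ) (f : M [⋀^Fin k]→L[ℝ] ℂ) :
    typeProj p (c • f) = c • typeProj p f := by
  ext v
  rw [ContinuousAlternatingMap.smul_apply, typeProj_apply, typeProj_apply, Complex.real_smul,
    Finset.mul_sum, Finset.mul_sum, Finset.mul_sum]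
  refine Finset.sum_congr rfl fun j _ => ?_
  rw [ContinuousAlternatingMap.smul_apply, Complex.real_smul]
  ring

theorem typeProj_zero [ContinuousConstSMul ℂ M] (p : ℕ) :
    typeProj p (0 : M [⋀^Fin k]→L[ℝ] ℂ) = 0 := by
  ext v
  rw [typeProj_apply]
  simp

theorem typeProj_sum [ContinuousConstSMul ℂ M] {ι : Type*} (p : ℕ) (s : Finset ι)
    (f : ι → M [⋀^Fin k]→L[ℝ] ℂ) : typeProj p (∑ i ∈ s, f i) = ∑ i ∈ s, typeProj p (f i) := by
  classical
  induction s using Finset.induction_on with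
  | empty => exact typeProj_zero p
  | insert a s ha ih => rw [Finset.sum_insert ha, Finset.sum_insert ha, typeProj_add, ih]

/-- Pullback under a complex linear map preserves types. -/
theorem IsType.comp {M' : Type*} [AddCommGroup M'] [Module ℂ M'] [TopologicalSpace M'] {p q : ℕ}
    {f : M [⋀^Fin k]→L[ℝ] ℂ} (hf : IsType p q f) (L : M' →L[ℂ] M) :
    IsType p q (f.compContinuousLinearMap (L.restrictScalars ℝ)) := by
  intro c v
  have h : (fun i => L (c • v i)) = fun i => c • L (v i) := by
    ext1 i; exact L.map_smul c (v i)
  exact (congrArg f h).trans (hf c fun i => L (v i))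

theorem map_complexFrame {M' : Type*} [AddCommGroup M'] [Module ℂ M'] {m : ℕ} (L : M' →ₗ[ℂ] M)
    (v : Fin m → M') : (fun j => L (complexFrame v j)) = complexFrame fun i => L (v i) := by
  ext1 j
  rw [complexFrame, complexFrame]
  split_ifs
  · rfl
  · exact L.map_smul _ _

end Conjugation

section FrameValues

variable {E : Type*} [NormedAddCommGroup E] [NormedSpace ℂ E] [FiniteDimensional ℂ E] {m : ℕ}

/-- Pull the form back to `ℂ^m` along the map that sends the standard frame to `v`. If `p + q = 2m`
and the type is not `(m, m)`, then `p` or `q` exceeds the dimension `m`, and the form or its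
conjugate vanishes. -/
theorem IsType.apply_complexFrame_eq_zero {p q : ℕ} {f : E [⋀^Fin (2 * m)]→L[ℝ] ℂ}
    (hf : IsType p q f) (h : (p, q) ≠ (m, m)) (v : Fin m → E) : f (complexFrame v) = 0 := by
  by_cases hpq : p + q = 2 * m
  swap
  · rw [hf.eq_zero_of_add_ne hpq]
    rfl
  let L : (Fin m → ℂ) →L[ℂ] E := LinearMap.toContinuousLinearMap (Fintype.linearCombination ℂ v)
  have hL : ∀ i, L (Pi.single i 1) = v i := fun i => by
    simp [L, Fintype.linearCombination_apply_single]
  have h1 : f.compContinuousLinearMap (L.restrictScalars ℝ)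
      (complexFrame fun i => Pi.single i 1) = f (complexFrame v) := by
    have h2 := map_complexFrame (L : (Fin m → ℂ) →ₗ[ℂ] E) fun i => Pi.single i 1
    refine (congrArg f h2).trans (congrArg (fun w => f (complexFrame w)) ?_)
    ext1 i
    exact hL i
  rw [← h1]
  rcases lt_or_ge m p with hp | hp
  · rw [(hf.comp L).eq_zero_of_finrank_lt (by simpa using hp)]
    rfl
  · have hq : m < q := by
      by_contra hq
      exact h (by rw [Prod.mk.injEq]; omega)
    have h3 := (hf.comp L).conjForm.eq_zero_of_finrank_lt (by simpa using hq)
    have h4 := congrArg (fun g => g (complexFrame fun i => Pi.single i 1)) h3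
    simpa using h4

/-- All other components vanish on complex frames, so positivity on complex planes concerns the `(m,
m)` component alone. -/
theorem typeProj_apply_complexFrame (f : E [⋀^Fin (2 * m)]→L[ℝ] ℂ) (v : Fin m → E) :
    typeProj m f (complexFrame v) = f (complexFrame v) := by
  conv_rhs => rw [← sum_typeProj f]
  rw [ContinuousAlternatingMap.sum_apply, Finset.sum_eq_single m]
  · intro p hp hpm
    refine (isType_typeProj (by simp at hp; omega) f).apply_complexFrame_eq_zero ?_ v
    intro h
    exact hpm (Prod.mk.inj h).1
  · intro h
    simp at h
    omega

theorem isType_typeProj_middle (f : E [⋀^Fin (2 * m)]→L[ℝ] ℂ) : IsType m m (typeProj m f) := by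
  have h := isType_typeProj (p := m) (by omega) f
  rwa [show 2 * m - m = m by omega] at h

end FrameValues

/-! ### The operators `∂` and `∂̄` in coordinates. -/

section LocalOperators

variable {E : Type*} [NormedAddCommGroup E] [NormedSpace ℂ E] [FiniteDimensional ℂ E] {k : ℕ}
  {F G : E → E [⋀^Fin k]→L[ℝ] ℂ} {y : E}

theorem localDel_apply (v : Fin (k + 1) → E) :
    localDel F y v = ∑ i : Fin (k + 1), (-1) ^ (i : ℕ) * ((1 / 2) *
      (fderiv ℝ F y (v i) (i.removeNth v) -
        Complex.I * fderiv ℝ F y (Complex.I • v i) (i.removeNth v))) := by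
  rw [localDel, ContinuousAlternatingMap.alternatizeUncurryFin_apply]
  refine Finset.sum_congr rfl fun i _ => ?_
  rw [zsmul_eq_mul]
  push_cast
  rfl

theorem localDelBar_apply (v : Fin (k + 1) → E) :
    localDelBar F y v = ∑ i : Fin (k + 1), (-1) ^ (i : ℕ) * ((1 / 2) *
      (fderiv ℝ F y (v i) (i.removeNth v) +
        Complex.I * fderiv ℝ F y (Complex.I • v i) (i.removeNth v))) := by
  rw [localDelBar, ContinuousAlternatingMap.alternatizeUncurryFin_apply]
  refine Finset.sum_congr rfl fun i _ => ?_
  rw [zsmul_eq_mul]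
  push_cast
  rfl

theorem extDeriv_apply_sum (v : Fin (k + 1) → E) :
    extDeriv F y v = ∑ i : Fin (k + 1), (-1) ^ (i : ℕ) * fderiv ℝ F y (v i) (i.removeNth v) := by
  rw [extDeriv, ContinuousAlternatingMap.alternatizeUncurryFin_apply]
  refine Finset.sum_congr rfl fun i _ => ?_
  rw [zsmul_eq_mul]
  push_cast
  rfl

theorem localDel_add_localDelBar : localDel F y + localDelBar F y = extDeriv F y := by
  ext v
  rw [ContinuousAlternatingMap.add_apply, localDel_apply, localDelBar_apply, extDeriv_apply_sum,
    ← Finset.sum_add_distrib]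
  refine Finset.sum_congr rfl fun i _ => ?_
  ring

theorem localDel_add (hF : DifferentiableAt ℝ F y) (hG : DifferentiableAt ℝ G y) :
    localDel (F + G) y = localDel F y + localDel G y := by
  ext v
  rw [ContinuousAlternatingMap.add_apply, localDel_apply, localDel_apply, localDel_apply,
    fderiv_add hF hG, ← Finset.sum_add_distrib]
  refine Finset.sum_congr rfl fun i _ => ?_
  simp only [_root_.add_apply, ContinuousAlternatingMap.add_apply]
  ring

theorem localDelBar_add (hF : DifferentiableAt ℝ F y) (hG : DifferentiableAt ℝ G y) :
    localDelBar (F + G) y = localDelBar F y + localDelBar G y := by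
  ext v
  rw [ContinuousAlternatingMap.add_apply, localDelBar_apply, localDelBar_apply, localDelBar_apply,
    fderiv_add hF hG, ← Finset.sum_add_distrib]
  refine Finset.sum_congr rfl fun i _ => ?_
  simp only [_root_.add_apply, ContinuousAlternatingMap.add_apply]
  ring

theorem localDelBar_neg : localDelBar (-F) y = -localDelBar F y := by
  ext v
  rw [ContinuousAlternatingMap.neg_apply, localDelBar_apply, localDelBar_apply, fderiv_neg,
    ← Finset.sum_neg_distrib]
  refine Finset.sum_congr rfl fun i _ => ?_
  simp only [_root_.neg_apply, ContinuousAlternatingMap.neg_apply]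
  ring

theorem fderiv_form_apply (hF : DifferentiableAt ℝ F y) (w : E) (u : Fin k → E) :
    fderiv ℝ F y w u = fderiv ℝ (fun z => F z u) y w := by
  let ev : (E [⋀^Fin k]→L[ℝ] ℂ) →ₗ[ℝ] ℂ :=
    { toFun := fun α => α u
      map_add' := fun _ _ => rfl
      map_smul' := fun _ _ => rfl }
  have h := ((LinearMap.toContinuousLinearMap ev).hasFDerivAt.comp y hF.hasFDerivAt).fderiv
  exact (congrArg (fun L : E →L[ℝ] ℂ => L w) h).symm

theorem differentiableAt_form_apply (hF : DifferentiableAt ℝ F y) (u : Fin k → E) :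
    DifferentiableAt ℝ (fun z => F z u) y := by
  let ev : (E [⋀^Fin k]→L[ℝ] ℂ) →ₗ[ℝ] ℂ :=
    { toFun := fun α => α u
      map_add' := fun _ _ => rfl
      map_smul' := fun _ _ => rfl }
  exact (LinearMap.toContinuousLinearMap ev).differentiableAt.comp y hF

theorem isType_fderiv {p q : ℕ} (hF : DifferentiableAt ℝ F y) (h : ∀ᶠ z in 𝓝 y, IsType p q (F z))
    (w : E) : IsType p q (fderiv ℝ F y w) := by
  intro c u
  have h1 : (fun z => F z (fun i => c • u i)) =ᶠ[𝓝 y]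
      fun z => (c ^ p * (starRingEnd ℂ c) ^ q) * F z u := by
    filter_upwards [h] with z hz
    exact hz c u
  rw [fderiv_form_apply hF, h1.fderiv_eq, fderiv_form_apply hF,
    fderiv_const_mul (differentiableAt_form_apply hF u)]
  rfl

theorem fderiv_smul_apply (c : ℂ) (w : E) (u : Fin k → E) : fderiv ℝ F y (c • w) u =
    c.re * fderiv ℝ F y w u + c.im * fderiv ℝ F y (Complex.I • w) u := by
  rw [smul_decomp c w, map_add, map_smul, map_smul]
  simp

theorem removeNth_smul (c : ℂ) (v : Fin (k + 1) → E) (i : Fin (k + 1)) :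
    i.removeNth (fun j => c • v j) = fun j => c • i.removeNth v j := rfl

/-- A directional derivative keeps the type, and `w ↦ D_w F - i D_{iw} F` is complex linear in `w`,
which contributes one more factor `c`. -/
theorem isType_localDel {p q : ℕ} (hF : DifferentiableAt ℝ F y)
    (h : ∀ᶠ z in 𝓝 y, IsType p q (F z)) : IsType (p + 1) q (localDel F y) := by
  intro c v
  rw [localDel_apply, localDel_apply, Finset.mul_sum]
  refine Finset.sum_congr rfl fun i _ => ?_
  rw [removeNth_smul, isType_fderiv hF h _ c, isType_fderiv hF h _ c, smul_smul,
    fderiv_smul_apply c, fderiv_smul_apply (Complex.I * c)]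
  simp only [Complex.mul_re, Complex.mul_im, Complex.I_re, Complex.I_im, zero_mul, one_mul, zero_sub,
    zero_add, Complex.ofReal_neg]
  have hc : (c.re : ℂ) + c.im * Complex.I = c := Complex.re_add_im c
  set A := fderiv ℝ F y (v i) (i.removeNth v)
  set B := fderiv ℝ F y (Complex.I • v i) (i.removeNth v)
  have key : (c.re * A + c.im * B) - Complex.I * (-(c.im : ℂ) * A + c.re * B) =
      c * (A - Complex.I * B) := by
    conv_rhs => rw [← hc]
    linear_combination (c.im * B) * Complex.I_sq
  linear_combination (-1) ^ (i : ℕ) * (1 / 2) * (c ^ p * (starRingEnd ℂ c) ^ q) * key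

theorem isType_localDelBar {p q : ℕ} (hF : DifferentiableAt ℝ F y)
    (h : ∀ᶠ z in 𝓝 y, IsType p q (F z)) : IsType p (q + 1) (localDelBar F y) := by
  intro c v
  rw [localDelBar_apply, localDelBar_apply, Finset.mul_sum]
  refine Finset.sum_congr rfl fun i _ => ?_
  rw [removeNth_smul, isType_fderiv hF h _ c, isType_fderiv hF h _ c, smul_smul,
    fderiv_smul_apply c, fderiv_smul_apply (Complex.I * c)]
  simp only [Complex.mul_re, Complex.mul_im, Complex.I_re, Complex.I_im, zero_mul, one_mul, zero_sub,
    zero_add, Complex.ofReal_neg]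
  have hc : (c.re : ℂ) - c.im * Complex.I = starRingEnd ℂ c := by
    apply Complex.ext <;> simp
  set A := fderiv ℝ F y (v i) (i.removeNth v)
  set B := fderiv ℝ F y (Complex.I • v i) (i.removeNth v)
  have key : (c.re * A + c.im * B) + Complex.I * (-(c.im : ℂ) * A + c.re * B) =
      starRingEnd ℂ c * (A + Complex.I * B) := by
    conv_rhs => rw [← hc]
    linear_combination (c.im * B) * Complex.I_sq
  linear_combination (-1) ^ (i : ℕ) * (1 / 2) * (c ^ p * (starRingEnd ℂ c) ^ q) * key

theorem extDeriv_conjForm (hF : DifferentiableAt ℝ F y) :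
    extDeriv (fun z => conjForm (F z)) y = conjForm (extDeriv F y) := by
  ext v
  have hd : DifferentiableAt ℝ (fun z => conjForm (F z)) y := by
    let L : (E [⋀^Fin k]→L[ℝ] ℂ) →ₗ[ℝ] (E [⋀^Fin k]→L[ℝ] ℂ) :=
      { toFun := conjForm
        map_add' := fun f g => by ext v; simp
        map_smul' := fun c f => by ext v; simp }
    exact (LinearMap.toContinuousLinearMap L).differentiableAt.comp y hF
  rw [conjForm_apply, extDeriv_apply_sum, extDeriv_apply_sum, map_sum]
  refine Finset.sum_congr rfl fun i _ => ?_
  rw [fderiv_form_apply hd, map_mul, fderiv_form_apply hF]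
  have h := (Complex.conjCLE.toContinuousLinearMap.hasFDerivAt.comp y
    (differentiableAt_form_apply hF (i.removeNth v)).hasFDerivAt).fderiv
  have h2 := congrArg (fun L : E →L[ℝ] ℂ => L (v i)) h
  simp only [map_pow, map_neg, map_one]
  exact congrArg _ h2

end LocalOperators

/-! ### Smoothness of fibrewise operations. -/

section SmoothOperations

theorem contDiffAt_linearMap₂ {Z A V W : Type*} [NormedAddCommGroup Z] [NormedSpace ℝ Z]
    [NormedAddCommGroup A] [NormedSpace ℝ A] [FiniteDimensional ℝ A]
    [NormedAddCommGroup V] [NormedSpace ℝ V] [FiniteDimensional ℝ V]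
    [NormedAddCommGroup W] [NormedSpace ℝ W] (B : A →ₗ[ℝ] V →ₗ[ℝ] W) {n : WithTop ℕ∞}
    {a : Z → A} {v : Z → V} {z : Z} (ha : ContDiffAt ℝ n a z) (hv : ContDiffAt ℝ n v z) :
    ContDiffAt ℝ n (fun x => B (a x) (v x)) z :=
  contDiffAt_bilinear (LinearMap.toContinuousLinearMap
    ((LinearMap.toContinuousLinearMap (𝕜 := ℝ) (E := V) (F' := W)).toLinearMap ∘ₗ B)) ha hv

variable {E : Type*} [NormedAddCommGroup E] [NormedSpace ℂ E] [FiniteDimensional ℂ E] {k l : ℕ}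

variable (E) in
theorem contDiff_typeProj (p : ℕ) :
    ContDiff ℝ ∞ (typeProj p : (E [⋀^Fin k]→L[ℝ] ℂ) → E [⋀^Fin k]→L[ℝ] ℂ) := by
  let L : (E [⋀^Fin k]→L[ℝ] ℂ) →ₗ[ℝ] (E [⋀^Fin k]→L[ℝ] ℂ) :=
    { toFun := typeProj p
      map_add' := typeProj_add p
      map_smul' := typeProj_real_smul p }
  exact (LinearMap.toContinuousLinearMap L).contDiff

variable (E) in
theorem contDiff_conjForm :
    ContDiff ℝ ∞ (conjForm : (E [⋀^Fin k]→L[ℝ] ℂ) → E [⋀^Fin k]→L[ℝ] ℂ) := by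
  let L : (E [⋀^Fin k]→L[ℝ] ℂ) →ₗ[ℝ] (E [⋀^Fin k]→L[ℝ] ℂ) :=
    { toFun := conjForm
      map_add' := fun f g => by ext v; simp
      map_smul' := fun c f => by ext v; simp }
  exact (LinearMap.toContinuousLinearMap L).contDiff

variable (E k l) in
/-- The exterior product as a bilinear map. -/
def wedgeBilin : (E [⋀^Fin k]→L[ℝ] ℂ) →ₗ[ℝ] (E [⋀^Fin l]→L[ℝ] ℂ) →ₗ[ℝ]
    (E [⋀^Fin (k + l)]→L[ℝ] ℂ) :=
  have hs : ∀ {j : ℕ} (c : ℝ) (α : E [⋀^Fin j]→L[ℝ] ℂ), c • α = (c : ℂ) • α := fun c α => by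
    ext v; simp
  LinearMap.mk₂ ℝ wedge (fun α α' β => wedge_add_left α α' β)
    (fun c α β => by rw [hs, wedge_smul_left, ← hs]) (fun α β β' => wedge_add_right α β β')
    (fun c α β => by rw [hs, wedge_smul_right, ← hs])

variable (E) in
theorem contDiff_wedgePow (m : ℕ) :
    ContDiff ℝ ∞ (fun γ : E [⋀^Fin 2]→L[ℝ] ℂ => wedgePow γ m) := by
  induction m with
  | zero => exact contDiff_const
  | succ m ih =>
    refine contDiff_iff_contDiffAt.mpr fun γ => ?_
    exact contDiffAt_linearMap₂ (wedgeBilin E (2 * m) 2) ih.contDiffAt contDiffAt_id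

end SmoothOperations

/-! ### The operators `∂` and `∂̄` on the manifold, and components of forms. -/

section Pointwise

variable {E : Type*} [NormedAddCommGroup E] [NormedSpace ℂ E] [FiniteDimensional ℂ E]
  {X : Type*} [TopologicalSpace X] [ChartedSpace E X] [IsManifold 𝓘(ℂ, E) ω X] {k l : ℕ}
  {e : OpenPartialHomeomorph X E}

theorem IsSmooth.of_inChart_eq {φ : RoughForm E X k} {ψ : RoughForm E X l} (hφ : IsSmooth φ)
    {F : (E [⋀^Fin k]→L[ℝ] ℂ) → E [⋀^Fin l]→L[ℝ] ℂ}
    (h : ∀ e ∈ atlas E X, ∀ y ∈ e.target, inChart ψ e y = F (inChart φ e y))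
    (hF : ∀ e ∈ atlas E X, ∀ y ∈ e.target, ContDiffAt ℝ ∞ F (inChart φ e y)) : IsSmooth ψ := by
  intro e he
  refine ContDiffOn.congr (f := fun y => F (inChart φ e y)) (fun y hy => ?_) fun y hy => h e he y hy
  exact (ContDiffAt.comp y (hF e he y hy)
    ((hφ e he).contDiffAt (e.open_target.mem_nhds hy))).contDiffWithinAt

theorem inChart_typeProj (p : ℕ) (φ : RoughForm E X k) (y : E) :
    inChart (fun x => typeProj p (φ x)) e y = typeProj p (inChart φ e y) := by
  ext v
  rw [inChart_apply, typeProj_apply, typeProj_apply]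
  congr 1
  refine Finset.sum_congr rfl fun j _ => ?_
  congr 1
  rw [inChart_apply]
  refine congrArg (φ (e.symm y)) ?_
  ext1 i
  exact (ContinuousLinearMap.map_smul _ _ _).symm

theorem isSmooth_typeProj (p : ℕ) {φ : RoughForm E X k} (hφ : IsSmooth φ) :
    IsSmooth (fun x => typeProj p (φ x)) :=
  hφ.of_inChart_eq (fun _ _ y _ => inChart_typeProj p φ y)
    fun _ _ _ _ => (contDiff_typeProj E p).contDiffAt

theorem isSmooth_conjForm {φ : RoughForm E X k} (hφ : IsSmooth φ) :
    IsSmooth (fun x => conjForm (φ x)) :=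
  hφ.of_inChart_eq (F := conjForm) (fun _ _ _ _ => rfl)
    fun _ _ _ _ => (contDiff_conjForm E).contDiffAt

theorem inChart_wedgePow (γ : RoughForm E X 2) (m : ℕ) (y : E) :
    inChart (fun x => wedgePow (γ x) m) e y = wedgePow (inChart γ e y) m :=
  wedgePow_compContinuousLinearMap _ _ _

theorem isSmooth_wedgePow {γ : RoughForm E X 2} (hγ : IsSmooth γ) (m : ℕ) :
    IsSmooth (fun x => wedgePow (γ x) m) :=
  hγ.of_inChart_eq (fun _ _ y _ => inChart_wedgePow γ m y)
    fun _ _ _ _ => (contDiff_wedgePow E m).contDiffAt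

theorem isType_inChart {p q : ℕ} {φ : RoughForm E X k} (h : ∀ x, IsType p q (φ x)) (y : E) :
    IsType p q (inChart φ e y) :=
  (h _).comp (mfderiv 𝓘(ℂ, E) 𝓘(ℂ, E) e.symm y)

theorem IsSmooth.differentiableAt {φ : RoughForm E X k} (hφ : IsSmooth φ) (x : X) :
    DifferentiableAt ℝ (inChart φ (chartAt E x)) (chartAt E x x) :=
  ((hφ _ (chart_mem_atlas E x)).contDiffAt
    ((chartAt E x).open_target.mem_nhds (mem_chart_target E x))).differentiableAt (by simp)

theorem del_add_delBar (φ : RoughForm E X k) : del φ + delBar φ = extD φ := by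
  funext x
  ext v
  have h := localDel_add_localDelBar (F := inChart φ (chartAt E x)) (y := chartAt E x x)
  exact congrArg (fun α : E [⋀^Fin (k + 1)]→L[ℝ] ℂ =>
    α fun i => mfderiv 𝓘(ℂ, E) 𝓘(ℂ, E) (chartAt E x) x (v i)) h

theorem isType_del {p q : ℕ} {φ : RoughForm E X k} (hφ : IsSmooth φ) (h : ∀ x, IsType p q (φ x))
    (x : X) : IsType (p + 1) q (del φ x) :=
  (isType_localDel (hφ.differentiableAt x) (Filter.Eventually.of_forall (isType_inChart h))).comp
    (mfderiv 𝓘(ℂ, E) 𝓘(ℂ, E) (chartAt E x) x)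

theorem isType_delBar {p q : ℕ} {φ : RoughForm E X k} (hφ : IsSmooth φ) (h : ∀ x, IsType p q (φ x))
    (x : X) : IsType p (q + 1) (delBar φ x) :=
  (isType_localDelBar (hφ.differentiableAt x)
    (Filter.Eventually.of_forall (isType_inChart h))).comp
      (mfderiv 𝓘(ℂ, E) 𝓘(ℂ, E) (chartAt E x) x)

theorem del_add {φ ψ : RoughForm E X k} (hφ : IsSmooth φ) (hψ : IsSmooth ψ) :
    del (φ + ψ) = del φ + del ψ := by
  funext x
  ext v
  have h := localDel_add (hφ.differentiableAt x) (hψ.differentiableAt x)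
  rw [← inChart_add] at h
  exact congrArg (fun α : E [⋀^Fin (k + 1)]→L[ℝ] ℂ =>
    α fun i => mfderiv 𝓘(ℂ, E) 𝓘(ℂ, E) (chartAt E x) x (v i)) h

theorem delBar_add {φ ψ : RoughForm E X k} (hφ : IsSmooth φ) (hψ : IsSmooth ψ) :
    delBar (φ + ψ) = delBar φ + delBar ψ := by
  funext x
  ext v
  have h := localDelBar_add (hφ.differentiableAt x) (hψ.differentiableAt x)
  rw [← inChart_add] at h
  exact congrArg (fun α : E [⋀^Fin (k + 1)]→L[ℝ] ℂ =>
    α fun i => mfderiv 𝓘(ℂ, E) 𝓘(ℂ, E) (chartAt E x) x (v i)) h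

theorem inChart_neg (φ : RoughForm E X k) : inChart (-φ) e = -inChart φ e := by
  ext y v; rfl

theorem delBar_neg (φ : RoughForm E X k) : delBar (-φ) = -delBar φ := by
  funext x
  ext v
  have h := localDelBar_neg (F := inChart φ (chartAt E x)) (y := chartAt E x x)
  rw [← inChart_neg] at h
  exact congrArg (fun α : E [⋀^Fin (k + 1)]→L[ℝ] ℂ =>
    α fun i => mfderiv 𝓘(ℂ, E) 𝓘(ℂ, E) (chartAt E x) x (v i)) h

theorem del_zero : del (0 : RoughForm E X k) = 0 :=
  left_eq_add.mp ((del_add (smoothForms E X k).zero_mem (smoothForms E X k).zero_mem).symm.trans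
    (congrArg del (add_zero _))).symm

theorem delBar_zero : delBar (0 : RoughForm E X k) = 0 :=
  left_eq_add.mp ((delBar_add (smoothForms E X k).zero_mem (smoothForms E X k).zero_mem).symm.trans
    (congrArg delBar (add_zero _))).symm

theorem del_sum {ι : Type*} (s : Finset ι) {φ : ι → RoughForm E X k} (h : ∀ i, IsSmooth (φ i)) :
    del (∑ i ∈ s, φ i) = ∑ i ∈ s, del (φ i) := by
  classical
  induction s using Finset.induction_on with
  | empty => exact del_zero
  | insert a s ha ih =>
    rw [Finset.sum_insert ha, Finset.sum_insert ha,
      del_add (h a) ((smoothForms E X k).sum_mem fun i _ => h i), ih]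

theorem delBar_sum {ι : Type*} (s : Finset ι) {φ : ι → RoughForm E X k} (h : ∀ i, IsSmooth (φ i)) :
    delBar (∑ i ∈ s, φ i) = ∑ i ∈ s, delBar (φ i) := by
  classical
  induction s using Finset.induction_on with
  | empty => exact delBar_zero
  | insert a s ha ih =>
    rw [Finset.sum_insert ha, Finset.sum_insert ha,
      delBar_add (h a) ((smoothForms E X k).sum_mem fun i _ => h i), ih]

theorem sum_typeProj_eq (φ : RoughForm E X k) :
    ∑ p ∈ Finset.range (k + 2), (fun x => typeProj p (φ x)) = φ := by
  funext x
  rw [Finset.sum_apply, Finset.sum_range_succ, typeProj_succ_eq_zero, add_zero]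
  exact sum_typeProj (φ x)

/-- Decompose `φ`: the operator raises the first degree of each component by one, so exactly one of
them contributes. Index `k + 1`, whose component is zero, is included to cover all `p` allowed. -/
theorem typeProj_del {p : ℕ} (hp : p ≤ k + 1) {φ : RoughForm E X k} (hφ : IsSmooth φ) (x : X) :
    typeProj (p + 1) (del φ x) = del (fun x => typeProj p (φ x)) x := by
  have h : ∀ r, IsSmooth (fun x => typeProj r (φ x)) := fun r => isSmooth_typeProj r hφ
  conv_lhs => rw [← sum_typeProj_eq φ, del_sum _ h, Finset.sum_apply, typeProj_sum]
  rw [Finset.sum_eq_single p]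
  · rw [(isType_del (h p) (fun x => isType_typeProj hp (φ x)) x).typeProj_eq (by omega), if_pos rfl]
  · intro r hr hrp
    rw [(isType_del (h r) (fun x => isType_typeProj (by simp at hr; omega) (φ x)) x).typeProj_eq
      (by omega), if_neg (by omega)]
  · intro h'
    simp at h'
    omega

theorem typeProj_delBar {p : ℕ} (hp : p ≤ k + 1) {φ : RoughForm E X k} (hφ : IsSmooth φ) (x : X) :
    typeProj p (delBar φ x) = delBar (fun x => typeProj p (φ x)) x := by
  have h : ∀ r, IsSmooth (fun x => typeProj r (φ x)) := fun r => isSmooth_typeProj r hφ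
  conv_lhs => rw [← sum_typeProj_eq φ, delBar_sum _ h, Finset.sum_apply, typeProj_sum]
  rw [Finset.sum_eq_single p]
  · rw [(isType_delBar (h p) (fun x => isType_typeProj hp (φ x)) x).typeProj_eq (by omega),
      if_pos rfl]
  · intro r hr hrp
    rw [(isType_delBar (h r) (fun x => isType_typeProj (by simp at hr; omega) (φ x)) x).typeProj_eq
      (by omega), if_neg (by omega)]
  · intro h'
    simp at h'
    omega

/-- The components of a closed form. -/
theorem del_typeProj_eq_neg_delBar {p : ℕ} (hp : p ≤ k) {φ : RoughForm E X k} (hφ : IsSmooth φ)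
    (hd : extD φ = 0) :
    del (fun x => typeProj p (φ x)) = -delBar (fun x => typeProj (p + 1) (φ x)) := by
  funext x
  rw [Pi.neg_apply, eq_neg_iff_add_eq_zero, ← typeProj_del (by omega) hφ, ← typeProj_delBar (by omega) hφ,
    ← typeProj_add]
  have h := congrFun ((del_add_delBar φ).trans hd) x
  rw [Pi.add_apply] at h
  rw [h]
  exact typeProj_zero _

theorem extD_conjForm {φ : RoughForm E X k} (hφ : IsSmooth φ) :
    extD (fun x => conjForm (φ x)) = fun x => conjForm (extD φ x) := by
  funext x
  ext v
  have h := extDeriv_conjForm (hφ.differentiableAt x)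
  exact congrArg (fun α : E [⋀^Fin (k + 1)]→L[ℝ] ℂ =>
    α fun i => mfderiv 𝓘(ℂ, E) 𝓘(ℂ, E) (chartAt E x) x (v i)) h

end Pointwise

/-! ### Positivity on complex planes. -/

section FramePositivity

open Matrix
open scoped ComplexOrder

/-- The real part of a form is positive on all complex planes of the appropriate dimension. -/
def FramePos {M : Type*} [AddCommGroup M] [Module ℂ M] [TopologicalSpace M] {m : ℕ}
    (α : M [⋀^Fin (2 * m)]→L[ℝ] ℂ) : Prop :=
  ∀ v : Fin m → M, LinearIndependent ℂ v → 0 < (α (complexFrame v)).re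

theorem FramePos.comp {M M' : Type*} [AddCommGroup M] [Module ℂ M] [TopologicalSpace M]
    [AddCommGroup M'] [Module ℂ M'] [TopologicalSpace M'] {m : ℕ} {α : M [⋀^Fin (2 * m)]→L[ℝ] ℂ}
    (h : FramePos α) (L : M' →L[ℂ] M) (hL : Function.Injective L) :
    FramePos (α.compContinuousLinearMap (L.restrictScalars ℝ)) := by
  intro v hv
  have h1 := h (fun i => L (v i)) (hv.map' L.toLinearMap (LinearMap.ker_eq_bot.mpr hL))
  have h2 := map_complexFrame (L : M' →ₗ[ℂ] M) v
  have h3 : α.compContinuousLinearMap (L.restrictScalars ℝ) (complexFrame v) =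
    α (complexFrame fun i => L (v i)) := congrArg α h2
  rwa [h3]

variable {E : Type*} [NormedAddCommGroup E] [NormedSpace ℂ E] [FiniteDimensional ℂ E] {m : ℕ}
  (b : Module.Basis (Fin (m + 1)) ℂ E)

theorem re_ofReal_mul_pos_iff {d : ℝ} (hd : 0 < d) (z : ℂ) : 0 < ((d : ℂ) * z).re ↔ 0 < z.re := by
  rw [Complex.re_ofReal_mul, mul_pos_iff_of_pos_left hd]

/-- Independence is tested with the power of a standard metric: its Hermitian form is positive at
`c`, whereas any form vanishes on a dependent frame. -/
theorem exists_linearIndependent_frame {c : Fin (m + 1) → ℂ} (hc : c ≠ 0) :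
    ∃ v : Fin m → E, LinearIndependent ℂ v ∧ ∃ d : ℝ, 0 < d ∧ ∀ α : E [⋀^Fin (2 * m)]→L[ℝ] ℂ,
      star c ⬝ᵥ (posMat b α *ᵥ c) = d * α (complexFrame v) := by
  obtain ⟨v, d, hd, h⟩ := exists_frame_of_ne_zero b hc
  refine ⟨v, ?_, d, hd, h⟩
  by_contra hv
  have h1 := (isPosDef_hermForm b Matrix.PosDef.one).posDef_posMat b
  have h2 := h1.dotProduct_mulVec_pos hc
  rw [h, apply_complexFrame_of_not_linearIndependent hv, mul_zero] at h2
  exact lt_irrefl _ h2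

theorem framePos_iff {α : E [⋀^Fin (2 * m)]→L[ℝ] ℂ} :
    FramePos α ↔ ∀ c : Fin (m + 1) → ℂ, c ≠ 0 → 0 < (star c ⬝ᵥ (posMat b α *ᵥ c)).re := by
  constructor
  · intro h c hc
    obtain ⟨v, hv, d, hd, hα⟩ := exists_linearIndependent_frame b hc
    rw [hα, re_ofReal_mul_pos_iff hd]
    exact h v hv
  · intro h v hv
    obtain ⟨c, hc, d, hd, hα⟩ := exists_covector_of_linearIndependent b hv
    rw [hα, re_ofReal_mul_pos_iff hd]
    exact h c hc

theorem FramePos.posDef_posMat {α : E [⋀^Fin (2 * m)]→L[ℝ] ℂ} (h : FramePos α)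
    (him : ∀ v : Fin m → E, (α (complexFrame v)).im = 0) : (posMat b α).PosDef := by
  refine posDef_of_dotProduct_pos fun c hc => ?_
  obtain ⟨v, hv, d, hd, hα⟩ := exists_linearIndependent_frame b hc
  rw [hα]
  refine mul_pos (by exact_mod_cast hd) (Complex.pos_iff.mpr ⟨h v hv, (him v).symm⟩)

theorem IsPosDef.framePos {γ : E [⋀^Fin 2]→L[ℝ] ℂ} (hγ : IsPosDef γ)
    (hE : Module.finrank ℂ E = m + 1) : FramePos (wedgePow γ m) := by
  let b := Module.finBasisOfFinrankEq ℂ E hE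
  refine (framePos_iff b).mpr fun c hc => ?_
  exact (Complex.pos_iff.mp ((hγ.posDef_posMat b).dotProduct_mulVec_pos hc)).1

theorem im_wedgePow_complexFrame {γ : E [⋀^Fin 2]→L[ℝ] ℂ} (hγ : IsPosDef γ)
    (hE : Module.finrank ℂ E = m + 1) (v : Fin m → E) :
    (wedgePow γ m (complexFrame v)).im = 0 := by
  let b := Module.finBasisOfFinrankEq ℂ E hE
  by_cases hv : LinearIndependent ℂ v
  · obtain ⟨c, hc, d, hd, hα⟩ := exists_covector_of_linearIndependent b hv
    have h := (Complex.pos_iff.mp ((hγ.posDef_posMat b).dotProduct_mulVec_pos hc)).2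
    rw [hα, Complex.im_ofReal_mul, ← h, mul_zero]
  · rw [apply_complexFrame_of_not_linearIndependent hv, Complex.zero_im]

/-- In terms of `posMat` the condition is a strict inequality on nonzero covectors, homogeneous of
degree two, hence a condition on the unit sphere; joint continuity and compactness give openness. -/
theorem isOpen_setOf_framePos (hE : Module.finrank ℂ E = m + 1) :
    IsOpen {α : E [⋀^Fin (2 * m)]→L[ℝ] ℂ | FramePos α} := by
  let b := Module.finBasisOfFinrankEq ℂ E hE
  let h : (E [⋀^Fin (2 * m)]→L[ℝ] ℂ) → (Fin (m + 1) → ℂ) → ℝ := fun α c =>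
    (star c ⬝ᵥ (posMat b α *ᵥ c)).re
  have hcont : Continuous fun x : (E [⋀^Fin (2 * m)]→L[ℝ] ℂ) × (Fin (m + 1) → ℂ) => h x.1 x.2 := by
    simp only [h, dotProduct, mulVec, Pi.star_apply]
    refine Complex.continuous_re.comp (continuous_finsetSum _ fun j _ => ?_)
    refine Continuous.mul (by fun_prop) (continuous_finsetSum _ fun k _ => ?_)
    exact ((contDiff_posMat b j k).continuous.comp continuous_fst).mul (by fun_prop)
  have hset : {α : E [⋀^Fin (2 * m)]→L[ℝ] ℂ | FramePos α} =
      {α | ∀ c ∈ Metric.sphere (0 : Fin (m + 1) → ℂ) 1, 0 < h α c} := by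
    ext α
    rw [Set.mem_ofPred_eq, framePos_iff b, Set.mem_ofPred_eq]
    constructor
    · intro H c hc
      refine H c ?_
      rintro rfl
      simp at hc
    · intro H c hc
      have hn : 0 < ‖c‖ := norm_pos_iff.mpr hc
      have h1 := H ((‖c‖⁻¹ : ℂ) • c) (by simp [norm_smul, hn.ne'])
      have h2 : h α ((‖c‖⁻¹ : ℂ) • c) = ‖c‖⁻¹ ^ 2 * h α c := by
        have h3 : star ((‖c‖⁻¹ : ℂ) • c) ⬝ᵥ (posMat b α *ᵥ ((‖c‖⁻¹ : ℂ) • c)) =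
            ((‖c‖⁻¹ ^ 2 : ℝ) : ℂ) * (star c ⬝ᵥ (posMat b α *ᵥ c)) := by
          rw [star_smul, mulVec_smul, smul_dotProduct, dotProduct_smul, smul_eq_mul, smul_eq_mul,
            ← mul_assoc]
          congr 1
          simp [sq]
        change (_ : ℂ).re = _
        rw [h3, Complex.re_ofReal_mul]
      rw [h2] at h1
      exact (mul_pos_iff_of_pos_left (by positivity)).mp h1
  rw [hset, isOpen_iff_eventually]
  intro α hα
  refine (isCompact_sphere (0 : Fin (m + 1) → ℂ) 1).eventually_forall_of_forall_eventually
    fun c hc => ?_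
  exact hcont.continuousAt.eventually (lt_mem_nhds (hα c hc))

end FramePositivity

/-! ### Existence of metrics, and metrics with a prescribed power. -/

section Metrics

open scoped ComplexOrder

variable {E : Type*} [NormedAddCommGroup E] [NormedSpace ℂ E] [FiniteDimensional ℂ E]
  {X : Type*} [TopologicalSpace X] [ChartedSpace E X] [IsManifold 𝓘(ℂ, E) ω X] {m : ℕ}
  {e : OpenPartialHomeomorph X E}

theorem injective_mfderiv_symm (he : e ∈ atlas E X) {y : E} (hy : y ∈ e.target) :
    Function.Injective (mfderiv 𝓘(ℂ, E) 𝓘(ℂ, E) e.symm y) :=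
  Function.LeftInverse.injective (g := mfderiv 𝓘(ℂ, E) 𝓘(ℂ, E) e (e.symm y))
    (mfderiv_apply_mfderiv_symm he hy)

theorem injective_mfderiv (he : e ∈ atlas E X) {x : X} (hx : x ∈ e.source) :
    Function.Injective (mfderiv 𝓘(ℂ, E) 𝓘(ℂ, E) e x) :=
  Function.LeftInverse.injective (g := mfderiv 𝓘(ℂ, E) 𝓘(ℂ, E) e.symm (e x))
    (mfderiv_symm_apply_mfderiv he hx)

theorem IsPosDef.comp {M M' : Type*} [AddCommGroup M] [Module ℂ M] [TopologicalSpace M]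
    [AddCommGroup M'] [Module ℂ M'] [TopologicalSpace M'] {γ : M [⋀^Fin 2]→L[ℝ] ℂ}
    (h : IsPosDef γ) (L : M' →L[ℂ] M) (hL : Function.Injective L) :
    IsPosDef (γ.compContinuousLinearMap (L.restrictScalars ℝ)) := by
  refine ⟨h.1.comp L, fun v hv => ?_⟩
  have h1 := h.2 (L v) fun h0 => hv (hL (h0.trans L.map_zero.symm))
  have h2 : (fun i => L (![v, Complex.I • v] i)) = ![L v, Complex.I • L v] := by
    ext1 i
    fin_cases i
    · rfl
    · exact L.map_smul _ _
  have h3 : γ.compContinuousLinearMap (L.restrictScalars ℝ) ![v, Complex.I • v] =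
    γ ![L v, Complex.I • L v] := congrArg γ h2
  rwa [h3]

-- Sum over the discs a constant metric times a cutoff function. Each term is nonnegative, and at
-- every point at least one cutoff equals `1`.
variable (E X) in
theorem exists_isPosDef [CompactSpace X] [T2Space X] :
    ∃ γ : Form E X 2, ∀ x, IsPosDef (γ.val x) := by
  obtain ⟨D⟩ := exists_discCover E X
  let _ : MeasurableSpace E := borel E
  have : BorelSpace E := ⟨rfl⟩
  let κ := hermForm (Module.finBasis ℂ E) 1
  have hκ : IsPosDef κ := isPosDef_hermForm _ Matrix.PosDef.one
  let g : X → E → E [⋀^Fin 2]→L[ℝ] ℂ := fun i y => D.innerBump i y • κ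
  let γ : RoughForm E X 2 := ∑ i ∈ D.points, ofChart (chartAt E i) (g i)
  have hs : IsSmooth γ := by
    refine isSmooth_iff.mpr fun x => RegularAt.sum fun i _ => ?_
    refine regularAt_ofChart (chart_mem_atlas E i) (D.isCompact_midBall i) (D.midBall_subset i)
      (fun y hy => ?_) fun _ => ?_
    · change D.innerBump i y • κ = 0
      rw [D.innerBump_eq_zero i hy]
      exact zero_smul_form κ
    · exact (D.innerBump i).contDiffAt.smul contDiffAt_const
  have hterm : ∀ i x, IsType 1 1 (ofChart (chartAt E i) (g i) x) ∧
      ∀ v : TangentSpace 𝓘(ℂ, E) x, 0 ≤ ofChart (chartAt E i) (g i) x ![v, Complex.I • v] := by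
    intro i x
    by_cases hx : x ∈ (chartAt E i).source
    · have h1 : ofChart (chartAt E i) (g i) x =
          ((D.innerBump i (chartAt E i x) : ℝ) : ℂ) • κ.compContinuousLinearMap
            ((mfderiv 𝓘(ℂ, E) 𝓘(ℂ, E) (chartAt E i) x).restrictScalars ℝ) := by
        rw [ofChart_apply hx]
        ext v
        rfl
      have h2 := hκ.comp _ (injective_mfderiv (chart_mem_atlas E i) hx)
      rw [h1]
      refine ⟨h2.1.smul _, fun v => ?_⟩
      rw [ContinuousAlternatingMap.smul_apply, smul_eq_mul]
      refine mul_nonneg (by exact_mod_cast (D.innerBump i).nonneg) ?_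
      by_cases hv : v = 0
      · rw [hv, smul_zero]
        refine le_of_eq (ContinuousAlternatingMap.map_coord_zero _ 0 rfl).symm
      · exact (h2.2 v hv).le
    · rw [ofChart_eq_zero fun h => (hx h).elim]
      refine ⟨fun c v => ?_, fun v => le_rfl⟩
      simp
  refine ⟨⟨γ, hs⟩, fun x => ⟨?_, fun v hv => ?_⟩⟩
  · change IsType 1 1 (γ x)
    rw [show γ x = ∑ i ∈ D.points, ofChart (chartAt E i) (g i) x from Finset.sum_apply _ _ _]
    exact IsType.sum _ fun i _ => (hterm i x).1
  · change 0 < γ x _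
    rw [show γ x = ∑ i ∈ D.points, ofChart (chartAt E i) (g i) x from Finset.sum_apply _ _ _,
      ContinuousAlternatingMap.sum_apply]
    obtain ⟨i, hi, hxs, hxb⟩ := D.exists_mem x
    refine Finset.sum_pos' (fun j _ => (hterm j x).2 v) ⟨i, hi, ?_⟩
    have h2 := hκ.comp _ (injective_mfderiv (chart_mem_atlas E i) hxs)
    rw [ofChart_apply hxs]
    have h3 : D.innerBump i (chartAt E i x) = 1 :=
      (D.innerBump i).one_of_mem_closedBall (Metric.ball_subset_closedBall
        (Metric.ball_subset_ball (by change D.radius i / 2 ≤ D.radius i; linarith [D.radius_pos i]) hxb))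
    have h4 : g i (chartAt E i x) = κ := by
      change D.innerBump i (chartAt E i x) • κ = κ
      rw [h3]
      ext v
      simp
    rw [h4]
    exact h2.2 v hv

theorem finiteDimensional_tangentSpace (x : X) :
    FiniteDimensional ℂ (TangentSpace 𝓘(ℂ, E) x) := inferInstanceAs (FiniteDimensional ℂ E)

/-- A positive real form of type `(m, m)` is the `m`-th power of a metric. -/
theorem exists_metric_of_power (hm : m ≠ 0) (hE : Module.finrank ℂ E = m + 1)
    {Ω : RoughForm E X (2 * m)} (hΩ : IsSmooth Ω) (hT : ∀ x, IsType m m (Ω x))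
    (hpos : ∀ x, FramePos (Ω x)) (him : ∀ x v, (Ω x (complexFrame v)).im = 0) :
    ∃ γ : Form E X 2, (∀ x, IsPosDef (γ.val x)) ∧ ∀ x, wedgePow (γ.val x) m = Ω x := by
  let b := Module.finBasisOfFinrankEq ℂ E hE
  -- One basis of `E` serves for all tangent spaces, which are `E` by definition; nothing is claimed
  -- about its compatibility with charts.
  let γ : RoughForm E X 2 := fun x => hermRoot (E := E) b (Ω x)
  have hpd : ∀ x, (posMat (E := E) b (Ω x)).PosDef := fun x =>
    FramePos.posDef_posMat (E := E) b (hpos x) (him x)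
  have h1 : ∀ x, IsPosDef (γ x) := fun x => isPosDef_hermRoot b (hpd x)
  have h2 : ∀ x, wedgePow (γ x) m = Ω x := fun x => wedgePow_hermRoot b hm (hT x) (hpd x)
  -- The expression of `γ` in a chart is a root of that of `Ω`, and roots are unique. So it is the
  -- fixed smooth map `hermRoot b` applied to a smooth function.
  have h3 : ∀ e ∈ atlas E X, ∀ y ∈ e.target, (posMat b (inChart Ω e y)).PosDef ∧
      inChart γ e y = hermRoot b (inChart Ω e y) := by
    intro e he y hy
    have hinj := injective_mfderiv_symm he hy
    have hp : IsPosDef (inChart γ e y) := (h1 _).comp _ hinj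
    have hw : wedgePow (inChart γ e y) m = inChart Ω e y := by
      rw [← inChart_wedgePow]
      exact congrArg (fun φ : RoughForm E X (2 * m) => inChart φ e y) (funext h2)
    rw [← hw]
    exact ⟨hp.posDef_posMat b, (hermRoot_wedgePow b hm hp).symm⟩
  have hs : IsSmooth γ := hΩ.of_inChart_eq (fun e he y hy => (h3 e he y hy).2)
    fun e he y hy => contDiffAt_hermRoot b (h3 e he y hy).1
  exact ⟨⟨γ, hs⟩, h1, h2⟩

end Metrics

/-! ### Factorization of functionals, and the positive cone in the space of tuples. -/

section Duality

/-- A functional that is bounded in terms of a linear map factors through it. -/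
theorem exists_factor {V W : Type*} [AddCommGroup V] [Module ℂ V] [NormedAddCommGroup W]
    [NormedSpace ℂ W] (d : V →ₗ[ℂ] W) (T : V →ₗ[ℂ] ℂ) {C : ℝ} (h : ∀ φ, ‖T φ‖ ≤ C * ‖d φ‖) :
    ∃ S : W →L[ℂ] ℂ, ∀ φ, T φ = S (d φ) := by
  have hker : LinearMap.ker d ≤ LinearMap.ker T := fun φ hφ => by
    have h1 := h φ
    rw [LinearMap.mem_ker.mp hφ, norm_zero, mul_zero] at h1
    exact LinearMap.mem_ker.mpr (norm_le_zero_iff.mp h1)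
  let S₀ : LinearMap.range d →ₗ[ℂ] ℂ :=
    (LinearMap.ker d).liftQ T hker ∘ₗ d.quotKerEquivRange.symm.toLinearMap
  have hS₀ : ∀ φ, S₀ ⟨d φ, LinearMap.mem_range_self d φ⟩ = T φ := fun φ => by
    have h1 : d.quotKerEquivRange.symm ⟨d φ, LinearMap.mem_range_self d φ⟩ =
        (LinearMap.ker d).mkQ φ := by
      rw [LinearEquiv.symm_apply_eq]
      rfl
    change (LinearMap.ker d).liftQ T hker (d.quotKerEquivRange.symm _) = _
    rw [h1]
    rfl
  have hb : ∀ w, ‖S₀ w‖ ≤ C * ‖w‖ := by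
    rintro ⟨_, φ, rfl⟩
    rw [hS₀]
    exact h φ
  obtain ⟨S, hS, _⟩ := exists_extension_norm_eq (LinearMap.range d) (S₀.mkContinuous C hb)
  refine ⟨S, fun φ => ?_⟩
  have := hS ⟨d φ, LinearMap.mem_range_self d φ⟩
  exact ((hS₀ φ).symm.trans this.symm)

variable {E : Type*} [NormedAddCommGroup E] [NormedSpace ℂ E] [FiniteDimensional ℂ E]
  {X : Type*} [TopologicalSpace X] [ChartedSpace E X] [IsManifold 𝓘(ℂ, E) ω X] {k m : ℕ}

variable (E X k) in
/-- The exterior derivative as a linear map. -/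
def dLinear : Form E X k →ₗ[ℂ] Form E X (k + 1) where
  toFun := Form.d
  map_add' φ ψ := Subtype.ext (extD_add φ.2 ψ.2)
  map_smul' c φ := Subtype.ext (extD_smul c φ.2)

namespace DiscCover

variable (D : DiscCover E X)

/-- The sup norm over the discs is dominated by finitely many seminorms of order zero of the `C^∞`
topology. -/
theorem continuous_lift_toCont (f : Form E X k →ₗ[ℂ] D.SupSpace k)
    (hf : ∀ φ, f φ = D.lift φ.toCont) : Continuous f := by
  classical
  have hw : WithSeminorms (fun i => formSeminorm (E := E) (X := X) k i) := ⟨rfl⟩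
  let idx : X → SeminormIndex E X := fun i =>
    ⟨chartAt E i, chart_mem_atlas E i, D.disc i, D.isCompact_disc i, D.disc_subset i, 0⟩
  refine hw.continuous_normedSpace_rng (D.SupSpace k) f ⟨D.points.image idx, 1, fun φ => ?_⟩
  rw [one_smul, Seminorm.comp_apply, coe_normSeminorm, hf]
  refine D.norm_lift_le (apply_nonneg _ _) fun i hi y hy => ?_
  refine le_trans ?_ (Seminorm.le_finset_sup_apply (Finset.mem_image_of_mem idx hi))
  have h := le_ciSup (bddAbove_seminorm φ (idx i)) ⟨y, hy⟩
  refine le_trans (le_of_eq ?_) h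
  exact (norm_iteratedFDeriv_zero (𝕜 := ℝ) (f := inChart φ.val (chartAt E i)) (x := y)).symm

variable (k) in
/-- The expressions of a smooth form on the discs. -/
def formLift : Form E X k →L[ℂ] D.SupSpace k :=
  let f : Form E X k →ₗ[ℂ] D.SupSpace k :=
    { toFun := fun φ => D.lift φ.toCont
      map_add' := fun _ _ => SupSpace.ext fun _ _ => rfl
      map_smul' := fun _ _ => SupSpace.ext fun _ _ => rfl }
  ⟨f, D.continuous_lift_toCont f fun _ => rfl⟩

variable (m) in
/-- The cone of tuples that are positive on complex planes. -/
def cone : Set (D.SupSpace (2 * m)) := {f | ∀ i y, FramePos (f i y)}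

/-- The discs are compact and pointwise positivity is open, so in each component this is an open
condition of the compact-open topology. -/
theorem isOpen_cone (hE : Module.finrank ℂ E = m + 1) : IsOpen (D.cone m) := by
  have h : D.cone m = ⋂ i : D.points, (fun f : D.SupSpace (2 * m) => f i) ⁻¹'
      {h : C(D.disc i, E [⋀^Fin (2 * m)]→L[ℝ] ℂ) | Set.MapsTo h Set.univ {α | FramePos α}} := by
    ext f
    rw [Set.mem_iInter]
    exact ⟨fun h i y _ => h i y, fun h i y => h i (Set.mem_univ y)⟩
  rw [h]
  refine isOpen_iInter_of_finite fun i => ?_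
  refine IsOpen.preimage ?_ (ContinuousMap.isOpen_setOfPred_mapsTo isCompact_univ
    (isOpen_setOf_framePos hE))
  exact continuous_apply (A := fun i : D.points => C(D.disc i, E [⋀^Fin (2 * m)]→L[ℝ] ℂ)) i

theorem convex_cone : Convex ℝ (D.cone m) := by
  intro f hf g hg a b ha hb hab i y v hv
  have h1 := hf i y v hv
  have h2 := hg i y v hv
  have h3 : ((a • f + b • g : D.SupSpace (2 * m)) i y) (complexFrame v) =
    a * (f i y) (complexFrame v) + b * (g i y) (complexFrame v) := rfl
  rw [h3, Complex.add_re, Complex.re_ofReal_mul, Complex.re_ofReal_mul]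
  rcases ha.eq_or_lt with rfl | ha
  · rw [zero_add] at hab
    rw [hab]
    simpa using h2
  · exact add_pos_of_pos_of_nonneg (mul_pos ha h1) (mul_nonneg hb h2.le)

/-- Differentials of charts are complex linear and injective, so they carry independent complex
frames to independent complex frames. -/
theorem lift_mem_cone_iff {u : ContForm E X (2 * m)} :
    D.lift u ∈ D.cone m ↔ ∀ x, FramePos (u.1 x) := by
  constructor
  · intro h x
    obtain ⟨i, hi, hs, hb⟩ := D.exists_mem x
    have hy : chartAt E i x ∈ D.disc i :=
      Metric.ball_subset_closedBall (Metric.ball_subset_ball (by linarith [D.radius_pos i]) hb)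
    have h1 : FramePos (inChart u.1 (chartAt E i) (chartAt E i x)) := h ⟨i, hi⟩ ⟨_, hy⟩
    have h2 := h1.comp _ (injective_mfderiv (chart_mem_atlas E i) hs)
    intro v hv
    exact (h2 v hv).trans_eq (congrArg Complex.re
      (inChart_apply_mfderiv u.1 (chart_mem_atlas E i) hs (complexFrame v)))
  · intro h i y
    exact (h _).comp _ (injective_mfderiv_symm (chart_mem_atlas E (i : X)) (D.disc_subset i y.2))

end DiscCover

end Duality

/-! ### Construction of the current by the Hahn-Banach theorem. -/

section Separation

open scoped ComplexOrder

variable {E : Type*} [NormedAddCommGroup E] [NormedSpace ℂ E] [FiniteDimensional ℂ E]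
  {X : Type*} [TopologicalSpace X] [ChartedSpace E X] [IsManifold 𝓘(ℂ, E) ω X] {k m : ℕ}

/-- Since `G` vanishes on closed forms, `φ` may be replaced by its difference from a closed form,
whose norm is controlled by `dφ`. The approximation is available in positive degree only. -/
theorem DiscCover.exists_bound_of_closed [CompactSpace X] [T2Space X] (D : DiscCover E X)
    {j : ℕ} (hj : j ≠ 0) (G : D.SupSpace j →L[ℂ] ℂ)
    (hG : ∀ ζ ∈ closedForms E X j, G (D.lift ζ) = 0) :
    ∃ C : ℝ, ∀ φ : Form E X j, ‖G (D.formLift j φ)‖ ≤ C * ‖D.formLift (j + 1) φ.d‖ := by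
  obtain ⟨k, rfl⟩ : ∃ k, j = k + 1 := Nat.exists_eq_add_one_of_ne_zero hj
  obtain ⟨C, hC0, hC⟩ := D.exists_closed_approx k
  refine ⟨‖G‖ * C, fun φ => ?_⟩
  obtain ⟨ζ, hζ, hb⟩ := hC φ.toCont φ.2
  have h1 : G (D.formLift (k + 1) φ) = G (D.lift (φ.toCont - ζ)) := by
    rw [D.lift_sub, map_sub, hG ζ hζ, sub_zero]
    rfl
  rw [h1, mul_assoc]
  exact (G.le_opNorm _).trans (mul_le_mul_of_nonneg_left hb (norm_nonneg _))

/-- The open convex cone is disjoint from the real subspace of closed forms, so a hyperplane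
separates them. -/
theorem DiscCover.exists_functional [CompactSpace X] [T2Space X] (D : DiscCover E X)
    (hE : Module.finrank ℂ E = m + 1)
    (h : ∀ ζ ∈ closedForms E X (2 * m), ∃ x, ¬ FramePos (ζ.1 x)) :
    ∃ G : D.SupSpace (2 * m) →L[ℂ] ℂ, (∀ f ∈ D.cone m, 0 < (G f).re) ∧
      ∀ ζ ∈ closedForms E X (2 * m), G (D.lift ζ) = 0 := by
  let B : Submodule ℝ (D.SupSpace (2 * m)) := (closedForms E X (2 * m)).map D.lift
  have hdisj : Disjoint (D.cone m) (B : Set (D.SupSpace (2 * m))) := by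
    rw [Set.disjoint_left]
    rintro _ hf ⟨ζ, hζ, rfl⟩
    obtain ⟨x, hx⟩ := h ζ hζ
    exact hx (D.lift_mem_cone_iff.mp hf x)
  obtain ⟨f, u, hfu, huB⟩ := RCLike.geometric_hahn_banach_open (𝕜 := ℂ) D.convex_cone
    (D.isOpen_cone hE) B.convex hdisj
  have hu : u ≤ 0 := by simpa using huB 0 B.zero_mem
  have hB : ∀ a ∈ B, (f a).re = 0 := by
    intro a ha
    by_contra hne
    -- A real part bounded below on a subspace is zero: this multiple would have the value `u - 1`,
    -- less than the bound `u`.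
    have h1 := huB (((u - 1) / (f a).re) • a) (B.smul_mem _ ha)
    have h2 : f (((u - 1) / (f a).re) • a) = (((u - 1) / (f a).re : ℝ) : ℂ) * f a := by
      have h3 : ((u - 1) / (f a).re) • a = (((u - 1) / (f a).re : ℝ) : ℂ) • a := by
        exact (Complex.coe_smul _ _).symm
      rw [h3, map_smul, smul_eq_mul]
    rw [h2] at h1
    have h4 : ((((u - 1) / (f a).re : ℝ) : ℂ) * f a).re = u - 1 := by
      rw [Complex.re_ofReal_mul, div_mul_cancel₀ _ hne]
    have h5 : u ≤ u - 1 := h1.trans (le_of_eq h4)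
    linarith
  refine ⟨-f, fun a ha => ?_, fun ζ hζ => ?_⟩
  · have h1 : (f a).re < u := hfu a ha
    rw [neg_apply, Complex.neg_re]
    linarith
  · have h1 : (f (D.lift ζ)).re = 0 := hB _ ⟨ζ, hζ, rfl⟩
    -- Separation controls only the real part; closed forms are stable under multiplication by `i`,
    -- which settles the imaginary part.
    let ζ' : ContForm E X (2 * m) := ⟨Complex.I • ζ.1,
      IsSmooth.mem_contForm ((smoothForms E X (2 * m)).smul_mem _ hζ.1)⟩
    have hζ' : ζ' ∈ closedForms E X (2 * m) := by
      refine ⟨(smoothForms E X (2 * m)).smul_mem _ hζ.1, (extD_smul _ hζ.1).trans ?_⟩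
      rw [hζ.2]
      ext x v
      simp
    have h2 : (f (D.lift ζ')).re = 0 := hB _ ⟨ζ', hζ', rfl⟩
    have h3 : D.lift ζ' = Complex.I • D.lift ζ := DiscCover.SupSpace.ext fun i y => rfl
    rw [h3, map_smul, smul_eq_mul, Complex.I_mul_re] at h2
    rw [neg_apply, neg_eq_zero]
    exact Complex.ext h1 (neg_eq_zero.mp h2)

/-- If no closed form is positive on complex planes, then there is a positive exact current. -/
theorem exists_current [CompactSpace X] [T2Space X] (hm : m ≠ 0)
    (hE : Module.finrank ℂ E = m + 1)
    (h : ∀ ζ ∈ closedForms E X (2 * m), ∃ x, ¬ FramePos (ζ.1 x)) :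
    ∃ T : Current E X (2 * m), T ≠ 0 ∧ HasBidimension T m m ∧ IsNonneg T ∧ IsExact T := by
  obtain ⟨D⟩ := exists_discCover E X
  obtain ⟨G, hGpos, hG⟩ := D.exists_functional hE h
  obtain ⟨γ, hγ⟩ := exists_isPosDef E X
  let P : Form E X (2 * m) := ⟨fun x => wedgePow (γ.val x) m, isSmooth_wedgePow γ.2 m⟩
  have hP : ∀ x, FramePos (P.val x) := fun x => IsPosDef.framePos (E := E) (hγ x) hE
  let T : Current E X (2 * m) := G.comp (D.formLift (2 * m))
  have hPpos : 0 < (T P).re := hGpos _ (D.lift_mem_cone_iff.mpr hP)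
  have hnonneg : ∀ φ : Form E X (2 * m), (∀ x v, 0 ≤ (φ.val x (complexFrame v)).re) →
      0 ≤ (T φ).re := by
    intro φ hφ
    by_contra hneg
    rw [not_le] at hneg
    -- If the real part at `φ` were negative, this `ε` would give `φ + ε P` in the cone with real
    -- part of `T` equal to zero.
    set ε : ℝ := -(T φ).re / (T P).re with hε
    have hε0 : 0 < ε := div_pos (neg_pos.mpr hneg) hPpos
    have h1 : ∀ x, FramePos ((φ + (ε : ℂ) • P).val x) := by
      intro x v hv
      have h2 : (φ + (ε : ℂ) • P).val x (complexFrame v) =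
        φ.val x (complexFrame v) + ε * P.val x (complexFrame v) := rfl
      rw [h2, Complex.add_re, Complex.re_ofReal_mul]
      exact add_pos_of_nonneg_of_pos (hφ x v) (mul_pos hε0 (hP x v hv))
    have h3 : 0 < (T (φ + (ε : ℂ) • P)).re := hGpos _ (D.lift_mem_cone_iff.mpr h1)
    rw [map_add, map_smul, smul_eq_mul, Complex.add_re, Complex.re_ofReal_mul, hε,
      div_mul_cancel₀ _ hPpos.ne', add_neg_cancel] at h3
    exact lt_irrefl _ h3
  have hzero : ∀ φ : Form E X (2 * m), (∀ x v, (φ.val x (complexFrame v)).re = 0) →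
      (T φ).re = 0 := by
    intro φ hφ
    refine le_antisymm ?_ (hnonneg φ fun x v => (hφ x v).ge)
    have h1 := hnonneg ((-1 : ℂ) • φ) fun x v => by
      have h2 : ((-1 : ℂ) • φ).val x (complexFrame v) = -1 * φ.val x (complexFrame v) := rfl
      rw [h2, neg_one_mul, Complex.neg_re, hφ x v, neg_zero]
    rw [map_smul, smul_eq_mul, neg_one_mul, Complex.neg_re] at h1
    linarith
  have him : ∀ φ : Form E X (2 * m), (∀ x v, (φ.val x (complexFrame v)).im = 0) →
      (T φ).im = 0 := by
    intro φ hφ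
    have h1 := hzero (Complex.I • φ) fun x v => by
      have h2 : (Complex.I • φ).val x (complexFrame v) =
        Complex.I * φ.val x (complexFrame v) := rfl
      rw [h2, Complex.I_mul_re, hφ x v, neg_zero]
    rwa [map_smul, smul_eq_mul, Complex.I_mul_re, neg_eq_zero] at h1
  refine ⟨T, fun h0 => ?_, fun r s hrs φ hφ => ?_, fun φ hφ => ?_, ?_⟩
  · have h1 : (T P).re = 0 := by rw [h0]; rfl
    exact hPpos.ne' h1
  -- Forms of other types vanish on complex frames, and `T` ignores whatever complex frames do not
  -- see.
  · have h1 : ∀ x v, φ.val x (complexFrame v) = 0 := fun x v =>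
      IsType.apply_complexFrame_eq_zero (E := E) (hφ x) hrs v
    exact Complex.ext (hzero φ fun x v => by rw [h1]; rfl) (him φ fun x v => by rw [h1]; rfl)
  · have h1 : ∀ x v, 0 ≤ φ.val x (complexFrame v) := fun x v => (hφ x).2 v
    exact Complex.nonneg_iff.mpr ⟨hnonneg φ fun x v => (Complex.nonneg_iff.mp (h1 x v)).1,
      (him φ fun x v => (Complex.nonneg_iff.mp (h1 x v)).2.symm).symm⟩
  -- The estimate by `‖dφ‖` shows that `T` factors through `d` followed by the embedding into
  -- tuples; composing the extended functional with that embedding gives a current.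
  · obtain ⟨C, hC⟩ := D.exists_bound_of_closed (by omega) G hG
    obtain ⟨S, hS⟩ := exists_factor ((D.formLift (2 * m + 1)).toLinearMap ∘ₗ dLinear E X (2 * m))
      T.toLinearMap hC
    exact ⟨S.comp (D.formLift (2 * m + 1)), hS⟩

end Separation

/-! ### From closed positive forms to strongly Gauduchon metrics, and vanishing of positive exact
currents. -/

section Equivalence

open scoped ComplexOrder

variable {E : Type*} [NormedAddCommGroup E] [NormedSpace ℂ E] [FiniteDimensional ℂ E]
  {X : Type*} [TopologicalSpace X] [ChartedSpace E X] [IsManifold 𝓘(ℂ, E) ω X] {k m : ℕ}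

/-- A component of a smooth form. -/
def Form.typeProj (p : ℕ) (φ : Form E X k) : Form E X k :=
  ⟨fun x => StronglyGauduchon.typeProj p (φ.val x), isSmooth_typeProj p φ.2⟩

/-- The complex conjugate of a smooth form. -/
def Form.conj (φ : Form E X k) : Form E X k :=
  ⟨fun x => conjForm (φ.val x), isSmooth_conjForm φ.2⟩

/-- The powers of a smooth `2`-form. -/
def Form.wedgePow (γ : Form E X 2) (m : ℕ) : Form E X (2 * m) :=
  ⟨fun x => StronglyGauduchon.wedgePow (γ.val x) m, isSmooth_wedgePow γ.2 m⟩

theorem Form.sum_typeProj (φ : Form E X k) :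
    ∑ p ∈ Finset.range (k + 2), φ.typeProj p = φ := by
  refine Subtype.ext ?_
  refine Eq.trans ?_ (sum_typeProj_eq φ.val)
  exact map_sum (smoothForms E X k).subtype (fun p => φ.typeProj p) _

/-- A closed form that is positive on complex planes gives a strongly Gauduchon metric. -/
theorem exists_isStronglyGauduchon_of_closed (hm : m ≠ 0) (hE : Module.finrank ℂ E = m + 1)
    {ζ : ContForm E X (2 * m)} (hζ : ζ ∈ closedForms E X (2 * m))
    (hpos : ∀ x, FramePos (ζ.1 x)) : ∃ γ : Form E X 2, IsStronglyGauduchon (m + 1) γ := by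
  -- Adding the conjugate makes the form real without losing closedness; on complex frames it
  -- doubles the real part.
  let Ω : RoughForm E X (2 * m) := ζ.1 + fun x => conjForm (ζ.1 x)
  have hΩ : IsSmooth Ω := (smoothForms E X (2 * m)).add_mem hζ.1 (isSmooth_conjForm hζ.1)
  have hd : extD Ω = 0 := by
    refine (extD_add hζ.1 (isSmooth_conjForm hζ.1)).trans ?_
    rw [extD_conjForm hζ.1, hζ.2]
    ext x v
    simp
  have hval : ∀ x v, typeProj m (Ω x) (complexFrame v) =
      ((2 * (ζ.1 x (complexFrame v)).re : ℝ) : ℂ) := by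
    intro x v
    exact (typeProj_apply_complexFrame (E := E) (Ω x) v).trans (Complex.add_conj _)
  obtain ⟨γ, hγ, hγΩ⟩ := exists_metric_of_power (X := X) hm hE (isSmooth_typeProj m hΩ)
    (fun x => isType_typeProj_middle (E := E) (Ω x))
    (fun x v hv => by
      rw [hval, Complex.ofReal_re]
      exact mul_pos two_pos (hpos x v hv))
    (fun x v => by rw [hval, Complex.ofReal_im])
  -- The component of `dΩ = 0` of type `(m+1, m)` says that `∂` of the `(m, m)` part cancels `∂̄` of
  -- the `(m+1, m-1)` part.
  refine ⟨γ, hγ, ⟨-fun x => typeProj (m + 1) (Ω x),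
    (smoothForms E X (2 * m)).neg_mem (isSmooth_typeProj (m + 1) hΩ)⟩, ?_⟩
  have h1 : (fun x => wedgePow (γ.val x) m) = fun x => typeProj m (Ω x) := funext hγΩ
  exact (congrArg del h1).trans ((del_typeProj_eq_neg_delBar (by omega) hΩ hd).trans
    (delBar_neg _).symm)

theorem conjForm_wedgePow {γ : E [⋀^Fin 2]→L[ℝ] ℂ} (hγ : IsPosDef γ)
    (hE : Module.finrank ℂ E = m + 1) : conjForm (wedgePow γ m) = wedgePow γ m := by
  have hT := hγ.1.wedgePow m
  have h : conjForm (wedgePow γ m) + (-1 : ℂ) • wedgePow γ m = 0 := by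
    refine (hT.conjForm.add (hT.smul (-1))).eq_zero_of_complexFrame fun v => ?_
    rw [ContinuousAlternatingMap.add_apply, ContinuousAlternatingMap.smul_apply, conjForm_apply,
      Complex.conj_eq_iff_im.mpr (im_wedgePow_complexFrame hγ hE v)]
    simp
  ext v
  have h1 := congrArg (fun α : E [⋀^Fin (2 * m)]→L[ℝ] ℂ => α v) h
  have h2 : starRingEnd ℂ (wedgePow γ m v) + -1 * wedgePow γ m v = 0 := h1
  rw [neg_one_mul] at h2
  exact add_neg_eq_zero.mp h2

/-- For a real form of type `(m, m)`, the operators `∂` and `∂̄` are conjugate. -/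
theorem delBar_eq_conjForm_del {P : RoughForm E X (2 * m)} (hP : IsSmooth P)
    (hT : ∀ x, IsType m m (P x)) (hconj : ∀ x, conjForm (P x) = P x) (x : X) :
    delBar P x = conjForm (del P x) := by
  have h1 : extD P x = conjForm (extD P x) := by
    conv_lhs => rw [← funext hconj]
    rw [extD_conjForm hP]
  have hdel := isType_del hP hT x
  have hdelBar := isType_delBar hP hT x
  have h2 : extD P x = del P x + delBar P x := (congrFun (del_add_delBar P) x).symm
  have h3 : conjForm (extD P x) = conjForm (del P x) + conjForm (delBar P x) := by
    rw [h2]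
    ext v
    simp
  -- As `dP` is real, its component of type `(m, m+1)` can be computed from `∂̄P` or from the
  -- conjugate of `∂P`.
  have h4 : typeProj m (extD P x) = delBar P x := by
    rw [h2, typeProj_add, hdel.typeProj_eq (by omega), hdelBar.typeProj_eq (by omega),
      if_neg (by omega), if_pos rfl, zero_add]
  have h5 : typeProj m (conjForm (extD P x)) = conjForm (del P x) := by
    rw [h3, typeProj_add, hdel.conjForm.typeProj_eq (by omega),
      hdelBar.conjForm.typeProj_eq (by omega), if_pos rfl, if_neg (by omega), add_zero]
  rw [← h4, ← h5, ← h1]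

/-- Up to forms of other types, the power of a strongly Gauduchon metric is closed. -/
theorem extD_wedgePow_eq (hE : Module.finrank ℂ E = m + 1) {γ : Form E X 2}
    (hγ : ∀ x, IsPosDef (γ.val x)) {β : Form E X (2 * m)}
    (hβ : del (γ.wedgePow m).val = delBar β.val) :
    (γ.wedgePow m).d = (β.typeProj (m + 1) + (β.typeProj (m + 1)).conj).d := by
  have hP : IsSmooth (γ.wedgePow m).val := (γ.wedgePow m).2
  have hT : ∀ x, IsType m m ((γ.wedgePow m).val x) := fun x => (hγ x).1.wedgePow m
  have hη : IsSmooth (β.typeProj (m + 1)).val := (β.typeProj (m + 1)).2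
  -- For `m = 0` the subtraction is truncated, but then the component has the index one above the
  -- degree and is zero.
  have hηT : ∀ x, IsType (m + 1) (2 * m - (m + 1)) ((β.typeProj (m + 1)).val x) :=
    fun x => isType_typeProj (by omega) _
  have h1 : ∀ x, extD (β.typeProj (m + 1)).val x = del (γ.wedgePow m).val x := by
    intro x
    -- Its first degree `m + 2` exceeds the dimension `m + 1`.
    have h2 : del (β.typeProj (m + 1)).val x = 0 := by
      have := finiteDimensional_tangentSpace (E := E) x
      refine (isType_del hη hηT x).eq_zero_of_finrank_lt ?_
      change Module.finrank ℂ E < _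
      omega
    have h3 : delBar (β.typeProj (m + 1)).val x = del (γ.wedgePow m).val x := by
      refine (typeProj_delBar (by omega) β.2 x).symm.trans ?_
      have h4 := (isType_del hP hT x).typeProj_eq (p := m + 1) (by omega)
      rw [if_pos rfl] at h4
      rw [← h4]
      exact congrArg (typeProj (m + 1)) (congrFun hβ x).symm
    have h5 := congrFun (del_add_delBar (β.typeProj (m + 1)).val) x
    rw [← h5, Pi.add_apply, h2, h3, zero_add]
  refine Subtype.ext ?_
  refine Eq.trans ?_ (extD_add hη (isSmooth_conjForm hη)).symm
  rw [extD_conjForm hη]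
  funext x
  rw [Pi.add_apply, h1 x, ← delBar_eq_conjForm_del hP hT
    (fun x => conjForm_wedgePow (E := E) (hγ x) hE) x]
  exact (congrFun (del_add_delBar _) x).symm

/-- A nonnegative current that vanishes on the power of a metric vanishes on real forms. -/
theorem IsNonneg.eq_zero_of_real [CompactSpace X] {T : Current E X (2 * m)} (hT : IsNonneg T)
    (hE : Module.finrank ℂ E = m + 1) {γ : Form E X 2} (hγ : ∀ x, IsPosDef (γ.val x))
    (hTγ : T (γ.wedgePow m) = 0) {ψ : Form E X (2 * m)} (hψ : ψ.IsType m m)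
    (him : ∀ x v, (ψ.val x (complexFrame v)).im = 0) : T ψ = 0 := by
  obtain ⟨D⟩ := exists_discCover E X
  set P := γ.wedgePow m with hPdef
  have hP : ∀ x, FramePos (P.val x) := fun x => IsPosDef.framePos (E := E) (hγ x) hE
  have hPim : ∀ x v, (P.val x (complexFrame v)).im = 0 := fun x v =>
    im_wedgePow_complexFrame (E := E) (hγ x) hE v
  have hPT : ∀ x, IsType m m (P.val x) := fun x => (hγ x).1.wedgePow m
  have hcont : Continuous fun t : ℝ => D.formLift _ P + (t : ℂ) • D.formLift _ ψ := by fun_prop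
  have h0 : ∀ᶠ t : ℝ in 𝓝 0, D.formLift _ P + (t : ℂ) • D.formLift _ ψ ∈ D.cone m := by
    refine hcont.continuousAt.eventually ((D.isOpen_cone hE).mem_nhds ?_)
    beta_reduce
    rw [Complex.ofReal_zero, zero_smul, add_zero]
    exact D.lift_mem_cone_iff.mpr hP
  -- The power `P` of the metric is interior to the cone, so `P + tψ` is positive for small `t` of
  -- either sign. As `T P = 0`, the number `t T(ψ)` is then nonnegative for both signs.
  have key : ∀ t : ℝ, D.formLift _ P + (t : ℂ) • D.formLift _ ψ ∈ D.cone m →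
      0 ≤ (t : ℂ) * T ψ := by
    intro t ht
    rw [← map_smul, ← map_add] at ht
    have h1 := D.lift_mem_cone_iff.mp ht
    have h2 : ∀ x v, (P + (t : ℂ) • ψ).val x (complexFrame v) =
      P.val x (complexFrame v) + t * ψ.val x (complexFrame v) := fun x v => rfl
    have h3 : 0 ≤ T (P + (t : ℂ) • ψ) := by
      refine hT _ fun x => ⟨(hPT x).add ((hψ x).smul _), fun v => ?_⟩
      by_cases hv : LinearIndependent ℂ v
      · refine Complex.nonneg_iff.mpr ⟨(h1 x v hv).le, ?_⟩
        rw [h2, Complex.add_im, Complex.im_ofReal_mul, hPim, him, mul_zero, add_zero]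
      · exact (apply_complexFrame_of_not_linearIndependent (E := E) hv _).ge
    rwa [map_add, map_smul, smul_eq_mul, hTγ, zero_add] at h3
  obtain ⟨ε, hε, hball⟩ := Metric.eventually_nhds_iff.mp h0
  have h1 := key (ε / 2) (hball (by rw [Real.dist_eq, sub_zero, abs_of_pos (by positivity)]; linarith))
  have h2 := key (-(ε / 2)) (hball (by
    rw [Real.dist_eq, sub_zero, abs_neg, abs_of_pos (by positivity)]; linarith))
  have h3 : ((ε / 2 : ℝ) : ℂ) * T ψ = 0 := by
    refine le_antisymm ?_ h1
    rw [Complex.ofReal_neg, neg_mul] at h2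
    exact neg_nonneg.mp h2
  exact (mul_eq_zero.mp h3).resolve_left (by exact_mod_cast (by positivity : ε / 2 ≠ 0))

/-- On a manifold with a strongly Gauduchon metric, positive exact currents vanish. -/
theorem eq_zero_of_isStronglyGauduchon [CompactSpace X] (hE : Module.finrank ℂ E = m + 1)
    {γ : Form E X 2} (hγ : IsStronglyGauduchon (m + 1) γ) {T : Current E X (2 * m)}
    (hT : HasBidimension T m m) (hT0 : IsNonneg T) (hTd : IsExact T) : T = 0 := by
  obtain ⟨hpos, β, hβ⟩ := hγ
  obtain ⟨S, hS⟩ := hTd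
  -- An exact current sees only `dγ^m`, which is also the differential of a sum of forms whose types
  -- differ from `(m, m)`; on these `T` vanishes.
  have hTP : T (γ.wedgePow m) = 0 := by
    rw [hS, extD_wedgePow_eq hE hpos (β := β) hβ, ← hS, map_add,
      hT (m + 1) (2 * m - (m + 1)) (fun h => by simp at h) (β.typeProj (m + 1))
        fun x => isType_typeProj (by omega) _,
      hT (2 * m - (m + 1)) (m + 1) (fun h => by simp at h) (β.typeProj (m + 1)).conj
        fun x => (isType_typeProj (by omega) _).conjForm, add_zero]
  have hmid : ∀ φ : Form E X (2 * m), T (φ.typeProj m) = 0 := by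
    intro φ
    set χ := φ.typeProj m with hχ
    have hχT : χ.IsType m m := fun x => isType_typeProj_middle (E := E) (φ.val x)
    have h1 : T (χ + χ.conj) = 0 :=
      hT0.eq_zero_of_real hE hpos hTP (fun x => (hχT x).add (hχT x).conjForm) fun x v => by
        change (χ.val x (complexFrame v) + starRingEnd ℂ (χ.val x (complexFrame v))).im = 0
        simp
    -- Both `χ + χ̄` and `i(χ - χ̄)` are real, and they determine `χ`.
    have h2 : T (Complex.I • χ + (-Complex.I) • χ.conj) = 0 :=
      hT0.eq_zero_of_real hE hpos hTP
        (fun x => ((hχT x).smul _).add ((hχT x).conjForm.smul _)) fun x v => by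
        change (Complex.I * χ.val x (complexFrame v) +
          -Complex.I * starRingEnd ℂ (χ.val x (complexFrame v))).im = 0
        simp
    rw [map_add] at h1
    rw [map_add, map_smul, map_smul, smul_eq_mul, smul_eq_mul] at h2
    linear_combination (1 / 2 : ℂ) * h1 - (Complex.I / 2) * h2 +
      (1 / 2) * (T χ - T χ.conj) * Complex.I_sq
  ext φ
  rw [← φ.sum_typeProj, map_sum, Finset.sum_eq_zero]
  · rfl
  · intro p hp
    by_cases hpm : p = m
    · rw [hpm]
      exact hmid φ
    · refine hT p (2 * m - p) (fun h => hpm (Prod.mk.inj h).1) _ fun x =>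
        isType_typeProj (by simp at hp; omega) _

theorem eq_zero_of_subsingleton [Subsingleton E] (φ : RoughForm E X (k + 1)) : φ = 0 := by
  funext x
  ext v
  exact (φ x).map_coord_zero 0 (Subsingleton.elim (α := E) _ _)

theorem del_wedgePow_zero (γ : RoughForm E X 2) : del (fun x => wedgePow (γ x) 0) = 0 := by
  funext x
  ext v
  have h1 : inChart (fun x => wedgePow (γ x) 0) (chartAt E x) = fun _ => wedgePow 0 0 := by
    ext y v
    rfl
  have h2 : ∀ w, localDel (inChart (fun x => wedgePow (γ x) 0) (chartAt E x)) (chartAt E x x) w =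
      0 := by
    intro w
    rw [localDel_apply, h1]
    refine Finset.sum_eq_zero fun i _ => ?_
    rw [fderiv_const_apply]
    simp
  exact h2 _

end Equivalence

end StronglyGauduchon

end

theorem proposition3p3 {E : Type*} [NormedAddCommGroup E] [NormedSpace ℂ E]
    [FiniteDimensional ℂ E] {X : Type*} [TopologicalSpace X] [T2Space X] [CompactSpace X]
    [ChartedSpace E X] [IsManifold 𝓘(ℂ, E) ω X] (n : ℕ) (hn : Module.finrank ℂ E = n) :
    (∃ γ : StronglyGauduchon.Form E X 2, StronglyGauduchon.IsStronglyGauduchon n γ) ↔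
      ¬ ∃ T : StronglyGauduchon.Current E X (2 * (n - 1)),
        T ≠ 0 ∧ StronglyGauduchon.HasBidimension T (n - 1) (n - 1) ∧
          StronglyGauduchon.IsNonneg T ∧ StronglyGauduchon.IsExact T := by
  open StronglyGauduchon in
  rcases n with _ | m
  -- Here `n - 1` is truncated to `0`. On a manifold of dimension zero all forms of positive degree
  -- vanish, so positive definiteness is vacuous and every exact current is zero.
  · have : Subsingleton E := Module.finrank_zero_iff.mp hn
    refine iff_of_true ⟨0, fun x => ⟨fun c v => ?_, fun v hv => ?_⟩, 0, ?_⟩ ?_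
    · exact (mul_zero _).symm
    · exact (hv (Subsingleton.elim (α := E) _ _)).elim
    · rw [eq_zero_of_subsingleton (del _), eq_zero_of_subsingleton (delBar _)]
    · rintro ⟨T, hT, -, -, S, hS⟩
      refine hT (ContinuousLinearMap.ext fun φ => ?_)
      have h : φ.d = 0 := Subtype.ext (eq_zero_of_subsingleton _)
      rw [hS, h, map_zero]
      rfl
  · constructor
    · rintro ⟨γ, hγ⟩ ⟨T, hT, hbi, hnonneg, hex⟩
      exact hT (eq_zero_of_isStronglyGauduchon hn hγ hbi hnonneg hex)
    · intro h
      -- On a curve `γ^0 = 1` is closed and every metric is strongly Gauduchon; the separation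
      -- argument needs positive degree `2m`.
      by_cases hm : m = 0
      · subst hm
        obtain ⟨γ, hγ⟩ := exists_isPosDef E X
        exact ⟨γ, hγ, 0, (del_wedgePow_zero γ.val).trans delBar_zero.symm⟩
      · by_contra hcon
        refine h (exists_current hm hn fun ζ hζ => ?_)
        by_contra hpos
        push Not at hpos
        exact hcon (exists_isStronglyGauduchon_of_closed hm hn hζ hpos)
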